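/- Let $M$ be a smooth (Hausdorff, second countable) manifold of dimension $n$ and $R=\mathcal C^\infty(M)$. A \emph{Weil algebra} is a finite-dimensional local commutative $\mathbb R$-algebra with residue field $\mathbb R$; its \emph{width} is $\dim_{\mathbb R}\mathfrak m_A/\mathfrak m_A^2$. A \emph{jet} of $M$ is an ideal $\mathfrak p\subset R$ such that $R/\mathfrak p$ is a Weil algebra; it is of \emph{type} $A$ if $R/\mathfrak p\simeq A$, and there is a unique $x\in M$ (the point of $\mathfrak p$) such that all the functions in $\mathfrak p$ vanish at $x$. Put $T_{\mathfrak p}M=\mathrm{Der}_{\mathbb R}(R,R/\mathfrak p)/\mathrm{Der}_{\mathbb R}(R/\mathfrak p,R/\mathfrak p)$. For jets $\mathfrak p\subseteq\mathfrak p'$ and $f\in\mathfrak p$ let $d'_{\mathfrak p}f\colon T_{\mathfrak p}M\to R/\mathfrak p'$, $[D]\mapsto Df \bmod \mathfrak p'$; the contact system of the pair is $\Omega_{(\mathfrak p,\mathfrak p')}=\{d'_{\mathfrak p}f: f\in\mathfrak p\}\subseteq \mathrm{Hom}_R(T_{\mathfrak p}M,R/\mathfrak p')$. For a Weil algebra $A'$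 let $\check M^{A'}$ be the manifold of surjective $\mathbb R$-algebra morphisms $P\colon R\to A'$, whose smooth structure is the one in which the real components $f_\eta\colon P\mapsto \eta(P(f))$ ($f\in R$, $\eta$ a linear form on $A'$) are smooth and generate locally all smooth functions; let $\mathbb M^{A'}$ be the manifold of jets of type $A'$, the quotient of $\check M^{A'}$ by $\mathrm{Aut}\,A'$ through $P\mapsto\ker P$ (a function on it is smooth if and only if its pull-back to $\check M^{A'}$ is). Tangent vectors at a point are the derivations of the smooth functions at that point. The \emph{prolongation} of an ideal $I\subseteq R$ to $\mathcal C^\infty(\mathbb M^{A'})$ is the ideal of those $F$ whose pull-back to $\check M^{A'}$ lies in the ideal generated by all $f_\eta$ with $f\in I$. There is a canonical $\mathbb R$-linear isomorphism $\kappa\colon T_{\mathfrak p'}M\simeq T_{\mathfrak p'}\mathbb M^{A'}$: it sends the class of $D\colon R\to R/\mathfrak p'$ to the image in $T_{\mathfrak p'}\mathbb M^{A'}$ of the tangent vector $V$ of $\check M^{A'}$ at $P$ with $V f_\eta=\eta(\bar P(Df))$ for all $f,\eta$, where $P$ is any point with $\ker P=\mathfrak p'$ and $\bar P\colon R/\mathfrak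 p'\to A'$ is the induced isomorphism. \textbf{Theorem.} Let $\mathfrak p$ be a jet of $M$. (1) Let $\mathfrak p'\supseteq\mathfrak p$ be a jet of type $A'$ such that every derivation of $R/\mathfrak p$ leaves stable the kernel of $R/\mathfrak p\to R/\mathfrak p'$. Then the projection $\pi_*\colon T_{\mathfrak p}M\to T_{\mathfrak p'}M$, $[D]\mapsto[D\bmod\mathfrak p']$, is well defined, $\kappa\circ\pi_*$ is surjective, and under the resulting inclusion $T^*_{\mathfrak p'}\mathbb M^{A'}\hookrightarrow \mathrm{Hom}_{\mathbb R}(T_{\mathfrak p}M,\mathbb R)$ the space $\{d_{\mathfrak p'}F: F\in\text{prolongation of }\mathfrak p\}$ coincides with the span of the real components $\eta\circ\xi$ of the contact system ($\xi\in\Omega_{(\mathfrak p,\mathfrak p')}$, $\eta$ a linear form on $R/\mathfrak p'$). (2) Let $m$ be the width of $R/\mathfrak p$, let the Cartan system $\mathcal C_{\mathfrak p}\subseteq T_{\mathfrak p}M$ be the submodule generated by the classes of the fields on $M$ tangent to some embedded $m$-dimensional submanifold $X$ that contains the point of $\mathfrak p$ and whose ideal $I(X)$ is contained in $\mathfrak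 p$ (tangent to $X$: mapping $I(X)$ into itself), and let $\mathfrak p'=\mathfrak p+(Df: [D]\in\mathcal C_{\mathfrak p},\,f\in\mathfrak p)$ be the derived ideal, $\Omega_{\mathfrak p}=\Omega_{(\mathfrak p,\mathfrak p')}$. Then $\mathfrak p'$ is a jet satisfying the stability condition of (1), so that (1) holds for $\Omega_{\mathfrak p}$ and every Weil algebra $A'\simeq R/\mathfrak p'$. Moreover the real components of $\Omega_{\mathfrak p}$ are the differentials at $\mathfrak p'$ of the real components of the prolongation of $\mathfrak p$: through each $P\in\check M^{A'}$ over $\mathfrak p'$ passes a local smooth section $s$ of $\check M^{A'}\to\mathbb M^{A'}$, and for each such $s$, each $f\in\mathfrak p$ and each linear form $\eta$ on $A'$, the function $f_\eta\circ s$ coincides near $\mathfrak p'$ with an element of the prolongation of $\mathfrak p$, and its differential at $\mathfrak p'$ is $[D]\mapsto\eta(\bar P(d'_{\mathfrak p}f\,[D]))$. -/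

import Mathlib

open scoped Manifold ContDiff Topology

noncomputable section

/-! ## Weil algebras and jets of an `ℝ`-algebra `R` (to be used with `R = C^∞(M)`) -/

/-- A Weil algebra: a finite dimensional, local, rational `ℝ`-algebra
(rational: the residue field is `ℝ`). -/
class IsWeilAlgebra (A : Type*) [CommRing A] [Algebra ℝ A] : Prop extends IsLocalRing A where
  finite : Module.Finite ℝ A
  rational : Function.Surjective (algebraMap ℝ (IsLocalRing.ResidueField A))

/-- The width of a Weil algebra: the dimension of `𝔪_A / 𝔪_A ^ 2`. -/
def weilWidth (A : Type*) [CommRing A] [Algebra ℝ A] [IsWeilAlgebra A] : ℕ :=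
  Module.finrank ℝ (IsLocalRing.maximalIdeal A).Cotangent

/-- A jet: an ideal whose quotient is a Weil algebra. -/
abbrev IsJet {R : Type*} [CommRing R] [Algebra ℝ R] (p : Ideal R) : Prop :=
  IsWeilAlgebra (R ⧸ p)

section Algebraic

variable {R : Type*} [CommRing R] [Algebra ℝ R]

/-- The derivations `R → R ⧸ p` induced by the derivations of the ring `R ⧸ p` to itself. -/
def inducedDerivations (p : Ideal R) : Submodule R (Derivation ℝ R (R ⧸ p)) :=
  LinearMap.range ((Derivation.compAlgebraMapL ℝ R (R ⧸ p) (R ⧸ p)).restrictScalars R)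

theorem mem_inducedDerivations_iff (p : Ideal R) (D : Derivation ℝ R (R ⧸ p)) :
    D ∈ inducedDerivations p ↔ ∀ f ∈ p, D f = 0 := by
  constructor
  · rintro ⟨δ, rfl⟩ f hf
    change δ (Ideal.Quotient.mk p f) = 0
    rw [Ideal.Quotient.eq_zero_iff_mem.mpr hf, map_zero]
  · intro h
    have hle : p.restrictScalars ℝ ≤ LinearMap.ker (D : R →ₗ[ℝ] (R ⧸ p)) := fun f hf => h f hf
    refine ⟨Derivation.mk' ((p.restrictScalars ℝ).liftQ (D : R →ₗ[ℝ] (R ⧸ p)) hle) ?_, ?_⟩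
    · intro a b
      obtain ⟨a, rfl⟩ := Ideal.Quotient.mk_surjective a
      obtain ⟨b, rfl⟩ := Ideal.Quotient.mk_surjective b
      change D (a * b) = Ideal.Quotient.mk p a * D b + Ideal.Quotient.mk p b * D a
      rw [D.leibniz]
      rfl
    · ext f
      rfl

/-- The tangent module `T_p M = Der(R, R ⧸ p) / Der(R ⧸ p, R ⧸ p)` at `p`. -/
abbrev TangentModule (p : Ideal R) : Type _ :=
  Derivation ℝ R (R ⧸ p) ⧸ inducedDerivations p

/-- The class `[D] ∈ T_p M` of a derivation `D : R → R ⧸ p`. -/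
def tangentClass (p : Ideal R) : Derivation ℝ R (R ⧸ p) →ₗ[R] TangentModule p :=
  (inducedDerivations p).mkQ

/-- The value at `p` of a field (a derivation of `R`), as a derivation `R → R ⧸ p`. -/
def fieldValue (p : Ideal R) : Derivation ℝ R R →ₗ[R] Derivation ℝ R (R ⧸ p) :=
  (Submodule.mkQ p).compDer

/-- The quotient map `R ⧸ p → R ⧸ p'`, as a map of `R`-modules. -/
def quotientProj {p p' : Ideal R} (h : p ≤ p') : (R ⧸ p) →ₗ[R] (R ⧸ p') :=
  Submodule.factor h

/-- `d'_p f : T_p M → R ⧸ p'`, `[D] ↦ [D f] mod p'`, for `p ⊆ p'` and `f ∈ p`. -/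
def pairDifferential {p p' : Ideal R} (h : p ≤ p') :
    p →ₗ[R] (TangentModule p →ₗ[R] (R ⧸ p')) where
  toFun f := (inducedDerivations p).liftQ
    { toFun := fun D => quotientProj h (D f)
      map_add' := fun D E => by simp
      map_smul' := fun a D => by simp }
    (fun D hD => by
      have := (mem_inducedDerivations_iff p D).mp hD f f.2
      simp [this])
  map_add' f g := by
    ext D
    change quotientProj h (D (f + g : R)) = quotientProj h (D f) + quotientProj h (D g)
    simp
  map_smul' a f := by
    ext D
    change quotientProj h (D (a * f : R)) = a • quotientProj h (D f)
    have hf : (f : R) • D a ∈ LinearMap.ker (quotientProj h) := by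
      obtain ⟨b, hb⟩ := Ideal.Quotient.mk_surjective (D a)
      rw [← hb]
      change Ideal.Quotient.mk p' ((f : R) * b) = 0
      exact Ideal.Quotient.eq_zero_iff_mem.mpr (p'.mul_mem_right _ (h f.2))
    rw [D.leibniz, map_add, LinearMap.mem_ker.mp hf, map_smul, add_zero]

/-- The contact system `Ω_(p,p') = {d'_p f | f ∈ p}` of the pair `p ⊆ p'`. -/
def contactSystemPair {p p' : Ideal R} (h : p ≤ p') :
    Submodule R (TangentModule p →ₗ[R] (R ⧸ p')) :=
  LinearMap.range (pairDifferential h)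

/-- The real components of a submodule `Ω ⊆ Hom(T_p M, R ⧸ p')`: the subspace of the real dual of
`T_p M` spanned by the compositions of the elements of `Ω` with the linear forms on `R ⧸ p'`. -/
def realComponents {p p' : Ideal R} (Ω : Submodule R (TangentModule p →ₗ[R] (R ⧸ p'))) :
    Submodule ℝ (Module.Dual ℝ (TangentModule p)) :=
  Submodule.span ℝ {c | ∃ ξ ∈ Ω, ∃ η : Module.Dual ℝ (R ⧸ p'), c = η ∘ₗ ξ.restrictScalars ℝ}

/-- For `p ⊆ p'`: the derivations of `A = R ⧸ p` leave stable the kernel of `A → R ⧸ p'`. -/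
def IsDerStable {p p' : Ideal R} (h : p ≤ p') : Prop :=
  ∀ δ : Derivation ℝ (R ⧸ p) (R ⧸ p),
    ∀ a ∈ RingHom.ker (Ideal.Quotient.factor h), δ a ∈ RingHom.ker (Ideal.Quotient.factor h)

/-- The map `T_p M → T_p' M`, `[D] ↦ [D mod p']`, for `p ⊆ p'` with the stability condition. -/
def tangentProj {p p' : Ideal R} (h : p ≤ p') (hs : IsDerStable h) :
    TangentModule p →ₗ[R] TangentModule p' :=
  Submodule.mapQ (inducedDerivations p) (inducedDerivations p') (quotientProj h).compDer (by
    rintro _ ⟨δ, rfl⟩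
    refine (mem_inducedDerivations_iff p' _).mpr fun f hf => ?_
    have hk : Ideal.Quotient.mk p f ∈ RingHom.ker (Ideal.Quotient.factor h) := by
      rw [RingHom.mem_ker, Ideal.Quotient.factor_mk]
      exact Ideal.Quotient.eq_zero_iff_mem.mpr hf
    exact hs δ _ hk)

/-! ## Regular `A`-points, jets of type `A`, and their smooth functions -/

variable (R) in
/-- The set of regular `A`-points: surjective morphisms of `ℝ`-algebras `R → A`. -/
abbrev RegularPoint (A : Type*) [CommRing A] [Algebra ℝ A] : Type _ :=
  {P : R →ₐ[ℝ] A // Function.Surjective P}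

variable (R) in
/-- The set of jets of type `A`: ideals `q` of `R` with `R ⧸ q ≃ A`. -/
abbrev JetSpace (A : Type*) [CommRing A] [Algebra ℝ A] : Type _ :=
  {q : Ideal R // Nonempty ((R ⧸ q) ≃ₐ[ℝ] A)}

variable {A : Type*} [CommRing A] [Algebra ℝ A]

/-- The projection `P ↦ ker P` from regular `A`-points to jets of type `A`. -/
def jetOf (P : RegularPoint R A) : JetSpace R A :=
  ⟨RingHom.ker P.1, ⟨Ideal.quotientKerAlgEquivOfSurjective P.2⟩⟩

/-- The isomorphism `R ⧸ q → A` induced by a regular `A`-point `P` with kernel `q`. -/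
def residueMap (P : RegularPoint R A) {q : JetSpace R A} (h : jetOf P = q) : (R ⧸ q.1) →ₐ[ℝ] A :=
  Ideal.Quotient.liftₐ q.1 P.1 (fun f hf => by subst h; exact hf)

/-- The real component `f_η` of `f ∈ R` with respect to a linear form `η` on `A`. The components of
`f` with respect to a basis of `A` are those given by the dual basis. -/
def component (η : Module.Dual ℝ A) (f : R) (P : RegularPoint R A) : ℝ := η (P.1 f)

/-- The topology of the space of regular `A`-points, induced by all the real components. -/
instance : TopologicalSpace (RegularPoint R A) :=
  TopologicalSpace.induced
    (fun P => fun i : Module.Dual ℝ A × R => component i.1 i.2 P) inferInstance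

/-- The quotient topology of the space of jets of type `A`. -/
instance : TopologicalSpace (JetSpace R A) :=
  TopologicalSpace.coinduced jetOf inferInstance

variable (R A) in
/-- The algebra of smooth functions on the manifold of regular `A`-points: the functions which
locally are smooth functions of finitely many real components. (The manifold structure is the one
for which the real components of functions of `R` are smooth and contain local coordinates.) -/
def smoothPoint : Subalgebra ℝ (RegularPoint R A → ℝ) where
  carrier := {F | ∀ P, ∃ (ι : Type) (_ : Fintype ι) (η : ι → Module.Dual ℝ A) (f : ι → R)
    (Φ : (ι → ℝ) → ℝ), ContDiff ℝ ∞ Φ ∧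
      ∀ᶠ Q in 𝓝 P, F Q = Φ (fun i => component (η i) (f i) Q)}
  algebraMap_mem' c P := ⟨Empty, inferInstance, Empty.elim, Empty.elim, fun _ => c,
    contDiff_const, Filter.Eventually.of_forall fun _ => rfl⟩
  add_mem' {F G} hF hG P := by
    obtain ⟨ι, _, η, f, Φ, hΦ, h⟩ := hF P
    obtain ⟨κ, _, θ, g, Ψ, hΨ, k⟩ := hG P
    refine ⟨ι ⊕ κ, inferInstance, Sum.elim η θ, Sum.elim f g,
      fun x => Φ (fun i => x (Sum.inl i)) + Ψ (fun i => x (Sum.inr i)), ?_, ?_⟩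
    · exact (hΦ.comp (by fun_prop)).add (hΨ.comp (by fun_prop))
    · filter_upwards [h, k] with Q h k
      simp [h, k]
  mul_mem' {F G} hF hG P := by
    obtain ⟨ι, _, η, f, Φ, hΦ, h⟩ := hF P
    obtain ⟨κ, _, θ, g, Ψ, hΨ, k⟩ := hG P
    refine ⟨ι ⊕ κ, inferInstance, Sum.elim η θ, Sum.elim f g,
      fun x => Φ (fun i => x (Sum.inl i)) * Ψ (fun i => x (Sum.inr i)), ?_, ?_⟩
    · exact (hΦ.comp (by fun_prop)).mul (hΨ.comp (by fun_prop))
    · filter_upwards [h, k] with Q h k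
      simp [h, k]

/-- The real components are smooth functions. -/
def smoothComponent (η : Module.Dual ℝ A) (f : R) : smoothPoint R A :=
  ⟨component η f, fun _ => ⟨Unit, inferInstance, fun _ => η, fun _ => f, fun x => x (),
    by fun_prop, Filter.Eventually.of_forall fun _ => rfl⟩⟩

variable (R A) in
/-- Composition with `P ↦ ker P`, on arbitrary real functions. -/
def jetPullbackFun : (JetSpace R A → ℝ) →ₐ[ℝ] (RegularPoint R A → ℝ) where
  toFun F := fun P => F (jetOf P)
  map_one' := rfl
  map_mul' _ _ := rfl
  map_zero' := rfl
  map_add' _ _ := rfl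
  commutes' _ := rfl

variable (R A) in
/-- The algebra of smooth functions on the manifold of jets of type `A`, the quotient of the
manifold of regular `A`-points: the functions whose composition with `P ↦ ker P` is smooth. -/
def smoothJet : Subalgebra ℝ (JetSpace R A → ℝ) :=
  (smoothPoint R A).comap (jetPullbackFun R A)

variable (R A) in
/-- The pull-back of smooth functions along `P ↦ ker P`. -/
def jetPullback : smoothJet R A →ₐ[ℝ] smoothPoint R A :=
  ((jetPullbackFun R A).comp (smoothJet R A).val).codRestrict (smoothPoint R A) (fun F => F.2)

/-- The tangent space at `x` to a manifold `X` with algebra of smooth functions `C`: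
the real valued derivations of `C` at `x`. -/
def PointTangent {X : Type*} (C : Subalgebra ℝ (X → ℝ)) (x : X) :
    Submodule ℝ (Module.Dual ℝ C) where
  carrier := {V | ∀ F G : C, V (F * G) = F.1 x * V G + G.1 x * V F}
  zero_mem' := by simp
  add_mem' {V W} hV hW F G := by
    simp only [Set.mem_ofPred_eq] at hV hW
    simp only [LinearMap.add_apply, hV, hW]
    ring
  smul_mem' c V hV F G := by
    simp only [Set.mem_ofPred_eq] at hV
    simp only [LinearMap.smul_apply, hV, smul_eq_mul]
    ring

/-- The differential at `x` of smooth functions, `d_x F : V ↦ V F`, with values in the cotangent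
space at `x`. -/
def pointDifferential {X : Type*} (C : Subalgebra ℝ (X → ℝ)) (x : X) :
    C →ₗ[ℝ] Module.Dual ℝ (PointTangent C x) :=
  LinearMap.flip (PointTangent C x).subtype

variable (A) in
/-- The prolongation of an ideal `I` to the manifold of jets of type `A`: the ideal of the smooth
functions on that manifold whose pull-back to the regular `A`-points is in the ideal generated by
the real components of the elements of `I`. (It is the unique ideal that generates, by pull-back,
the same ideal as these real components.) -/
def prolongation (I : Ideal R) : Ideal (smoothJet R A) :=
  (Ideal.span {g : smoothPoint R A | ∃ f ∈ I, ∃ η : Module.Dual ℝ A, g = smoothComponent η f}).comap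
    (jetPullback R A)

/-- The space of the differentials at the jet `q` of the functions in the prolongation of `I`. -/
def prolongationDifferentials (I : Ideal R) (q : JetSpace R A) :
    Submodule ℝ (Module.Dual ℝ (PointTangent (smoothJet R A) q)) :=
  ((prolongation A I).restrictScalars ℝ).map (pointDifferential (smoothJet R A) q)

/-- The canonical identification of the tangent module `T_q M` with the tangent space at `q` to the
manifold of jets of type `A`: to the class of `D : R → R ⧸ q` corresponds the image, under the
tangent map of `P ↦ ker P` at any `P` over `q`, of the tangent vector `V` at `P` such that
`V f_η = (D f)_η` for all the real components of all the `f`. -/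
def IsCanonicalIso (q : JetSpace R A)
    (κ : TangentModule q.1 ≃ₗ[ℝ] PointTangent (smoothJet R A) q) : Prop :=
  ∀ (P : RegularPoint R A) (hP : jetOf P = q) (D : Derivation ℝ R (R ⧸ q.1)),
    ∃ V ∈ PointTangent (smoothPoint R A) P,
      (∀ (f : R) (η : Module.Dual ℝ A), V (smoothComponent η f) = η (residueMap P hP (D f))) ∧
      ∀ F : smoothJet R A, (κ (tangentClass q.1 D)).1 F = V (jetPullback R A F)

/-- The projection `T_p M → T_q M ≃ T_q (jets of type A)`, as a real linear map. -/
def toJetTangent {p : Ideal R} {q : JetSpace R A} (h : p ≤ q.1) (hs : IsDerStable h)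
    (κ : TangentModule q.1 ≃ₗ[ℝ] PointTangent (smoothJet R A) q) :
    TangentModule p →ₗ[ℝ] PointTangent (smoothJet R A) q :=
  κ.toLinearMap ∘ₗ (tangentProj h hs).restrictScalars ℝ

/-- `s` is, near `q`, a smooth section of the projection `P ↦ ker P`. -/
def IsLocalSection (s : JetSpace R A → RegularPoint R A) (q : JetSpace R A) : Prop :=
  (∀ᶠ r in 𝓝 q, jetOf (s r) = r) ∧
    ∀ g : smoothPoint R A, ∃ F : smoothJet R A, ∀ᶠ r in 𝓝 q, F.1 r = g.1 (s r)

end Algebraic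

/-! ## The Cartan system and the derived ideal of a jet of a manifold -/

section Geometric

/-- The ring `C^∞(M)` of a smooth manifold `M` of dimension `n`. -/
abbrev SmoothRing (n : ℕ) (M : Type*) [TopologicalSpace M]
    [ChartedSpace (EuclideanSpace ℝ (Fin n)) M] : Type _ :=
  C^∞⟮𝓡 n, M; 𝓘(ℝ, ℝ), ℝ⟯

variable {n : ℕ} {M : Type*} [TopologicalSpace M] [ChartedSpace (EuclideanSpace ℝ (Fin n)) M]

/-- `X` is an embedded (locally closed) submanifold of dimension `m`: near each of its points it is
given in some chart by the vanishing of the last `n - m` coordinates. -/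
def IsEmbeddedSubmanifold (n m : ℕ) {M : Type*} [TopologicalSpace M]
    [ChartedSpace (EuclideanSpace ℝ (Fin n)) M] (X : Set M) : Prop :=
  m ≤ n ∧ ∀ x ∈ X, ∃ φ ∈ IsManifold.maximalAtlas (𝓡 n) ∞ M, x ∈ φ.source ∧
    ∀ y ∈ φ.source, y ∈ X ↔ ∀ i : Fin n, m ≤ (i : ℕ) → φ y i = 0

/-- The ideal `I(X)` of the smooth functions vanishing on `X`. -/
def idealOf (n : ℕ) {M : Type*} [TopologicalSpace M]
    [ChartedSpace (EuclideanSpace ℝ (Fin n)) M] (X : Set M) : Ideal (SmoothRing n M) where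
  carrier := {f | ∀ x ∈ X, f x = 0}
  zero_mem' _ _ := rfl
  add_mem' {f g} hf hg x hx := by
    change f x + g x = 0
    rw [hf x hx, hg x hx, add_zero]
  smul_mem' c f hf x hx := by
    change c x * f x = 0
    rw [hf x hx, mul_zero]

/-- `X` passes through the jet `p`: `I(X) ⊆ p`. As `X` need not be closed in `M`, it is required
that the point near which `p` lies belongs to `X` (this is automatic for closed `X`). -/
def PassesThrough (X : Set M) (p : Ideal (SmoothRing n M)) : Prop :=
  idealOf n X ≤ p ∧ ∃ x ∈ X, p ≤ idealOf n {x}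

/-- The Cartan system at a jet `p` of width `m`: the submodule of `T_p M` generated by the values of
the fields which are tangent to some `m`-dimensional submanifold `X` passing through `p`. -/
def cartanSystem (p : Ideal (SmoothRing n M)) [IsJet p] :
    Submodule (SmoothRing n M) (TangentModule p) :=
  Submodule.span (SmoothRing n M)
    {t | ∃ D : Derivation ℝ (SmoothRing n M) (SmoothRing n M),
      (∃ X : Set M, IsEmbeddedSubmanifold n (weilWidth (SmoothRing n M ⧸ p)) X ∧
        PassesThrough X p ∧ ∀ f ∈ idealOf n X, D f ∈ idealOf n X) ∧
      t = tangentClass p (fieldValue p D)}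

/-- The derived ideal `p' = p + (D f | [D] in the Cartan system at p, f ∈ p)`. -/
def derivedIdeal (p : Ideal (SmoothRing n M)) [IsJet p] : Ideal (SmoothRing n M) :=
  p ⊔ Ideal.span {g | ∃ D : Derivation ℝ (SmoothRing n M) (SmoothRing n M ⧸ p),
    tangentClass p D ∈ cartanSystem p ∧ ∃ f ∈ p, Ideal.Quotient.mk p g = D f}

theorem le_derivedIdeal (p : Ideal (SmoothRing n M)) [IsJet p] : p ≤ derivedIdeal p :=
  le_sup_left

/-- The derived ideal, as a jet of type `A'`. -/
def derivedJet (p : Ideal (SmoothRing n M)) [IsJet p] {A' : Type*} [CommRing A'] [Algebra ℝ A']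
    (e : Nonempty ((SmoothRing n M ⧸ derivedIdeal p) ≃ₐ[ℝ] A')) : JetSpace (SmoothRing n M) A' :=
  ⟨derivedIdeal p, e⟩

/-- The contact system at the jet `p`: `Ω_p = Ω_(p,p')` with `p'` the derived ideal. -/
def contactSystem (p : Ideal (SmoothRing n M)) [IsJet p] :
    Submodule (SmoothRing n M)
      (TangentModule p →ₗ[SmoothRing n M] (SmoothRing n M ⧸ derivedIdeal p)) :=
  contactSystemPair (le_derivedIdeal p)

end Geometric

end

noncomputable section

/-! ## Hadamard's lemma -/

section Hadamard

universe u

/-! Write R for the algebra of smooth functions. A linear map D from R to A with D(fg) = P(f)D(g) +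
P(g)D(f) is the same thing as a tangent vector at the regular point P. One direction is the
expansion of V f_η in a basis of A. For the other, D is the velocity of a curve of regular points
(`hasCurves`): take local coordinates x_i and functions G_i with P(G_i) = D(x_i), and follow f ↦
P(f(x + tG)). This is differentiable in t because the value of a morphism at f depends smoothly on
its values at coordinates: Hadamard's lemma expands f around the base point until nilpotency ends
the expansion (`exists_functionalCalculus`). Projecting to the jets gives κ. Derivations of R/q go
to zero since they integrate to automorphisms, which move P inside its fibre; conversely, for f in q
and a local section s through P the function f_η ∘ s has derivative η(Df), so a vector with zero
projection has D = 0 on q.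

Local sections are the analytic core. A linear right inverse of P turns each regular point near P
into an invertible endomorphism of A, its frame, on which automorphisms of A act by left
multiplication. Sections then come from smooth representatives of the cosets of Aut A near 1
(`exists_slice`): write g = exp(δ)(1 + ν) with δ a derivation and ν in a complement of the
derivations. `exists_rigid` shows that ν depends only on the coset, by a direct estimate instead of
Lie group theory. Smooth functions being global by definition, local constructions also need bump
functions on the space of jets; these rest on the properness of the action
(`exists_nhds_isClosed_image_jetOf`).

For (1), s(ker Q) = gQ with an automorphism g that depends smoothly on Q, so the pull-back of f_η ∘
s is a combination of real components of f with smooth coefficients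
(`exists_smoothJet_component_section`). Hence it agrees near q with an element of the prolongation,
and its differential is η ∘ d'f. Conversely, all the generators of the pulled-back ideal vanish at
P, so differentiating a combination of them there leaves only real components of the contact system.
Surjectivity holds because every derivation at a jet is the value of a field on M.

For (2), with m the width, take coordinates at the point of p whose last n - m belong to p, and let
J be generated by p and the derivatives ∂_i f with i < m and f in p. The slice where the last
coordinates vanish passes through p, so J lies in the derived ideal. A field tangent to another
submanifold through p maps p into the analogue of J for coordinates straightening that submanifold,
and this analogue lies in J because the Jacobian matrix of the change of coordinates is block
triangular modulo J (`CoordAt.firstDerivedIdeal_le`). So J is the derived ideal. It is proper since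
the ∂_i f vanish at the point. It is stable since a derivation of R/p lifts to a field Y preserving
p whose last components lie in p, and Y can be commuted past ∂_i. -/

/-- Differentiation under the integral sign: the partial derivative in x is bounded on the compact
product of a closed ball and [0, 1], and that bound is the dominating function. -/
theorem hasFDerivAt_parametricIntegral {E F : Type*} [NormedAddCommGroup E] [NormedSpace ℝ E]
    [FiniteDimensional ℝ E] [NormedAddCommGroup F] [NormedSpace ℝ F]
    {G : E × ℝ → F} (hG : ContDiff ℝ 1 G) (x : E) :
    HasFDerivAt (fun x => ∫ s in (0 : ℝ)..1, G (x, s))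
      (∫ s in (0 : ℝ)..1, (fderiv ℝ G (x, s)).comp (ContinuousLinearMap.inl ℝ E ℝ)) x := by
  have hcont : Continuous fun q : E × ℝ =>
      (fderiv ℝ G q).comp (ContinuousLinearMap.inl ℝ E ℝ) :=
    (hG.continuous_fderiv one_ne_zero).clm_comp continuous_const
  obtain ⟨C, hC⟩ := ((isCompact_closedBall x 1).prod (isCompact_Icc (a := (0 : ℝ)) (b := 1))).exists_bound_of_continuousOn
    hcont.continuousOn
  have key := intervalIntegral.hasFDerivAt_integral_of_dominated_of_fderiv_le
    (𝕜 := ℝ) (μ := MeasureTheory.volume) (a := (0 : ℝ)) (b := 1) (F := fun x s => G (x, s))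
    (F' := fun x s => (fderiv ℝ G (x, s)).comp (ContinuousLinearMap.inl ℝ E ℝ)) (x₀ := x)
    (s := Metric.closedBall x 1) (bound := fun _ => C)
    (Metric.closedBall_mem_nhds x one_pos) ?_ ?_ ?_ ?_ ?_ ?_
  · exact key
  · refine Filter.Eventually.of_forall fun y => Continuous.aestronglyMeasurable ?_
    exact hG.continuous.comp (by fun_prop)
  · exact (hG.continuous.comp (by fun_prop)).intervalIntegrable _ _
  · exact (hcont.comp (f := fun s : ℝ => (x, s)) (by fun_prop)).aestronglyMeasurable
  · refine Filter.Eventually.of_forall fun s hs y hy => ?_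
    rw [Set.uIoc_of_le zero_le_one] at hs
    exact hC (y, s) ⟨hy, ⟨hs.1.le, hs.2⟩⟩
  · exact intervalIntegrable_const
  · refine Filter.Eventually.of_forall fun s _ y _ => ?_
    have h1 : HasFDerivAt G (fderiv ℝ G (y, s)) (y, s) :=
      (hG.differentiable one_ne_zero _).hasFDerivAt
    have h2 : HasFDerivAt (fun y : E => (y, s)) (ContinuousLinearMap.inl ℝ E ℝ) y :=
      hasFDerivAt_prodMk_left y s
    exact h1.comp y h2

/-- The derivative of a parametric integral is again one, with values in linear maps. The induction
therefore has to run over all targets `F` at once, kept in the universe of `E`. -/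
theorem contDiff_nat_parametricIntegral {E : Type u} [NormedAddCommGroup E] [NormedSpace ℝ E]
    [FiniteDimensional ℝ E] (n : ℕ) :
    ∀ {F : Type u} [NormedAddCommGroup F] [NormedSpace ℝ F] {G : E × ℝ → F},
      ContDiff ℝ ∞ G → ContDiff ℝ n (fun x => ∫ s in (0 : ℝ)..1, G (x, s)) := by
  induction n with
  | zero =>
    intro F _ _ G hG
    rw [Nat.cast_zero, contDiff_zero]
    exact continuous_iff_continuousAt.mpr fun x =>
      (hasFDerivAt_parametricIntegral (hG.of_le (by simp)) x).continuousAt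
  | succ n ih =>
    intro F _ _ G hG
    rw [Nat.cast_add, Nat.cast_one, contDiff_succ_iff_fderiv]
    have hd := hasFDerivAt_parametricIntegral (hG.of_le (by simp) : ContDiff ℝ 1 G)
    refine ⟨fun x => (hd x).differentiableAt, by simp, ?_⟩
    rw [funext fun x => (hd x).fderiv]
    exact ih ((hG.fderiv_right (m := ∞) (by simp)).clm_comp contDiff_const)

theorem contDiff_parametricIntegral {E F : Type u} [NormedAddCommGroup E] [NormedSpace ℝ E]
    [FiniteDimensional ℝ E] [NormedAddCommGroup F] [NormedSpace ℝ F] {G : E × ℝ → F}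
    (hG : ContDiff ℝ ∞ G) : ContDiff ℝ ∞ (fun x => ∫ s in (0 : ℝ)..1, G (x, s)) :=
  contDiff_infty.mpr fun n => contDiff_nat_parametricIntegral n hG

/-- Hadamard's lemma. -/
theorem exists_hadamard {E : Type u} [NormedAddCommGroup E] [NormedSpace ℝ E]
    [FiniteDimensional ℝ E] {f : E → ℝ} (hf : ContDiff ℝ ∞ f) :
    ∃ G : E × E → (E →L[ℝ] ℝ), ContDiff ℝ ∞ G ∧
      ∀ x y, f y = f x + G (x, y) (y - x) := by
  have hf' : ContDiff ℝ ∞ (fderiv ℝ f) := hf.fderiv_right (by simp)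
  have hK : ContDiff ℝ ∞ fun q : (E × E) × ℝ => fderiv ℝ f (q.1.1 + q.2 • (q.1.2 - q.1.1)) :=
    hf'.comp (by fun_prop)
  refine ⟨fun p => ∫ s in (0 : ℝ)..1, fderiv ℝ f (p.1 + s • (p.2 - p.1)),
    ?_, fun x y => ?_⟩
  · exact contDiff_parametricIntegral hK
  · have hd : ∀ s ∈ Set.uIcc (0 : ℝ) 1, HasDerivAt (fun s : ℝ => f (x + s • (y - x)))
        (fderiv ℝ f (x + s • (y - x)) (y - x)) s := fun s _ => by
      have h1 : HasFDerivAt f (fderiv ℝ f (x + s • (y - x))) (x + s • (y - x)) :=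
        (hf.differentiable (by simp) _).hasFDerivAt
      have h2 : HasDerivAt (fun s : ℝ => x + s • (y - x)) ((1 : ℝ) • (y - x)) s :=
        ((hasDerivAt_id s).smul_const _).const_add x
      rw [one_smul] at h2
      exact h1.comp_hasDerivAt s h2
    have hc : Continuous fun s : ℝ => fderiv ℝ f (x + s • (y - x)) :=
      hf'.continuous.comp (by fun_prop)
    have hi := intervalIntegral.integral_eq_sub_of_hasDerivAt hd
      (((ContinuousLinearMap.apply ℝ ℝ (y - x)).continuous.comp hc).intervalIntegrable _ _)
    have ha := ContinuousLinearMap.intervalIntegral_apply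
      (hc.intervalIntegrable (μ := MeasureTheory.volume) 0 1) (y - x)
    simp only [one_smul, zero_smul, add_zero, add_sub_cancel] at hi
    rw [ha, hi]
    ring

end Hadamard

/-! ## Weil algebras -/

section Weil

variable (A : Type*) [CommRing A] [Algebra ℝ A] [IsWeilAlgebra A]

theorem IsWeilAlgebra.bijective_algebraMap_residueField :
    Function.Bijective (algebraMap ℝ (IsLocalRing.ResidueField A)) :=
  ⟨(algebraMap ℝ (IsLocalRing.ResidueField A)).injective, IsWeilAlgebra.rational⟩

/-- The augmentation of a Weil algebra. -/
def weilAug : A →ₐ[ℝ] ℝ :=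
  ((AlgEquiv.ofBijective (Algebra.ofId ℝ (IsLocalRing.ResidueField A))
    (IsWeilAlgebra.bijective_algebraMap_residueField A)).symm : _ →ₐ[ℝ] ℝ).comp
    (IsScalarTower.toAlgHom ℝ A (IsLocalRing.ResidueField A))

variable {A}

theorem weilAug_eq_zero_iff {a : A} : weilAug A a = 0 ↔ a ∈ IsLocalRing.maximalIdeal A := by
  rw [← IsLocalRing.residue_eq_zero_iff]
  exact map_eq_zero_iff
    (AlgEquiv.ofBijective (Algebra.ofId ℝ (IsLocalRing.ResidueField A))
      (IsWeilAlgebra.bijective_algebraMap_residueField A)).symm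
    (AlgEquiv.injective _)

theorem isUnit_of_weilAug_ne_zero {a : A} (h : weilAug A a ≠ 0) : IsUnit a := by
  by_contra hu
  exact h (weilAug_eq_zero_iff.mpr ((IsLocalRing.mem_maximalIdeal a).mpr hu))

theorem sub_weilAug_mem (a : A) :
    a - algebraMap ℝ A (weilAug A a) ∈ IsLocalRing.maximalIdeal A := by
  rw [← weilAug_eq_zero_iff, map_sub, AlgHom.commutes, Algebra.algebraMap_self, RingHom.id_apply,
    sub_self]

variable (A) in
theorem exists_maximalIdeal_pow_eq_bot : ∃ k : ℕ, IsLocalRing.maximalIdeal A ^ k = ⊥ := by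
  have : Module.Finite ℝ A := IsWeilAlgebra.finite
  have : IsArtinianRing A := IsArtinianRing.of_finite ℝ A
  obtain ⟨k, hk⟩ := IsArtinianRing.isNilpotent_jacobson_bot (R := A)
  rw [IsLocalRing.jacobson_eq_maximalIdeal ⊥ bot_ne_top] at hk
  exact ⟨k, hk⟩

/-- An algebra morphism to a Weil algebra kills the elements annihilated by an element that it does
not map to the maximal ideal. -/
theorem map_eq_zero_of_mul_eq_zero {R : Type*} [CommRing R] [Algebra ℝ R] (Q : R →ₐ[ℝ] A)
    {ψ f : R} (hψ : weilAug A (Q ψ) ≠ 0) (h : ψ * f = 0) : Q f = 0 := by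
  have h1 : Q ψ * Q f = 0 := by rw [← map_mul, h, map_zero]
  exact (isUnit_of_weilAug_ne_zero hψ).mul_right_eq_zero.mp h1

/-- Leibniz on ψ f = 0 leaves Q(ψ) D(f) = 0, since Q(f) is already zero, and Q(ψ) is a unit. With ψ
a bump function this says that D depends only on germs. -/
theorem derivation_eq_zero_of_mul_eq_zero {R : Type*} [CommRing R] [Algebra ℝ R] (Q : R →ₐ[ℝ] A)
    {D : R →ₗ[ℝ] A} (hD : ∀ f g, D (f * g) = Q f * D g + Q g * D f)
    {ψ f : R} (hψ : weilAug A (Q ψ) ≠ 0) (h : ψ * f = 0) : D f = 0 := by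
  have h1 : Q ψ * D f = 0 := by
    have := hD ψ f
    rwa [h, map_zero, map_eq_zero_of_mul_eq_zero Q hψ h, zero_mul, add_zero, eq_comm] at this
  exact (isUnit_of_weilAug_ne_zero hψ).mul_right_eq_zero.mp h1

end Weil

/-! ## Morphisms from the smooth functions of a Euclidean space to a Weil algebra -/

section Euclidean

variable {n : ℕ}

/-- A smooth function on a Euclidean space, as an element of the ring of smooth functions. -/
def smoothFun (f : EuclideanSpace ℝ (Fin n) → ℝ) (hf : ContDiff ℝ ∞ f) :
    SmoothRing n (EuclideanSpace ℝ (Fin n)) :=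
  ⟨f, hf.contMDiff⟩

theorem contDiff_smoothRing (f : SmoothRing n (EuclideanSpace ℝ (Fin n))) :
    ContDiff ℝ ∞ (f : EuclideanSpace ℝ (Fin n) → ℝ) :=
  f.contMDiff.contDiff

/-- The coordinate functions of a Euclidean space. -/
def coordFun (i : Fin n) : SmoothRing n (EuclideanSpace ℝ (Fin n)) :=
  smoothFun (fun y => y i) (by fun_prop)

/-- The restriction to a slice of a smooth function of two variables. -/
def sliceFun {F : EuclideanSpace ℝ (Fin n) × EuclideanSpace ℝ (Fin n) → ℝ} (hF : ContDiff ℝ ∞ F)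
    (x : EuclideanSpace ℝ (Fin n)) : SmoothRing n (EuclideanSpace ℝ (Fin n)) :=
  smoothFun (fun y => F (x, y)) (hF.comp (by fun_prop))

/-- Hadamard's lemma around a moving point x. The remainders are slices of functions that are again
smooth in both variables, so the expansion can be iterated while x varies smoothly. -/
theorem exists_sliceFun_eq
    {F : EuclideanSpace ℝ (Fin n) × EuclideanSpace ℝ (Fin n) → ℝ} (hF : ContDiff ℝ ∞ F) :
    ∃ (H : Fin n → EuclideanSpace ℝ (Fin n) × EuclideanSpace ℝ (Fin n) → ℝ)
      (hH : ∀ i, ContDiff ℝ ∞ (H i)), ∀ x,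
      sliceFun hF x = algebraMap ℝ _ (F (x, x)) +
        ∑ i, (coordFun i - algebraMap ℝ _ (x i)) * sliceFun (hH i) x := by
  obtain ⟨G, hG, h⟩ := exists_hadamard hF
  -- Hadamard on the product space, between the points (x, x) and (x, y), whose difference has only
  -- a second component.
  refine ⟨fun i q => G ((q.1, q.1), (q.1, q.2)) (0, EuclideanSpace.single i 1), fun i => ?_,
    fun x => ?_⟩
  · exact (hG.comp (by fun_prop)).clm_apply contDiff_const
  · ext y
    have h1 := h (x, x) (x, y)
    have h2 : ((x, y) : EuclideanSpace ℝ (Fin n) × EuclideanSpace ℝ (Fin n)) - (x, x) =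
        ∑ i, (y i - x i) • ((0 : EuclideanSpace ℝ (Fin n)), EuclideanSpace.single i (1 : ℝ)) := by
      ext i
      · simp [Prod.fst_sum]
      · simp [Prod.snd_sum, Finset.sum_apply, Pi.single_apply]
    rw [h2, map_sum] at h1
    have h3 : ∀ f : Fin n → SmoothRing n (EuclideanSpace ℝ (Fin n)),
        (∑ i, f i) y = ∑ i, f i y := fun f =>
      map_sum (ContMDiffMap.evalRingHom y) f Finset.univ
    change F (x, y) = F (x, x) + _
    rw [h1, h3]
    simp only [map_smul, smul_eq_mul]
    rfl

variable {A : Type*} [NormedCommRing A] [NormedAlgebra ℝ A] [IsWeilAlgebra A]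

/-- The point near which a tuple of elements of a Weil algebra lies. -/
def basePoint (c : Fin n → A) : EuclideanSpace ℝ (Fin n) :=
  WithLp.toLp 2 fun i => weilAug A (c i)

theorem contDiff_weilAug : ContDiff ℝ ∞ (weilAug A) := by
  have : FiniteDimensional ℝ A := IsWeilAlgebra.finite
  exact (LinearMap.toContinuousLinearMap (weilAug A).toLinearMap).contDiff

theorem contDiff_basePoint : ContDiff ℝ ∞ (basePoint (A := A) (n := n)) := by
  rw [contDiff_euclidean]
  exact fun i => contDiff_weilAug.comp (contDiff_apply ℝ A i)

/-- Expand around the base point a of c. As c_i - a_i is in the maximal ideal, knowing the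
remainders modulo its k-th power gives the value modulo the next power. Two variables are needed
because the centre a itself depends, smoothly, on c. -/
theorem exists_functionalCalculus_mod (k : ℕ) :
    ∀ {F : EuclideanSpace ℝ (Fin n) × EuclideanSpace ℝ (Fin n) → ℝ} (hF : ContDiff ℝ ∞ F),
    ∃ Θ : (Fin n → A) → A, ContDiff ℝ ∞ Θ ∧
      ∀ Q : SmoothRing n (EuclideanSpace ℝ (Fin n)) →ₐ[ℝ] A, ∀ c, (∀ i, Q (coordFun i) = c i) →
        Q (sliceFun hF (basePoint c)) - Θ c ∈ IsLocalRing.maximalIdeal A ^ k := by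
  induction k with
  | zero => exact fun hF => ⟨fun _ => 0, contDiff_const, fun Q c _ => by simp⟩
  | succ k ih =>
    intro F hF
    obtain ⟨H, hH, h⟩ := exists_sliceFun_eq hF
    choose Θ hΘ hQ using fun i => ih (hH i)
    have ha : ContDiff ℝ ∞ (algebraMap ℝ A) := (algebraMapCLM ℝ A).contDiff
    refine ⟨fun c => algebraMap ℝ A (F (basePoint c, basePoint c)) +
      ∑ i, (c i - algebraMap ℝ A (basePoint c i)) * Θ i c, ?_, fun Q c hc => ?_⟩
    · have hb := contDiff_basePoint (A := A) (n := n)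
      refine (ha.comp (hF.comp (hb.prodMk hb))).add (ContDiff.sum fun i _ => ?_)
      refine ((contDiff_apply ℝ A i).sub (ha.comp ?_)).mul (hΘ i)
      exact contDiff_euclidean.mp hb i
    · rw [h, map_add, map_sum, AlgHom.commutes, add_sub_add_left_eq_sub, ← Finset.sum_sub_distrib]
      refine Ideal.sum_mem _ fun i _ => ?_
      rw [map_mul, map_sub, AlgHom.commutes, hc, ← mul_sub, pow_succ']
      exact Ideal.mul_mem_mul (sub_weilAug_mem (c i)) (hQ i Q c hc)

/-- The value of an algebra morphism to a Weil algebra at a smooth function is a smooth function of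
its values at the coordinates. -/
theorem exists_functionalCalculus (f : SmoothRing n (EuclideanSpace ℝ (Fin n))) :
    ∃ Θ : (Fin n → A) → A, ContDiff ℝ ∞ Θ ∧
      ∀ Q : SmoothRing n (EuclideanSpace ℝ (Fin n)) →ₐ[ℝ] A,
        Q f = Θ fun i => Q (coordFun i) := by
  obtain ⟨k, hk⟩ := exists_maximalIdeal_pow_eq_bot A
  obtain ⟨Θ, hΘ, h⟩ := exists_functionalCalculus_mod (A := A) k
    (F := fun q => f q.2) ((contDiff_smoothRing f).comp contDiff_snd)
  refine ⟨Θ, hΘ, fun Q => ?_⟩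
  have := h Q _ fun i => rfl
  rw [hk, Ideal.mem_bot, sub_eq_zero] at this
  exact this

end Euclidean

section EuclideanDerivation

variable {n : ℕ} {A : Type*} [CommRing A] [Algebra ℝ A] [IsWeilAlgebra A]

/-- A derivation of the smooth functions of a Euclidean space over an algebra morphism to a Weil
algebra is determined by its values at the coordinates. -/
theorem euclidean_derivation_eq_zero (Q : SmoothRing n (EuclideanSpace ℝ (Fin n)) →ₐ[ℝ] A)
    (D : SmoothRing n (EuclideanSpace ℝ (Fin n)) →ₗ[ℝ] A)
    (hD : ∀ f g, D (f * g) = Q f * D g + Q g * D f) (h0 : ∀ i, D (coordFun i) = 0) : D = 0 := by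
  have h1 : ∀ c : ℝ, D (algebraMap ℝ _ c) = 0 := fun c => by
    have h := hD 1 1
    simp only [mul_one, map_one, one_mul, left_eq_add] at h
    rw [Algebra.algebraMap_eq_smul_one, map_smul, h, smul_zero]
  obtain ⟨k, hk⟩ := exists_maximalIdeal_pow_eq_bot A
  -- The value of D lies in every power of the maximal ideal: in the Hadamard expansion D kills the
  -- coordinate factors, and their images under Q are nilpotent.
  suffices H : ∀ (k : ℕ) (F : EuclideanSpace ℝ (Fin n) × EuclideanSpace ℝ (Fin n) → ℝ)
      (hF : ContDiff ℝ ∞ F), D (sliceFun hF (WithLp.toLp 2 fun i => weilAug A (Q (coordFun i)))) ∈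
        IsLocalRing.maximalIdeal A ^ k by
    ext f
    have := H k (fun q => f q.2) ((contDiff_smoothRing f).comp contDiff_snd)
    rw [hk, Ideal.mem_bot] at this
    exact this
  intro k
  induction k with
  | zero => simp
  | succ k ih =>
    intro F hF
    obtain ⟨H, hH, h⟩ := exists_sliceFun_eq hF
    rw [h, map_add, h1, zero_add, map_sum]
    refine Ideal.sum_mem _ fun i _ => ?_
    rw [hD, map_sub D, h0, h1, sub_zero, mul_zero, add_zero, pow_succ', map_sub, AlgHom.commutes]
    exact Ideal.mul_mem_mul (sub_weilAug_mem _) (ih (H i) (hH i))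

end EuclideanDerivation

/-! ## Smooth functions on the spaces of regular points and of jets -/

/-- `SmoothPtAt` asks for a function smooth on the whole space; cutting off by a bump function
brings locally defined functions, such as inversion or the slice, into this form. -/
theorem exists_contDiff_eventuallyEq {E F : Type*} [NormedAddCommGroup E] [NormedSpace ℝ E]
    [FiniteDimensional ℝ E] [NormedAddCommGroup F] [NormedSpace ℝ F] {f : E → F} {V : Set E}
    (hV : IsOpen V) (hf : ContDiffOn ℝ ∞ f V) {x : E} (hx : x ∈ V) :
    ∃ g : E → F, ContDiff ℝ ∞ g ∧ ∀ᶠ y in 𝓝 x, g y = f y := by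
  obtain ⟨ε, hε, hεV⟩ := Metric.nhds_basis_closedBall.mem_iff.mp (hV.mem_nhds hx)
  let χ : ContDiffBump x := ⟨ε / 2, ε, half_pos hε, half_lt_self hε⟩
  refine ⟨fun y => χ y • f y, ?_, ?_⟩
  · refine contDiff_iff_contDiffAt.mpr fun y => ?_
    by_cases hy : y ∈ V
    · exact χ.contDiffAt.smul (hf.contDiffAt (hV.mem_nhds hy))
    · have hy' : y ∈ (tsupport χ)ᶜ := fun h => hy (hεV (χ.tsupport_eq ▸ h))
      refine (contDiffAt_const (c := (0 : F))).congr_of_eventuallyEq ?_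
      filter_upwards [(isClosed_tsupport χ).isOpen_compl.mem_nhds hy'] with z hz
      rw [image_eq_zero_of_notMem_tsupport hz, zero_smul]
  · filter_upwards [χ.eventuallyEq_one] with y hy
    simp [hy]

section PointSpace

variable {R : Type*} [CommRing R] [Algebra ℝ R] {A : Type*} [CommRing A] [Algebra ℝ A]
  {E F : Type*} [NormedAddCommGroup E] [NormedSpace ℝ E] [NormedAddCommGroup F] [NormedSpace ℝ F]

theorem continuous_component (η : Module.Dual ℝ A) (f : R) :
    Continuous (component η f : RegularPoint R A → ℝ) :=
  have h : Continuous fun (P : RegularPoint R A) (i : Module.Dual ℝ A × R) => component i.1 i.2 P :=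
    continuous_induced_dom
  (continuous_apply (η, f)).comp h

/-- A vector valued map on the space of regular `A`-points is smooth near `P`. -/
def SmoothPtAt (G : RegularPoint R A → E) (P : RegularPoint R A) : Prop :=
  ∃ (ι : Type) (_ : Fintype ι) (η : ι → Module.Dual ℝ A) (f : ι → R) (Φ : (ι → ℝ) → E),
    ContDiff ℝ ∞ Φ ∧ ∀ᶠ Q in 𝓝 P, G Q = Φ fun i => component (η i) (f i) Q

theorem mem_smoothPoint_iff {G : RegularPoint R A → ℝ} :
    G ∈ smoothPoint R A ↔ ∀ P, SmoothPtAt G P :=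
  Iff.rfl

theorem smoothPtAt_component (η : Module.Dual ℝ A) (f : R) (P : RegularPoint R A) :
    SmoothPtAt (component η f) P :=
  (smoothComponent η f).2 P

theorem smoothPtAt_smoothPoint (F : smoothPoint R A) (P : RegularPoint R A) : SmoothPtAt F.1 P :=
  F.2 P

theorem smoothPtAt_smoothJet (F : smoothJet R A) (P : RegularPoint R A) :
    SmoothPtAt (fun Q => F.1 (jetOf Q)) P :=
  F.2 P

theorem smoothPtAt_const (c : E) (P : RegularPoint R A) : SmoothPtAt (fun _ => c) P :=
  ⟨Empty, inferInstance, Empty.elim, Empty.elim, fun _ => c, contDiff_const,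
    Filter.Eventually.of_forall fun _ => rfl⟩

namespace SmoothPtAt

variable {P : RegularPoint R A} {G : RegularPoint R A → E} {H : RegularPoint R A → F}

theorem congr {G' : RegularPoint R A → E} (h : SmoothPtAt G P) (h' : ∀ᶠ Q in 𝓝 P, G' Q = G Q) :
    SmoothPtAt G' P := by
  obtain ⟨ι, i, η, f, Φ, hΦ, hG⟩ := h
  refine ⟨ι, i, η, f, Φ, hΦ, ?_⟩
  filter_upwards [hG, h'] with Q h1 h2
  rw [h2, h1]

theorem continuousAt (h : SmoothPtAt G P) : ContinuousAt G P := by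
  obtain ⟨ι, i, η, f, Φ, hΦ, hG⟩ := h
  have hc : Continuous fun Q : RegularPoint R A => Φ fun i => component (η i) (f i) Q :=
    hΦ.continuous.comp (continuous_pi fun i => continuous_component (η i) (f i))
  exact hc.continuousAt.congr (hG.mono fun Q hQ => hQ.symm)

theorem comp {Ψ : E → F} {V : Set E} (hV : IsOpen V) (hΨ : ContDiffOn ℝ ∞ Ψ V)
    (h : SmoothPtAt G P) (hP : G P ∈ V) : SmoothPtAt (fun Q => Ψ (G Q)) P := by
  obtain ⟨ι, i, η, f, Φ, hΦ, hG⟩ := h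
  have hP' : (fun i => component (η i) (f i) P) ∈ Φ ⁻¹' V := by
    rw [Set.mem_preimage, ← hG.self_of_nhds]
    exact hP
  obtain ⟨Φ', h1, h2⟩ := exists_contDiff_eventuallyEq (hV.preimage hΦ.continuous)
    (hΨ.comp hΦ.contDiffOn fun y hy => hy) hP'
  refine ⟨ι, i, η, f, Φ', h1, ?_⟩
  have hc : Continuous fun Q : RegularPoint R A => fun i => component (η i) (f i) Q :=
    continuous_pi fun i => continuous_component (η i) (f i)
  filter_upwards [hG, hc.continuousAt.eventually h2] with Q h3 h4
  rw [h3, h4]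
  rfl

theorem comp_contDiff {Ψ : E → F} (hΨ : ContDiff ℝ ∞ Ψ) (h : SmoothPtAt G P) :
    SmoothPtAt (fun Q => Ψ (G Q)) P :=
  h.comp isOpen_univ hΨ.contDiffOn trivial

theorem pi {J : Type} [Fintype J] {E : J → Type*} [∀ j, NormedAddCommGroup (E j)]
    [∀ j, NormedSpace ℝ (E j)] {G : ∀ j, RegularPoint R A → E j} (h : ∀ j, SmoothPtAt (G j) P) :
    SmoothPtAt (fun Q j => G j Q) P := by
  choose ι i η f Φ hΦ hG using h
  refine ⟨Σ j, ι j, inferInstance, fun k => η k.1 k.2, fun k => f k.1 k.2,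
    fun y j => Φ j fun k => y ⟨j, k⟩, ?_, ?_⟩
  · exact contDiff_pi.mpr fun j => (hΦ j).comp (by fun_prop)
  · filter_upwards [Filter.eventually_all.mpr hG] with Q hQ
    funext j
    exact hQ j

theorem prodMk (hG : SmoothPtAt G P) (hH : SmoothPtAt H P) :
    SmoothPtAt (fun Q => (G Q, H Q)) P := by
  obtain ⟨ι, _, η, f, Φ, hΦ, h⟩ := hG
  obtain ⟨κ, _, θ, g, Ψ, hΨ, k⟩ := hH
  refine ⟨ι ⊕ κ, inferInstance, Sum.elim η θ, Sum.elim f g,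
    fun x => (Φ (fun i => x (Sum.inl i)), Ψ (fun i => x (Sum.inr i))), ?_, ?_⟩
  · exact (hΦ.comp (by fun_prop)).prodMk (hΨ.comp (by fun_prop))
  · filter_upwards [h, k] with Q h k
    simp [h, k]

theorem sum {J : Type} [Fintype J] {G : J → RegularPoint R A → E}
    (h : ∀ j, SmoothPtAt (G j) P) : SmoothPtAt (fun Q => ∑ j, G j Q) P :=
  (pi h).comp_contDiff (Ψ := fun y => ∑ j, y j) (by fun_prop)

theorem smul {G : RegularPoint R A → ℝ} {H : RegularPoint R A → E} (hG : SmoothPtAt G P)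
    (hH : SmoothPtAt H P) : SmoothPtAt (fun Q => G Q • H Q) P :=
  (hG.prodMk hH).comp_contDiff (Ψ := fun y => y.1 • y.2) (by fun_prop)

theorem clm_apply {G : RegularPoint R A → E →L[ℝ] F} {H : RegularPoint R A → E}
    (hG : SmoothPtAt G P) (hH : SmoothPtAt H P) : SmoothPtAt (fun Q => G Q (H Q)) P :=
  (hG.prodMk hH).comp_contDiff (Ψ := fun y => y.1 y.2) (by fun_prop)

end SmoothPtAt

theorem exists_component_subset {P : RegularPoint R A} {V : Set (RegularPoint R A)}
    (hV : V ∈ 𝓝 P) :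
    ∃ (k : ℕ) (η : Fin k → Module.Dual ℝ A) (f : Fin k → R) (ε : ℝ), 0 < ε ∧
      ∀ Q, (fun i => component (η i) (f i) Q) ∈
        Metric.closedBall (fun i => component (η i) (f i) P) ε → Q ∈ V := by
  rw [nhds_induced, Filter.mem_comap] at hV
  obtain ⟨W, hW, hWV⟩ := hV
  rw [nhds_pi, Filter.mem_pi'] at hW
  obtain ⟨I, t, ht, hI⟩ := hW
  -- One radius serves the finitely many components that matter.
  have hε : ∀ᶠ ε in 𝓝[>] (0 : ℝ), ∀ i ∈ I,
      Metric.closedBall (component i.1 i.2 P) ε ⊆ t i := by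
    refine (Filter.eventually_all_finset I).mpr fun i _ => ?_
    obtain ⟨δ, hδ, h⟩ := Metric.nhds_basis_closedBall.mem_iff.mp (ht i)
    filter_upwards [Ioc_mem_nhdsGT hδ] with ε hε
    exact (Metric.closedBall_subset_closedBall hε.2).trans h
  obtain ⟨ε, h1, h2⟩ := (hε.and self_mem_nhdsWithin).exists
  refine ⟨I.card, fun j => (I.equivFin.symm j).1.1, fun j => (I.equivFin.symm j).1.2, ε, h2,
    fun Q hQ => hWV (hI fun i hi => h1 i hi ?_)⟩
  rw [closedBall_pi _ (le_of_lt h2)] at hQ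
  have := hQ (I.equivFin ⟨i, hi⟩) trivial
  simpa using this

/-- Bump functions on the space of regular `A`-points. -/
theorem exists_bump_regularPoint {P : RegularPoint R A} {V : Set (RegularPoint R A)}
    (hV : V ∈ 𝓝 P) :
    ∃ (β : smoothPoint R A) (K : Set (RegularPoint R A)), IsClosed K ∧ K ⊆ V ∧
      (∀ Q, Q ∉ K → β.1 Q = 0) ∧ ∀ᶠ Q in 𝓝 P, β.1 Q = 1 := by
  obtain ⟨k, η, f, ε, hε, h⟩ := exists_component_subset hV
  have hc : Continuous fun Q : RegularPoint R A => fun i => component (η i) (f i) Q :=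
    continuous_pi fun i => continuous_component (η i) (f i)
  let χ : ContDiffBump (fun i => component (η i) (f i) P) :=
    ⟨ε / 2, ε, half_pos hε, half_lt_self hε⟩
  refine ⟨⟨fun Q => χ fun i => component (η i) (f i) Q, fun P' => ⟨Fin k, inferInstance, η, f, χ,
    χ.contDiff, Filter.Eventually.of_forall fun _ => rfl⟩⟩, _,
    Metric.isClosed_closedBall.preimage hc, h, fun Q hQ => ?_,
    hc.continuousAt.eventually χ.eventuallyEq_one⟩
  rw [Set.mem_preimage, Metric.mem_closedBall, not_le] at hQ
  exact χ.zero_of_le_dist hQ.le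

theorem pointTangent_apply_one {X : Type*} {C : Subalgebra ℝ (X → ℝ)} {x : X}
    {V : Module.Dual ℝ C} (hV : V ∈ PointTangent C x) : V 1 = 0 := by
  have h := hV 1 1
  have h1 : (1 : C).1 x = 1 := rfl
  rw [h1, mul_one, one_mul] at h
  linarith

theorem pointTangent_apply_algebraMap {X : Type*} {C : Subalgebra ℝ (X → ℝ)} {x : X}
    {V : Module.Dual ℝ C} (hV : V ∈ PointTangent C x) (c : ℝ) : V (algebraMap ℝ C c) = 0 := by
  rw [Algebra.algebraMap_eq_smul_one, map_smul, pointTangent_apply_one hV, smul_zero]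

/-- Leibniz applied to b(F - G) = 0, where b is 1 and F - G is 0 at x. Locality of tangent vectors
thus reduces to the existence of bump functions. -/
theorem pointTangent_apply_eq_of_bump {X : Type*} {C : Subalgebra ℝ (X → ℝ)} {x : X}
    {V : Module.Dual ℝ C} (hV : V ∈ PointTangent C x) {b F G : C} (hb : b.1 x = 1)
    (h : ∀ y, b.1 y ≠ 0 → F.1 y = G.1 y) : V F = V G := by
  have h0 : b * (F - G) = 0 := by
    ext y
    change b.1 y * (F.1 y - G.1 y) = 0
    by_cases hy : b.1 y = 0
    · rw [hy, zero_mul]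
    · rw [h y hy, sub_self, mul_zero]
  have h1 := hV b (F - G)
  have h2 : (F - G).1 x = 0 := by
    change F.1 x - G.1 x = 0
    rw [h x (by rw [hb]; exact one_ne_zero), sub_self]
  rw [h0, map_zero, hb, one_mul, h2, zero_mul, add_zero, map_sub] at h1
  exact (sub_eq_zero.mp h1.symm)

theorem pointTangent_apply_eq_of_eventuallyEq {P : RegularPoint R A}
    {V : Module.Dual ℝ (smoothPoint R A)} (hV : V ∈ PointTangent (smoothPoint R A) P)
    {F G : smoothPoint R A} (h : ∀ᶠ Q in 𝓝 P, F.1 Q = G.1 Q) : V F = V G := by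
  obtain ⟨β, K, _, hK, h0, h1⟩ := exists_bump_regularPoint h
  refine pointTangent_apply_eq_of_bump hV h1.self_of_nhds fun Q hQ => ?_
  by_contra hne
  exact hQ (h0 Q fun hQK => hne (hK hQK))

/-- A tangent vector at a regular `A`-point is determined by its values at the real components. -/
theorem pointTangent_ext {P : RegularPoint R A} {V W : Module.Dual ℝ (smoothPoint R A)}
    (hV : V ∈ PointTangent (smoothPoint R A) P) (hW : W ∈ PointTangent (smoothPoint R A) P)
    (h : ∀ (η : Module.Dual ℝ A) (f : R), V (smoothComponent η f) = W (smoothComponent η f)) :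
    V = W := by
  rw [← sub_eq_zero]
  have hd := Submodule.sub_mem _ hV hW
  have h0 : ∀ (η : Module.Dual ℝ A) (f : R), (V - W) (smoothComponent η f) = 0 := fun η f => by
    rw [LinearMap.sub_apply, h, sub_self]
  generalize V - W = U at hd h0
  ext F
  obtain ⟨ι, _, η, f, Φ, hΦ, hF⟩ := F.2 P
  obtain ⟨G, hG, hΦG⟩ := exists_hadamard hΦ
  classical
  set y₀ : ι → ℝ := fun i => component (η i) (f i) P with hy₀
  let g : ι → smoothPoint R A := fun i =>
    ⟨fun Q => G (y₀, fun i => component (η i) (f i) Q) (Pi.single i 1), fun P' =>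
      ⟨ι, inferInstance, η, f, fun y => G (y₀, y) (Pi.single i 1),
        (hG.comp (by fun_prop)).clm_apply contDiff_const,
        Filter.Eventually.of_forall fun _ => rfl⟩⟩
  -- The Hadamard expansion of `Φ` at the components of P. It agrees with `F` near P, and `U` kills
  -- it, because every factor f_η - f_η(P) vanishes at P and is killed by `U`.
  let F' : smoothPoint R A := algebraMap ℝ _ (Φ y₀) +
    ∑ i, (smoothComponent (η i) (f i) - algebraMap ℝ _ (y₀ i)) * g i
  have hF' : U F' = 0 := by
    rw [map_add, pointTangent_apply_algebraMap hd, zero_add, map_sum]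
    refine Finset.sum_eq_zero fun i _ => ?_
    rw [hd, map_sub, h0, pointTangent_apply_algebraMap hd]
    have : (smoothComponent (η i) (f i) - algebraMap ℝ (smoothPoint R A) (y₀ i)).1 P = 0 :=
      sub_self (y₀ i)
    rw [this]
    ring
  rw [LinearMap.zero_apply, ← hF']
  refine pointTangent_apply_eq_of_eventuallyEq hd ?_
  filter_upwards [hF] with Q hQ
  have e1 : F'.1 Q = Φ y₀ + ∑ i, (component (η i) (f i) Q - y₀ i) * (g i).1 Q := by
    simp only [F', Subalgebra.coe_add, Pi.add_apply, AddSubmonoidClass.coe_finsetSum,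
      Finset.sum_apply]
    rfl
  rw [hQ, e1, hΦG y₀]
  congr 1
  have e2 : (fun i => component (η i) (f i) Q) - y₀ =
      ∑ i, (component (η i) (f i) Q - y₀ i) • (Pi.single i (1 : ℝ) : ι → ℝ) := by
    ext j
    simp [Finset.sum_apply, Pi.single_apply]
  rw [e2, map_sum]
  simp only [map_smul, smul_eq_mul, g]

/-! ### The action of the automorphisms of `A` -/

/-- The action of an automorphism of `A` on a regular `A`-point. -/
def actPoint (g : A ≃ₐ[ℝ] A) (Q : RegularPoint R A) : RegularPoint R A :=
  ⟨(g : A →ₐ[ℝ] A).comp Q.1, g.surjective.comp Q.2⟩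

theorem actPoint_apply (g : A ≃ₐ[ℝ] A) (Q : RegularPoint R A) (f : R) :
    (actPoint g Q).1 f = g (Q.1 f) :=
  rfl

theorem continuous_actPoint (g : A ≃ₐ[ℝ] A) :
    Continuous (actPoint g : RegularPoint R A → RegularPoint R A) :=
  continuous_induced_rng.mpr (continuous_pi fun i => continuous_component (R := R)
    (i.1 ∘ₗ (g : A →ₐ[ℝ] A).toLinearMap) i.2)

theorem SmoothPtAt.comp_actPoint {G : RegularPoint R A → E} (g : A ≃ₐ[ℝ] A)
    {P : RegularPoint R A} (h : SmoothPtAt G (actPoint g P)) :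
    SmoothPtAt (fun Q => G (actPoint g Q)) P := by
  obtain ⟨ι, i, η, f, Φ, hΦ, hG⟩ := h
  exact ⟨ι, i, fun i => η i ∘ₗ (g : A →ₐ[ℝ] A).toLinearMap, f, Φ, hΦ,
    (continuous_actPoint g).continuousAt.eventually hG⟩

theorem jetOf_actPoint (g : A ≃ₐ[ℝ] A) (Q : RegularPoint R A) : jetOf (actPoint g Q) = jetOf Q := by
  refine Subtype.ext (Ideal.ext fun f => ?_)
  change g (Q.1 f) = 0 ↔ Q.1 f = 0
  exact map_eq_zero_iff g g.injective

theorem mem_jetOf {Q : RegularPoint R A} {f : R} : f ∈ (jetOf Q).1 ↔ Q.1 f = 0 :=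
  Iff.rfl

theorem jetOf_surjective : Function.Surjective (jetOf : RegularPoint R A → JetSpace R A) := by
  rintro ⟨q, ⟨e⟩⟩
  refine ⟨⟨(e : (R ⧸ q) →ₐ[ℝ] A).comp (Ideal.Quotient.mkₐ ℝ q),
    e.surjective.comp (Ideal.Quotient.mkₐ_surjective ℝ q)⟩, Subtype.ext (Ideal.ext fun f => ?_)⟩
  change e (Ideal.Quotient.mk q f) = 0 ↔ f ∈ q
  rw [map_eq_zero_iff e e.injective, Ideal.Quotient.eq_zero_iff_mem]

/-- Both points identify the quotient by the common kernel with A, and the two identifications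
differ by an automorphism. So the fibres of `jetOf` are exactly the orbits of Aut A. -/
theorem exists_actPoint_eq {Q Q' : RegularPoint R A} (h : jetOf Q = jetOf Q') :
    ∃ g : A ≃ₐ[ℝ] A, Q' = actPoint g Q := by
  have h' : RingHom.ker Q.1 = RingHom.ker Q'.1 := congrArg Subtype.val h
  refine ⟨((Ideal.quotientKerAlgEquivOfSurjective Q.2).symm.trans
    (Ideal.quotientEquivAlgOfEq ℝ h')).trans (Ideal.quotientKerAlgEquivOfSurjective Q'.2),
    Subtype.ext (AlgHom.ext fun f => ?_)⟩
  have : (Ideal.quotientKerAlgEquivOfSurjective Q.2).symm (Q.1 f) = Ideal.Quotient.mk _ f := by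
    rw [AlgEquiv.symm_apply_eq]
    rfl
  simp only [actPoint_apply, AlgEquiv.trans_apply, this]
  rfl

theorem continuous_jetOf : Continuous (jetOf : RegularPoint R A → JetSpace R A) :=
  continuous_coinduced_rng

/-- The saturation of an open set is the union of its translates by automorphisms. -/
theorem isOpenMap_jetOf : IsOpenMap (jetOf : RegularPoint R A → JetSpace R A) := by
  intro U hU
  rw [isOpen_coinduced]
  have : jetOf ⁻¹' (jetOf '' U) = ⋃ g : A ≃ₐ[ℝ] A, actPoint g ⁻¹' U := by
    ext Q
    simp only [Set.mem_preimage, Set.mem_image, Set.mem_iUnion]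
    constructor
    · rintro ⟨Q', hQ', h⟩
      obtain ⟨g, rfl⟩ := exists_actPoint_eq h.symm
      exact ⟨g, hQ'⟩
    · rintro ⟨g, hg⟩
      exact ⟨_, hg, jetOf_actPoint g Q⟩
  rw [this]
  exact isOpen_iUnion fun g => hU.preimage (continuous_actPoint g)

theorem SmoothPtAt.of_jetOf_eq {G : JetSpace R A → E} {P P' : RegularPoint R A}
    (h : SmoothPtAt (fun Q => G (jetOf Q)) P) (hP : jetOf P = jetOf P') :
    SmoothPtAt (fun Q => G (jetOf Q)) P' := by
  obtain ⟨g, rfl⟩ := exists_actPoint_eq hP.symm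
  simpa only [jetOf_actPoint] using h.comp_actPoint g

theorem eventually_jetOf {P : RegularPoint R A} {p : JetSpace R A → Prop} :
    (∀ᶠ r in 𝓝 (jetOf P), p r) ↔ ∀ᶠ Q in 𝓝 P, p (jetOf Q) := by
  rw [← isOpenMap_jetOf.map_nhds_eq continuous_jetOf.continuousAt, Filter.eventually_map]

theorem mem_smoothJet_iff {G : JetSpace R A → ℝ} :
    G ∈ smoothJet R A ↔ ∀ P, SmoothPtAt (fun Q => G (jetOf Q)) P :=
  Iff.rfl

/-- Extension by zero: over U both factors are smooth, and elsewhere the product vanishes near the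
point because C is closed and contained in U. -/
theorem bump_mul_mem_smoothPoint {b : smoothJet R A} {C U : Set (JetSpace R A)} (hC : IsClosed C)
    (hCU : C ⊆ U) (hb : ∀ r, r ∉ C → b.1 r = 0) {c : RegularPoint R A → ℝ}
    (hc : ∀ Q, jetOf Q ∈ U → SmoothPtAt c Q) :
    (fun Q => b.1 (jetOf Q) * c Q) ∈ smoothPoint R A := by
  refine mem_smoothPoint_iff.mpr fun Q => ?_
  by_cases hQ : jetOf Q ∈ U
  · exact (smoothPtAt_smoothJet b Q).smul (hc Q hQ)
  · refine (smoothPtAt_const (0 : ℝ) Q).congr ?_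
    filter_upwards [(hC.isOpen_compl.preimage continuous_jetOf).mem_nhds
      fun h => hQ (hCU h)] with Q' hQ'
    rw [hb _ hQ', zero_mul]

end PointSpace

section Normed

variable {R : Type*} [CommRing R] [Algebra ℝ R] {A : Type*} [NormedCommRing A] [NormedAlgebra ℝ A]
  [FiniteDimensional ℝ A]

theorem smoothPtAt_eval (f : R) (P : RegularPoint R A) :
    SmoothPtAt (fun Q : RegularPoint R A => Q.1 f) P := by
  let u := Module.finBasis ℝ A
  have h : SmoothPtAt (fun Q : RegularPoint R A => ∑ j, component (u.coord j) f Q • u j) P :=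
    SmoothPtAt.sum fun j => (smoothPtAt_component (u.coord j) f P).smul (smoothPtAt_const (u j) P)
  refine h.congr (Filter.Eventually.of_forall fun Q => ?_)
  exact (u.sum_repr (Q.1 f)).symm

theorem smoothPtAt_of_apply {F : Type*} [NormedAddCommGroup F] [NormedSpace ℝ F]
    {G : RegularPoint R A → A →L[ℝ] F} {P : RegularPoint R A}
    (h : ∀ a, SmoothPtAt (fun Q => G Q a) P) : SmoothPtAt G P := by
  let u := Module.finBasis ℝ A
  have h' : SmoothPtAt (fun Q => ∑ j, ContinuousLinearMap.smulRight
      (LinearMap.toContinuousLinearMap (u.coord j)) (G Q (u j))) P := by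
    refine SmoothPtAt.sum fun j => ?_
    exact (h (u j)).comp_contDiff (Ψ := fun y => ContinuousLinearMap.smulRight
      (LinearMap.toContinuousLinearMap (u.coord j)) y)
      (ContinuousLinearMap.smulRightL ℝ A F
        (LinearMap.toContinuousLinearMap (u.coord j))).contDiff
  refine h'.congr (Filter.Eventually.of_forall fun Q => ?_)
  ext a
  conv_lhs => rw [← u.sum_repr a, map_sum]
  simp

theorem tendsto_eval {X : Type*} {l : Filter X} {γ : X → RegularPoint R A} {P : RegularPoint R A} :
    Filter.Tendsto γ l (𝓝 P) ↔ ∀ f, Filter.Tendsto (fun x => (γ x).1 f) l (𝓝 (P.1 f)) := by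
  constructor
  · exact fun h f => (smoothPtAt_eval f P).continuousAt.tendsto.comp h
  · intro h
    rw [nhds_induced, Filter.tendsto_comap_iff, tendsto_pi_nhds]
    exact fun i => ((LinearMap.toContinuousLinearMap i.1).continuous.tendsto _).comp (h i.2)

end Normed

/-! ## A local slice for the cosets of the automorphism group of a finite dimensional algebra -/

section ExpProduct

variable {B : Type*} [NormedRing B] [NormedAlgebra ℝ B] [FiniteDimensional ℝ B]

theorem exp_neg_mul_exp (x : B) : NormedSpace.exp (-x) * NormedSpace.exp x = 1 := by
  let _ : NormedAlgebra ℚ B := NormedAlgebra.restrictScalars ℚ ℝ B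
  have : CompleteSpace B := FiniteDimensional.complete ℝ B
  rw [← NormedSpace.exp_add_of_commute (Commute.refl x).neg_left, neg_add_cancel,
    NormedSpace.exp_zero]

theorem exists_norm_le_mul_norm_apply {E F : Type*} [NormedAddCommGroup E] [NormedSpace ℝ E]
    [NormedAddCommGroup F] [NormedSpace ℝ F] [FiniteDimensional ℝ E] (f : E →ₗ[ℝ] F)
    (hf : LinearMap.ker f = ⊥) : ∃ K : ℝ, 0 < K ∧ ∀ x, ‖x‖ ≤ K * ‖f x‖ := by
  obtain ⟨K, hK, h⟩ := f.exists_antilipschitzWith hf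
  refine ⟨K, hK, fun x => ?_⟩
  simpa using h.le_mul_dist x 0

/-- For complementary subspaces `H` and `N`, every element near `1` is smoothly and locally uniquely
a product `exp h * (1 + n)`. -/
theorem exists_exp_mul_one_add {H N : Submodule ℝ B} (hN : IsCompl H N) :
    ∃ δ ν : B → B, (∀ g, δ g ∈ H) ∧ (∀ g, ν g ∈ N) ∧ ν 1 = 0 ∧
      (∀ᶠ g in 𝓝 1, ContDiffAt ℝ ω ν g) ∧
      ∀ᶠ g in 𝓝 1, NormedSpace.exp (δ g) * (1 + ν g) = g := by
  let _ : NormedAlgebra ℚ B := NormedAlgebra.restrictScalars ℚ ℝ B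
  have : CompleteSpace B := FiniteDimensional.complete ℝ B
  -- The differential of `f` at 0 is (h, n) ↦ h + n, invertible for complementary subspaces. The
  -- components of the local inverse are δ and ν.
  let f : H × N → B := fun z => NormedSpace.exp (z.1 : B) * (1 + (z.2 : B))
  have hexp : ContDiff ℝ ω (NormedSpace.exp : B → B) :=
    contDiff_iff_contDiffAt.mpr fun x => (NormedSpace.exp_analytic (𝕂 := ℝ) x).contDiffAt
  have hf : ContDiffAt ℝ ω f 0 := by
    have h1 : ContDiff ℝ ω fun z : H × N => (z.1 : B) :=
      ContDiff.comp (g := H.subtypeL) (ContinuousLinearMap.contDiff _) contDiff_fst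
    have h2 : ContDiff ℝ ω fun z : H × N => (z.2 : B) :=
      ContDiff.comp (g := N.subtypeL) (ContinuousLinearMap.contDiff _) contDiff_snd
    exact ((hexp.comp h1).mul (contDiff_const.add h2)).contDiffAt
  let e : (H × N) ≃L[ℝ] B := (Submodule.prodEquivOfIsCompl H N hN).toContinuousLinearEquiv
  have hf' : HasFDerivAt f (e : (H × N) →L[ℝ] B) 0 := by
    have h1 : HasFDerivAt (fun z : H × N => NormedSpace.exp (z.1 : B))
        ((1 : B →L[ℝ] B).comp (H.subtypeL.comp (ContinuousLinearMap.fst ℝ H N))) 0 :=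
      HasFDerivAt.comp (g := NormedSpace.exp) (f := fun z : H × N => (z.1 : B)) 0 (by
        simpa using hasFDerivAt_exp_zero (𝕂 := ℝ) (𝔸 := B))
        (ContinuousLinearMap.hasFDerivAt (H.subtypeL.comp (ContinuousLinearMap.fst ℝ H N)))
    have h2 : HasFDerivAt (fun z : H × N => (1 : B) + (z.2 : B))
        (N.subtypeL.comp (ContinuousLinearMap.snd ℝ H N)) 0 :=
      (ContinuousLinearMap.hasFDerivAt (N.subtypeL.comp (ContinuousLinearMap.snd ℝ H N))).const_add _
    have h3 := h1.mul' h2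
    refine h3.congr_fderiv (ContinuousLinearMap.ext fun z => ?_)
    simp [e, add_comm]
  have hω : (ω : WithTop ℕ∞) ≠ 0 := by simp
  have hf0 : f 0 = 1 := by simp [f]
  let inv := hf.localInverse hf' hω
  have hinv0 : inv 1 = 0 := by
    have := hf.localInverse_apply_image hf' hω
    rwa [hf0] at this
  have hinvd : ContDiffAt ℝ ω inv 1 := by
    have := hf.to_localInverse hf' hω
    rwa [hf0] at this
  refine ⟨fun g => (inv g).1, fun g => (inv g).2, fun g => (inv g).1.2, fun g => (inv g).2.2,
    by simp [hinv0], ?_, ?_⟩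
  · filter_upwards [hinvd.eventually (by simp)] with g hg
    exact ContDiffAt.comp (g := N.subtypeL) g (ContinuousLinearMap.contDiff _).contDiffAt
      (contDiff_snd.contDiffAt.comp g hg)
  · have := (hf.hasStrictFDerivAt' hf' hω).eventually_right_inverse
    rwa [hf0] at this

end ExpProduct

section Slice

variable {A : Type*} [NormedCommRing A] [NormedAlgebra ℝ A]

theorem endomorphism_mul_apply (f g : A →L[ℝ] A) (a : A) : (f * g) a = f (g a) :=
  rfl

/-- Multiplicative continuous linear endomorphisms. -/
def IsMulMap (h : A →L[ℝ] A) : Prop :=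
  ∀ a b, h (a * b) = h a * h b

theorem IsMulMap.exists_algEquiv {h : A →L[ℝ] A} (hm : IsMulMap h) (hu : IsUnit h) :
    ∃ g : A ≃ₐ[ℝ] A, ∀ a, g a = h a := by
  obtain ⟨u, rfl⟩ := hu
  have hr : ∀ a, (u : A →L[ℝ] A) ((↑u⁻¹ : A →L[ℝ] A) a) = a := fun a =>
    congrArg (fun f : A →L[ℝ] A => f a) u.mul_inv
  have hl : ∀ a, (↑u⁻¹ : A →L[ℝ] A) ((u : A →L[ℝ] A) a) = a := fun a =>
    congrArg (fun f : A →L[ℝ] A => f a) u.inv_mul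
  -- Preservation of 1 is not part of `IsMulMap`; it follows from multiplicativity at a preimage of
  -- 1.
  have h1 : (u : A →L[ℝ] A) 1 = 1 := by
    have := hm 1 ((↑u⁻¹ : A →L[ℝ] A) 1)
    rw [one_mul, hr, mul_one] at this
    exact this.symm
  exact ⟨AlgEquiv.ofBijective (AlgHom.ofLinearMap ((u : A →L[ℝ] A) : A →ₗ[ℝ] A) h1 hm)
    (Function.bijective_iff_has_inverse.mpr ⟨_, hl, hr⟩), fun a => rfl⟩

variable (A) in
/-- The continuous derivations, as a subspace of the continuous endomorphisms. -/
def derivationSubspace : Submodule ℝ (A →L[ℝ] A) where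
  carrier := {δ | ∀ a b, δ (a * b) = δ a * b + a * δ b}
  zero_mem' := by simp
  add_mem' {δ ε} hδ hε a b := by
    simp only [Set.mem_ofPred_eq] at hδ hε
    simp only [add_apply, hδ, hε]
    ring
  smul_mem' c δ hδ a b := by
    simp only [Set.mem_ofPred_eq] at hδ
    simp only [smul_apply, hδ, smul_add, smul_mul_assoc, mul_smul_comm]

theorem exp_zero_smul (δ : A →L[ℝ] A) : NormedSpace.exp ((0 : ℝ) • δ) = 1 := by
  rw [show (0 : ℝ) • δ = 0 from zero_smul ℝ δ, NormedSpace.exp_zero]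

theorem hasDerivAt_exp_smul_apply [CompleteSpace A] (δ : A →L[ℝ] A) (c : A) (t : ℝ) :
    HasDerivAt (fun t : ℝ => NormedSpace.exp (t • δ) c) (δ (NormedSpace.exp (t • δ) c)) t := by
  have := (hasDerivAt_exp_smul_const' (𝕂 := ℝ) δ t).clm_apply (hasDerivAt_const t c)
  simpa using this

theorem isMulMap_exp [CompleteSpace A] {δ : A →L[ℝ] A} (hδ : δ ∈ derivationSubspace A) :
    IsMulMap (NormedSpace.exp δ) := by
  let _ : NormedAlgebra ℚ (A →L[ℝ] A) := NormedAlgebra.restrictScalars ℚ ℝ (A →L[ℝ] A)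
  intro a b
  -- The derivative of `φ` vanishes precisely by the Leibniz rule for `δ`; comparing times 0 and 1
  -- gives multiplicativity.
  let φ : ℝ → A := fun t => NormedSpace.exp (t • (-δ))
    (NormedSpace.exp (t • δ) a * NormedSpace.exp (t • δ) b)
  have hφ : ∀ t, HasDerivAt φ 0 t := fun t => by
    have h1 := fun c : A => hasDerivAt_exp_smul_apply δ c t
    have h2 := hasDerivAt_exp_smul_const (𝕂 := ℝ) (-δ) t
    have h3 := h2.clm_apply ((h1 a).mul (h1 b))
    convert! h3 using 1
    rw [endomorphism_mul_apply, neg_apply, map_neg, Pi.mul_apply, hδ, neg_add_cancel]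
  have hc := is_const_of_deriv_eq_zero (fun t => (hφ t).differentiableAt) (fun t => (hφ t).deriv) 1 0
  have e1 : ∀ δ : A →L[ℝ] A, (1 : ℝ) • δ = δ := one_smul ℝ
  have h0 : φ 0 = a * b := by
    simp only [φ, exp_zero_smul]
    rfl
  have h1 : φ 1 = NormedSpace.exp (-δ) (NormedSpace.exp δ a * NormedSpace.exp δ b) := by
    simp only [φ, e1]
  have h2 : NormedSpace.exp δ * NormedSpace.exp (-δ) = 1 := by
    rw [← NormedSpace.exp_add_of_commute (Commute.refl δ).neg_right, add_neg_cancel,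
      NormedSpace.exp_zero]
  rw [h0, h1] at hc
  rw [← hc, ← endomorphism_mul_apply, h2]
  rfl

/-- The deviation of an endomorphism from being a derivation. -/
def derivationDefect (k : A →L[ℝ] A) : A →L[ℝ] A →L[ℝ] A :=
  (ContinuousLinearMap.compL ℝ A A A k).comp (ContinuousLinearMap.mul ℝ A) -
    (ContinuousLinearMap.mul ℝ A).comp k -
    ((ContinuousLinearMap.compL ℝ A A A).flip k).comp (ContinuousLinearMap.mul ℝ A)

theorem derivationDefect_apply (k : A →L[ℝ] A) (a b : A) :
    derivationDefect k a b = k (a * b) - k a * b - a * k b :=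
  rfl

theorem norm_derivationDefect_le (k : A →L[ℝ] A) : ‖derivationDefect k‖ ≤ 3 * ‖k‖ := by
  refine ContinuousLinearMap.opNorm_le_bound₂ _ (by positivity) fun a b => ?_
  rw [derivationDefect_apply]
  have h1 : ‖k (a * b)‖ ≤ ‖k‖ * (‖a‖ * ‖b‖) :=
    (k.le_opNorm _).trans (mul_le_mul_of_nonneg_left (norm_mul_le a b) (norm_nonneg k))
  have h2 : ‖k a * b‖ ≤ ‖k‖ * ‖a‖ * ‖b‖ :=
    (norm_mul_le _ _).trans (mul_le_mul_of_nonneg_right (k.le_opNorm a) (norm_nonneg b))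
  have h3 : ‖a * k b‖ ≤ ‖a‖ * (‖k‖ * ‖b‖) :=
    (norm_mul_le _ _).trans (mul_le_mul_of_nonneg_left (k.le_opNorm b) (norm_nonneg a))
  have h4 := norm_sub_le (k (a * b) - k a * b) (a * k b)
  have h5 := norm_sub_le (k (a * b)) (k a * b)
  linarith

variable (A) in
/-- The deviation from being a derivation, as a linear map. -/
def derivationDefectₗ : (A →L[ℝ] A) →ₗ[ℝ] A →L[ℝ] A →L[ℝ] A where
  toFun := derivationDefect
  map_add' k l := by
    ext a b
    simp only [derivationDefect_apply, add_apply]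
    ring
  map_smul' c k := by
    ext a b
    simp only [derivationDefect_apply, smul_apply, RingHom.id_apply, smul_sub, smul_mul_assoc,
      mul_smul_comm]

theorem derivationDefect_eq_zero_iff {k : A →L[ℝ] A} :
    derivationDefectₗ A k = 0 ↔ k ∈ derivationSubspace A := by
  constructor
  · intro h a b
    have h1 : derivationDefect k a b = 0 := by
      change derivationDefectₗ A k a b = 0
      rw [h]
      rfl
    rw [derivationDefect_apply, sub_sub, sub_eq_zero] at h1
    exact h1
  · intro h
    ext a b
    change derivationDefect k a b = 0
    rw [derivationDefect_apply, h a b]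
    ring

variable [FiniteDimensional ℝ A]

/-- With k = h - 1, multiplicativity of h says that the defect of k from being a derivation is the
quadratic expression k(a)k(b). From y - x = k + kx the defect of y - x is of second order in the
small quantities, while on N, which meets the derivations only in 0, the defect bounds the norm from
below. Hence y - x = 0. No closeness of h to 1 is assumed; it follows from x and y being small. -/
theorem exists_rigid {N : Submodule ℝ (A →L[ℝ] A)} (hN : Disjoint (derivationSubspace A) N) :
    ∃ ε > 0, ∀ x ∈ N, ∀ y ∈ N, ‖x‖ < ε → ‖y‖ < ε → ∀ h : A →L[ℝ] A, IsMulMap h →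
      1 + y = h * (1 + x) → y = x := by
  obtain ⟨K, hK', hanti⟩ := exists_norm_le_mul_norm_apply (E := N) (F := A →L[ℝ] A →L[ℝ] A)
    ((derivationDefectₗ A).domRestrict N) (by
      rw [LinearMap.ker_eq_bot']
      intro m hm
      have h1 := derivationDefect_eq_zero_iff.mp hm
      exact Subtype.ext (Submodule.disjoint_def.mp hN m.1 h1 m.2))
  let C := derivationDefectₗ A
  -- The bound 1/2 on x gives ‖k‖ ≤ 2‖y - x‖ ≤ 4ε. The 7 is 4 + 3, from ‖k‖ + 3‖x‖, and the
  -- remaining 4K makes the final contraction factor 1/2.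
  set ε : ℝ := min (1 / 2) (1 / (4 * K * 7)) with hε
  have hε0 : 0 < ε := lt_min (by norm_num) (by positivity)
  refine ⟨ε, hε0, fun x hx y hy hxε hyε h hh hxy => ?_⟩
  have hε1 : ε ≤ 1 / 2 := min_le_left _ _
  have hε2 : ε * (4 * K * 7) ≤ 1 := by
    have := min_le_right (1 / 2) (1 / (4 * K * 7))
    rw [← hε, le_div_iff₀ (by positivity)] at this
    exact this
  set k : A →L[ℝ] A := h - 1 with hk
  have e1 : y - x = k + k * x := by
    have : y = h * (1 + x) - 1 := by rw [← hxy]; abel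
    rw [hk, sub_mul, one_mul, this, mul_add, mul_one]
    abel
  have hd : ‖y - x‖ ≤ 2 * ε := by
    have := norm_sub_le y x
    linarith
  have hkx : ‖k * x‖ ≤ ‖k‖ * ‖x‖ := norm_mul_le k x
  have hk1 : ‖k‖ ≤ 2 * ‖y - x‖ := by
    have e2 : k = (y - x) - k * x := by rw [e1]; abel
    have h1 : ‖k‖ ≤ ‖y - x‖ + ‖k * x‖ := by
      conv_lhs => rw [e2]
      exact norm_sub_le _ _
    have h2 : ‖k‖ * ‖x‖ ≤ ‖k‖ * (1 / 2) :=
      mul_le_mul_of_nonneg_left (hxε.le.trans hε1) (norm_nonneg k)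
    linarith
  have hCk : ‖C k‖ ≤ ‖k‖ * ‖k‖ := by
    refine ContinuousLinearMap.opNorm_le_bound₂ _ (by positivity) fun a b => ?_
    have e3 : C k a b = k a * k b := by
      change derivationDefect k a b = _
      rw [derivationDefect_apply]
      have : ∀ c, k c = h c - c := fun c => rfl
      rw [this, this, this, hh a b]
      ring
    rw [e3]
    calc ‖k a * k b‖ ≤ ‖k a‖ * ‖k b‖ := norm_mul_le _ _
      _ ≤ (‖k‖ * ‖a‖) * (‖k‖ * ‖b‖) := by
        gcongr <;> exact k.le_opNorm _
      _ = ‖k‖ * ‖k‖ * ‖a‖ * ‖b‖ := by ring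
  have hCd : ‖C (y - x)‖ ≤ ‖k‖ * ‖k‖ + 3 * (‖k‖ * ‖x‖) := by
    rw [e1, map_add]
    have h7 : ‖C (k * x)‖ ≤ 3 * (‖k‖ * ‖x‖) :=
      (norm_derivationDefect_le (k * x)).trans (mul_le_mul_of_nonneg_left hkx zero_le_three)
    have h8 := norm_add_le (C k) (C (k * x))
    linarith
  have hlow : ‖y - x‖ ≤ K * ‖C (y - x)‖ := hanti ⟨y - x, N.sub_mem hy hx⟩
  have hfin : ‖y - x‖ ≤ ‖y - x‖ / 2 := by
    have h4 : ‖k‖ ≤ 4 * ε := by linarith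
    have h5 : ‖k‖ * ‖k‖ + 3 * (‖k‖ * ‖x‖) ≤ (2 * ‖y - x‖) * (ε * 7) := by
      have : ‖k‖ * ‖k‖ + 3 * (‖k‖ * ‖x‖) = ‖k‖ * (‖k‖ + 3 * ‖x‖) := by ring
      rw [this]
      have h6 : ‖k‖ + 3 * ‖x‖ ≤ ε * 7 := by
        have := mul_le_mul_of_nonneg_left hxε.le zero_le_three
        linarith
      exact mul_le_mul hk1 h6 (by positivity) (by positivity)
    calc ‖y - x‖ ≤ K * ‖C (y - x)‖ := hlow
      _ ≤ K * ((2 * ‖y - x‖) * (ε * 7)) :=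
        mul_le_mul_of_nonneg_left (hCd.trans h5) hK'.le
      _ = (ε * (4 * K * 7)) * (‖y - x‖ / 2) := by ring
      _ ≤ 1 * (‖y - x‖ / 2) := by gcongr
      _ = ‖y - x‖ / 2 := one_mul _
  have : ‖y - x‖ ≤ 0 := by linarith
  exact sub_eq_zero.mp (norm_le_zero_iff.mp this)

variable (A) in
/-- Near the identity, the cosets of the group of automorphisms of `A` in the general linear group
have representatives that depend smoothly on the coset. -/
theorem exists_slice :
    ∃ (U : Set (A →L[ℝ] A)) (ν : (A →L[ℝ] A) → (A →L[ℝ] A)), IsOpen U ∧ 1 ∈ U ∧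
      ContDiffOn ℝ ∞ ν U ∧ ν 1 = 1 ∧
      (∀ g ∈ U, IsUnit g ∧ ∃ h, IsMulMap h ∧ IsUnit h ∧ g = h * ν g) ∧
      ∀ g ∈ U, ∀ g' ∈ U, ∀ h, IsMulMap h → IsUnit h → g' = h * g → ν g' = ν g := by
  let _ : NormedAlgebra ℚ (A →L[ℝ] A) := NormedAlgebra.restrictScalars ℚ ℝ (A →L[ℝ] A)
  have : CompleteSpace A := FiniteDimensional.complete ℝ A
  obtain ⟨N, hN⟩ := (derivationSubspace A).exists_isCompl
  obtain ⟨ε, hε, hrigid⟩ := exists_rigid hN.disjoint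
  obtain ⟨δ, ν, hδ, hν, hν1, h1, h2⟩ := exists_exp_mul_one_add hN
  have h3 : ∀ᶠ g in 𝓝 (1 : A →L[ℝ] A), ‖ν g‖ < ε := by
    refine h1.self_of_nhds.continuousAt.norm.eventually_lt continuousAt_const ?_
    rwa [hν1, norm_zero]
  have h4 : ∀ᶠ g in 𝓝 (1 : A →L[ℝ] A), IsUnit g := Units.isOpen.mem_nhds isUnit_one
  obtain ⟨U, hU, hUo, h1U⟩ := eventually_nhds_iff.mp (h1.and (h2.and (h3.and h4)))
  refine ⟨U, fun g => 1 + ν g, hUo, h1U, fun g hg => ?_, ?_, fun g hg => ?_,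
    fun g hg g' hg' h hm hu hgg' => ?_⟩
  · exact (contDiffAt_const.add ((hU g hg).1.of_le (by simp))).contDiffWithinAt
  · exact (congrArg (fun x => 1 + x) hν1).trans (add_zero 1)
  · exact ⟨(hU g hg).2.2.2, NormedSpace.exp (δ g), isMulMap_exp (hδ g),
      NormedSpace.isUnit_exp _, (hU g hg).2.1.symm⟩
  · obtain ⟨-, e1, n1, -⟩ := hU g hg
    obtain ⟨-, e2, n2, -⟩ := hU g' hg'
    have m1 := isMulMap_exp (Submodule.neg_mem _ (hδ g'))
    have m2 := isMulMap_exp (hδ g)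
    have e3 : NormedSpace.exp (-δ g') * NormedSpace.exp (δ g') = 1 := exp_neg_mul_exp (δ g')
    -- Moving the exponentials to one side, 1 + ν g' is the product of 1 + ν g with the
    -- multiplicative map exp(-δ g') h exp(δ g), so rigidity applies.
    have key := hrigid _ (hν g) _ (hν g') n1 n2
      (NormedSpace.exp (-δ g') * h * NormedSpace.exp (δ g)) (fun a b => ?_) ?_
    · exact congrArg (fun x => 1 + x) key
    · simp only [endomorphism_mul_apply]
      rw [m2 a b, hm, m1]
    · rw [mul_assoc, mul_assoc, e1, ← hgg']
      calc 1 + ν g' = NormedSpace.exp (-δ g') * (NormedSpace.exp (δ g') * (1 + ν g')) := by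
            rw [← mul_assoc, e3, one_mul]
        _ = NormedSpace.exp (-δ g') * g' := congrArg _ e2

end Slice

/-! ## Smooth sections and bump functions on the space of jets -/

section Invertible

variable {A : Type*} [NormedCommRing A] [NormedAlgebra ℝ A]

theorem isUnit_mul_inverse_apply {L : A →L[ℝ] A} (h : IsUnit L) (a : A) :
    L (Ring.inverse L a) = a :=
  congrArg (fun f : A →L[ℝ] A => f a) (Ring.mul_inverse_cancel L h)

theorem isUnit_inverse_mul_apply {L : A →L[ℝ] A} (h : IsUnit L) (a : A) :
    Ring.inverse L (L a) = a :=
  congrArg (fun f : A →L[ℝ] A => f a) (Ring.inverse_mul_cancel L h)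

end Invertible

section JetBump

variable {R : Type*} [CommRing R] [Algebra ℝ R] {A : Type*} [NormedCommRing A] [NormedAlgebra ℝ A]
  [FiniteDimensional ℝ A]

variable (R A) in
/-- Every regular `A`-point has a neighbourhood on which all the values are bounded. -/
def HasBoundedNhds : Prop :=
  ∀ P : RegularPoint R A, ∃ V ∈ 𝓝 P, ∀ f : R, ∃ C : ℝ, ∀ Q ∈ V, ‖Q.1 f‖ ≤ C

/-- The endomorphism of `A` that a regular `A`-point induces on a family of elements of `R` indexed
by `A`. -/
def frameMap (lam : A →ₗ[ℝ] R) (Q : RegularPoint R A) : A →L[ℝ] A :=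
  LinearMap.toContinuousLinearMap (Q.1.toLinearMap ∘ₗ lam)

theorem frameMap_apply (lam : A →ₗ[ℝ] R) (Q : RegularPoint R A) (a : A) :
    frameMap lam Q a = Q.1 (lam a) :=
  rfl

theorem frameMap_eq_one {lam : A →ₗ[ℝ] R} {P : RegularPoint R A} (h : ∀ a, P.1 (lam a) = a) :
    frameMap lam P = 1 := by
  ext a
  exact h a

theorem exists_linearSection (P : RegularPoint R A) : ∃ lam : A →ₗ[ℝ] R, ∀ a, P.1 (lam a) = a := by
  obtain ⟨lam, h⟩ := P.1.toLinearMap.exists_rightInverse_of_surjective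
    (LinearMap.range_eq_top.mpr P.2)
  exact ⟨lam, fun a => congrArg (fun f : A →ₗ[ℝ] A => f a) h⟩

/-- An automorphism of `A` as a continuous linear map. -/
def autMap (g : A ≃ₐ[ℝ] A) : A →L[ℝ] A :=
  LinearMap.toContinuousLinearMap (g : A →ₐ[ℝ] A).toLinearMap

theorem autMap_apply (g : A ≃ₐ[ℝ] A) (a : A) : autMap g a = g a :=
  rfl

theorem isMulMap_autMap (g : A ≃ₐ[ℝ] A) : IsMulMap (autMap g) :=
  fun a b => map_mul g a b

theorem isUnit_autMap (g : A ≃ₐ[ℝ] A) : IsUnit (autMap g) := by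
  refine ⟨⟨autMap g, autMap g.symm, ?_, ?_⟩, rfl⟩
  · ext a
    exact g.apply_symm_apply a
  · ext a
    exact g.symm_apply_apply a

/-- Equivariance of the frame: the action on regular points becomes left multiplication on
endomorphisms, where `exists_slice` applies. -/
theorem frameMap_actPoint (lam : A →ₗ[ℝ] R) (g : A ≃ₐ[ℝ] A) (Q : RegularPoint R A) :
    frameMap lam (actPoint g Q) = autMap g * frameMap lam Q :=
  rfl

theorem smoothPtAt_frameMap (lam : A →ₗ[ℝ] R) (P : RegularPoint R A) :
    SmoothPtAt (frameMap lam) P :=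
  smoothPtAt_of_apply fun a => smoothPtAt_eval (lam a) P

theorem continuous_frameMap (lam : A →ₗ[ℝ] R) :
    Continuous (frameMap lam : RegularPoint R A → A →L[ℝ] A) :=
  continuous_iff_continuousAt.mpr fun P => (smoothPtAt_frameMap lam P).continuousAt

theorem SmoothPtAt.ringInverse {G : RegularPoint R A → A →L[ℝ] A} {P : RegularPoint R A}
    (h : SmoothPtAt G P) (hP : IsUnit (G P)) : SmoothPtAt (fun Q => Ring.inverse (G Q)) P := by
  have : CompleteSpace A := FiniteDimensional.complete ℝ A
  refine h.comp (V := {L | IsUnit L}) Units.isOpen ?_ hP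
  rintro _ ⟨L, rfl⟩
  exact (contDiffAt_ringInverse ℝ L).contDiffWithinAt

theorem SmoothPtAt.comp_map {E : Type*} [NormedAddCommGroup E] [NormedSpace ℝ E]
    {G : RegularPoint R A → E} {S : RegularPoint R A → RegularPoint R A} {P : RegularPoint R A}
    (hS : ∀ f, SmoothPtAt (fun Q => (S Q).1 f) P) (hG : SmoothPtAt G (S P)) :
    SmoothPtAt (fun Q => G (S Q)) P := by
  obtain ⟨ι, _, η, f, Φ, hΦ, h⟩ := hG
  have hc : Filter.Tendsto S (𝓝 P) (𝓝 (S P)) :=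
    tendsto_eval.mpr fun f => (hS f).continuousAt
  have h1 : SmoothPtAt (fun Q => Φ fun i => component (η i) (f i) (S Q)) P := by
    refine (SmoothPtAt.pi fun i => ?_).comp_contDiff hΦ
    exact (hS (f i)).comp_contDiff (Ψ := fun a => η i a)
      (LinearMap.toContinuousLinearMap (η i)).contDiff
  exact h1.congr (hc.eventually h)

theorem exists_tendsto_of_bounded {X : Type*} (u : Ultrafilter X) {E : Type*}
    [NormedAddCommGroup E] [NormedSpace ℝ E] [FiniteDimensional ℝ E] {φ : X → E} {S : Set X}
    (hS : S ∈ u) {c : E} {C : ℝ} (h : ∀ x ∈ S, φ x ∈ Metric.closedBall c C) :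
    ∃ v ∈ Metric.closedBall c C, Filter.Tendsto φ u (𝓝 v) := by
  have : ProperSpace E := FiniteDimensional.proper ℝ E
  obtain ⟨v, hv, h⟩ := (isCompact_closedBall c C).ultrafilter_le_nhds (u.map φ) (by
    rw [Filter.le_principal_iff]
    exact Filter.mem_map.mpr (Filter.mem_of_superset hS h))
  exact ⟨v, hv, h⟩

/-- The action of the automorphisms of `A` on the regular `A`-points is proper. -/
theorem exists_nhds_isClosed_image_jetOf (hB : HasBoundedNhds R A) (P : RegularPoint R A) :
    ∃ V ∈ 𝓝 P, ∀ K : Set (RegularPoint R A), IsClosed K → K ⊆ V → IsClosed (jetOf '' K) := by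
  have : CompleteSpace A := FiniteDimensional.complete ℝ A
  obtain ⟨lam, hlam⟩ := exists_linearSection P
  obtain ⟨V, hV, hVB⟩ := hB P
  -- A closed ball of invertible endomorphisms: limits of frames taken in it stay invertible.
  obtain ⟨δ, hδ, hδu⟩ := Metric.nhds_basis_closedBall.mem_iff.mp
    (Units.isOpen.mem_nhds (isUnit_one (M := A →L[ℝ] A)))
  refine ⟨V ∩ frameMap lam ⁻¹' Metric.closedBall 1 δ, Filter.inter_mem hV
    ((continuous_frameMap lam).continuousAt ?_), fun K hK hKV => ?_⟩
  · rw [frameMap_eq_one hlam]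
    exact Metric.closedBall_mem_nhds 1 hδ
  rw [isClosed_coinduced, isClosed_iff_ultrafilter]
  intro Q u hu hS
  have hex : ∀ Q' ∈ jetOf ⁻¹' (jetOf '' K), ∃ k ∈ K, ∃ g : A ≃ₐ[ℝ] A, Q' = actPoint g k := by
    rintro Q' ⟨k, hk, h⟩
    exact ⟨k, hk, exists_actPoint_eq h⟩
  have : Nonempty (RegularPoint R A) := ⟨P⟩
  choose! k hk g hg using hex
  -- Boundedness of the values and compactness of balls in A give limits along the ultrafilter. That
  -- `v` is a regular point is not known yet; it follows once the automorphisms `g` converge.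
  have hv : ∀ f : R, ∃ v, Filter.Tendsto (fun Q' => (k Q').1 f) u (𝓝 v) := fun f => by
    obtain ⟨C, hC⟩ := hVB f
    obtain ⟨v, -, h⟩ := exists_tendsto_of_bounded u hS (c := (0 : A)) (C := C)
      (φ := fun Q' => (k Q').1 f) fun Q' hQ' => by
        rw [mem_closedBall_zero_iff]
        exact hC _ (hKV (hk Q' hQ')).1
    exact ⟨v, h⟩
  choose v hv using hv
  obtain ⟨l, hl, hlt⟩ := exists_tendsto_of_bounded u hS (c := (1 : A →L[ℝ] A)) (C := δ)
    (φ := fun Q' => frameMap lam (k Q')) fun Q' hQ' => (hKV (hk Q' hQ')).2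
  have hlu : IsUnit l := hδu hl
  have hQt : Filter.Tendsto (frameMap lam) u (𝓝 (frameMap lam Q)) :=
    ((continuous_frameMap lam).tendsto Q).mono_left hu
  set G : A →L[ℝ] A := frameMap lam Q * Ring.inverse l with hGdef
  have hinv : Filter.Tendsto (fun Q' => Ring.inverse (frameMap lam (k Q'))) u
      (𝓝 (Ring.inverse l)) := by
    obtain ⟨l', rfl⟩ := hlu
    exact (NormedRing.inverse_continuousAt l').tendsto.comp hlt
  have hG : Filter.Tendsto (fun Q' => autMap (g Q')) u (𝓝 G) := by
    -- The automorphism is recovered from frames, as frame(Q') times the inverse of frame(k Q'), so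
    -- it converges. The limit is multiplicative, and surjective because Q is.
    refine (hQt.mul hinv).congr' ?_
    filter_upwards [hS] with Q' hQ'
    conv_lhs => rw [hg Q' hQ', frameMap_actPoint, ← hg Q' hQ']
    rw [mul_assoc, Ring.mul_inverse_cancel _ (hδu (hKV (hk Q' hQ')).2), mul_one]
  have hGa : ∀ a, Filter.Tendsto (fun Q' => g Q' a) u (𝓝 (G a)) := fun a =>
    ((ContinuousLinearMap.apply ℝ A a).continuous.tendsto G).comp hG
  have hGm : IsMulMap G := fun a b => by
    refine tendsto_nhds_unique (hGa (a * b)) ?_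
    simpa only [map_mul] using (hGa a).mul (hGa b)
  have hGv : ∀ f, G (v f) = Q.1 f := fun f => by
    have h1 : Filter.Tendsto (fun Q' => g Q' ((k Q').1 f)) u (𝓝 (G (v f))) :=
      (isBoundedBilinearMap_apply.continuous.tendsto (G, v f)).comp (hG.prodMk_nhds (hv f))
    have h2 : Filter.Tendsto (fun Q' : RegularPoint R A => Q'.1 f) u (𝓝 (Q.1 f)) :=
      (tendsto_eval.mp Filter.tendsto_id f).mono_left hu
    refine tendsto_nhds_unique (h1.congr' ?_) h2
    filter_upwards [hS] with Q' hQ'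
    conv_rhs => rw [hg Q' hQ']
    rfl
  have hGs : Function.Surjective G := fun a => by
    obtain ⟨f, hf⟩ := Q.2 a
    exact ⟨v f, (hGv f).trans hf⟩
  have hGu : IsUnit G := ContinuousLinearMap.isUnit_iff_bijective.mpr
    ⟨LinearMap.injective_iff_surjective (f := (G : A →ₗ[ℝ] A)).mpr hGs, hGs⟩
  obtain ⟨γ, hγ⟩ := hGm.exists_algEquiv hGu
  have hkt : Filter.Tendsto k u (𝓝 (actPoint γ.symm Q)) := tendsto_eval.mpr fun f => by
    have : (actPoint γ.symm Q).1 f = v f := by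
      rw [actPoint_apply, AlgEquiv.symm_apply_eq, hγ, hGv]
    rw [this]
    exact hv f
  refine ⟨actPoint γ.symm Q, ?_, jetOf_actPoint _ _⟩
  exact hK.mem_of_tendsto hkt (Filter.mem_of_superset hS hk)

/-- If frame(Q) = h ν(frame Q) with h an automorphism, the representative of the orbit of Q is h⁻¹Q,
that is, ν(frame Q) frame(Q)⁻¹ Q. It is smooth in Q, unchanged under automorphisms since ν depends
only on the coset, and equal to P at P, whose frame is 1. -/
theorem exists_smooth_section (P : RegularPoint R A) :
    ∃ (W : Set (JetSpace R A)) (s : JetSpace R A → RegularPoint R A), IsOpen W ∧ jetOf P ∈ W ∧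
      s (jetOf P) = P ∧ (∀ r ∈ W, jetOf (s r) = r) ∧
      ∀ (Q : RegularPoint R A), jetOf Q ∈ W → ∀ f : R, SmoothPtAt (fun Q => (s (jetOf Q)).1 f) Q := by
  classical
  obtain ⟨lam, hlam⟩ := exists_linearSection P
  obtain ⟨U, ν, hU, h1U, hν, hν1, hdec, hinv⟩ := exists_slice A
  set O : Set (RegularPoint R A) := frameMap lam ⁻¹' U with hO
  have hOo : IsOpen O := hU.preimage (continuous_frameMap lam)
  have hPO : P ∈ O := by
    rw [hO, Set.mem_preimage, frameMap_eq_one hlam]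
    exact h1U
  have hex : ∀ Q ∈ O, ∃ T : RegularPoint R A, jetOf T = jetOf Q ∧
      ∀ f, T.1 f = ν (frameMap lam Q) (Ring.inverse (frameMap lam Q) (Q.1 f)) := by
    intro Q hQ
    obtain ⟨hu, h, hm, hhu, e⟩ := hdec _ hQ
    obtain ⟨g, hg⟩ := hm.exists_algEquiv hhu
    refine ⟨actPoint g.symm Q, jetOf_actPoint _ _, fun f => ?_⟩
    rw [actPoint_apply, AlgEquiv.symm_apply_eq, hg]
    have : h (ν (frameMap lam Q) (Ring.inverse (frameMap lam Q) (Q.1 f))) =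
        (h * ν (frameMap lam Q)) (Ring.inverse (frameMap lam Q) (Q.1 f)) := rfl
    rw [this, ← e, isUnit_mul_inverse_apply hu]
  have hindep : ∀ Q ∈ O, ∀ Q' ∈ O, jetOf Q = jetOf Q' → ∀ f : R,
      ν (frameMap lam Q) (Ring.inverse (frameMap lam Q) (Q.1 f)) =
        ν (frameMap lam Q') (Ring.inverse (frameMap lam Q') (Q'.1 f)) := by
    intro Q hQ Q' hQ' h f
    obtain ⟨g, rfl⟩ := exists_actPoint_eq h
    rw [hinv _ hQ _ hQ' (autMap g) (isMulMap_autMap g) (isUnit_autMap g) (frameMap_actPoint _ _ _)]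
    congr 1
    have h1 := isUnit_inverse_mul_apply (hdec _ hQ').1 (Ring.inverse (frameMap lam Q) (Q.1 f))
    rw [frameMap_actPoint, endomorphism_mul_apply, isUnit_mul_inverse_apply (hdec _ hQ).1] at h1
    rw [frameMap_actPoint, ← h1]
    rfl
  have : Nonempty (RegularPoint R A) := ⟨P⟩
  choose! T hTj hT using hex
  let s : JetSpace R A → RegularPoint R A := fun r =>
    if h : ∃ Q ∈ O, jetOf Q = r then T h.choose else P
  have hs : ∀ Q ∈ O, ∀ f, (s (jetOf Q)).1 f =
      ν (frameMap lam Q) (Ring.inverse (frameMap lam Q) (Q.1 f)) := by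
    intro Q hQ f
    have h : ∃ Q' ∈ O, jetOf Q' = jetOf Q := ⟨Q, hQ, rfl⟩
    have e : s (jetOf Q) = T h.choose := dif_pos h
    rw [e, hT _ h.choose_spec.1]
    exact hindep _ h.choose_spec.1 _ hQ h.choose_spec.2 f
  refine ⟨jetOf '' O, s, isOpenMap_jetOf O hOo, ⟨P, hPO, rfl⟩, ?_, ?_, ?_⟩
  · refine Subtype.ext (AlgHom.ext fun f => ?_)
    rw [hs P hPO, frameMap_eq_one hlam, hν1, Ring.inverse_one]
    rfl
  · rintro _ ⟨Q, hQ, rfl⟩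
    have e : s (jetOf Q) = T Q := Subtype.ext (AlgHom.ext fun f => by rw [hs Q hQ, hT Q hQ])
    rw [e, hTj Q hQ]
  · rintro Q ⟨Q₁, hQ₁, h⟩ f
    refine SmoothPtAt.of_jetOf_eq (G := fun r => (s r).1 f) ?_ h
    have h1 : SmoothPtAt (fun Q => ν (frameMap lam Q)
        (Ring.inverse (frameMap lam Q) (Q.1 f))) Q₁ :=
      ((smoothPtAt_frameMap lam Q₁).comp hU hν hQ₁).clm_apply
        (((smoothPtAt_frameMap lam Q₁).ringInverse (hdec _ hQ₁).1).clm_apply (smoothPtAt_eval f Q₁))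
    refine h1.congr ?_
    filter_upwards [hOo.mem_nhds hQ₁] with Q hQ
    exact hs Q hQ f

/-- Bump functions on the space of jets. -/
theorem exists_bump_jet (hB : HasBoundedNhds R A) {q : JetSpace R A} {U : Set (JetSpace R A)}
    (hU : U ∈ 𝓝 q) :
    ∃ (b : smoothJet R A) (C : Set (JetSpace R A)), IsClosed C ∧ C ⊆ U ∧
      (∀ r, r ∉ C → b.1 r = 0) ∧ ∀ᶠ r in 𝓝 q, b.1 r = 1 := by
  classical
  obtain ⟨P, rfl⟩ := jetOf_surjective q
  obtain ⟨W, s, hW, hPW, hsP, hjs, hsm⟩ := exists_smooth_section P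
  obtain ⟨V, hV, hVc⟩ := exists_nhds_isClosed_image_jetOf hB P
  obtain ⟨β, K, hK, hKV, h0, h1⟩ := exists_bump_regularPoint (Filter.inter_mem hV
    (continuous_jetOf.continuousAt.preimage_mem_nhds (Filter.inter_mem hU (hW.mem_nhds hPW))))
  have hC : IsClosed (jetOf '' K) := hVc K hK fun Q hQ => (hKV hQ).1
  have hCU : jetOf '' K ⊆ U ∩ W := by
    rintro _ ⟨Q, hQ, rfl⟩
    exact (hKV hQ).2
  -- A bump function upstairs, pulled back by the section. The extension by zero is smooth because
  -- the image of `K` is closed, by properness, and lies in `W`.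
  let b : JetSpace R A → ℝ := fun r => if r ∈ W then β.1 (s r) else 0
  have hb0 : ∀ r, r ∉ jetOf '' K → b r = 0 := by
    intro r hr
    by_cases hrW : r ∈ W
    · simp only [b, if_pos hrW]
      exact h0 _ fun h => hr ⟨s r, h, hjs r hrW⟩
    · simp only [b, if_neg hrW]
  have hsm' : ∀ Q, jetOf Q ∈ W → SmoothPtAt (fun Q => β.1 (s (jetOf Q))) Q := fun Q hQ =>
    SmoothPtAt.comp_map (S := fun Q => s (jetOf Q)) (hsm Q hQ) (β.2 _)
  refine ⟨⟨b, mem_smoothJet_iff.mpr fun Q => ?_⟩, _, hC, fun r hr => (hCU hr).1, hb0, ?_⟩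
  · by_cases hQ : jetOf Q ∈ W
    · refine (hsm' Q hQ).congr ?_
      filter_upwards [(hW.preimage continuous_jetOf).mem_nhds hQ] with Q' hQ'
      exact if_pos hQ'
    · refine (smoothPtAt_const (0 : ℝ) Q).congr ?_
      filter_upwards [(hC.isOpen_compl.preimage continuous_jetOf).mem_nhds
        fun h => hQ (hCU h).2] with Q' hQ'
      exact hb0 _ hQ'
  · rw [eventually_jetOf]
    have hc : Filter.Tendsto (fun Q => s (jetOf Q)) (𝓝 P) (𝓝 P) := by
      have h2 : Filter.Tendsto (fun Q => s (jetOf Q)) (𝓝 P) (𝓝 (s (jetOf P))) :=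
        tendsto_eval.mpr fun f => (hsm P hPW f).continuousAt
      rwa [hsP] at h2
    filter_upwards [hc.eventually h1, (hW.preimage continuous_jetOf).mem_nhds hPW] with Q hQ hQ'
    exact (if_pos hQ').trans hQ

/-- A function on the space of jets which is smooth near `q` coincides near `q` with a smooth
function. -/
theorem exists_smoothJet_eventuallyEq (hB : HasBoundedNhds R A) {q : JetSpace R A}
    {U : Set (JetSpace R A)} (hU : IsOpen U) (hq : q ∈ U) {G : JetSpace R A → ℝ}
    (hG : ∀ Q, jetOf Q ∈ U → SmoothPtAt (fun Q => G (jetOf Q)) Q) :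
    ∃ F : smoothJet R A, ∀ᶠ r in 𝓝 q, F.1 r = G r := by
  obtain ⟨b, C, hC, hCU, hb, hb1⟩ := exists_bump_jet hB (hU.mem_nhds hq)
  refine ⟨⟨fun r => b.1 r * G r, mem_smoothJet_iff.mpr fun Q =>
    bump_mul_mem_smoothPoint hC hCU hb hG Q⟩, ?_⟩
  filter_upwards [hb1] with r hr
  simp only [hr, one_mul]

/-- Through every regular `A`-point passes a local smooth section of the projection onto the space
of jets. -/
theorem exists_isLocalSection (hB : HasBoundedNhds R A) (P : RegularPoint R A) :
    ∃ s, IsLocalSection s (jetOf P) ∧ s (jetOf P) = P := by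
  obtain ⟨W, s, hW, hPW, hsP, hjs, hsm⟩ := exists_smooth_section P
  refine ⟨s, ⟨?_, fun g => ?_⟩, hsP⟩
  · filter_upwards [hW.mem_nhds hPW] with r hr
    exact hjs r hr
  · exact exists_smoothJet_eventuallyEq hB hW hPW (G := fun r => g.1 (s r)) fun Q hQ =>
      SmoothPtAt.comp_map (S := fun Q => s (jetOf Q)) (hsm Q hQ) (g.2 _)

theorem pointTangent_jet_apply_eq (hB : HasBoundedNhds R A) {q : JetSpace R A}
    {V : Module.Dual ℝ (smoothJet R A)} (hV : V ∈ PointTangent (smoothJet R A) q)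
    {F G : smoothJet R A} (h : ∀ᶠ r in 𝓝 q, F.1 r = G.1 r) : V F = V G := by
  obtain ⟨β, K, _, hK, h0, h1⟩ := exists_bump_jet hB h
  refine pointTangent_apply_eq_of_bump hV h1.self_of_nhds fun r hr => ?_
  by_contra hne
  exact hr (h0 r fun hrK => hne (hK hrK))

/-- The real components of `f` along a local section `s` coincide near the base point with a smooth
function whose pull-back is a combination of real components of `f`. -/
theorem exists_smoothJet_component_section (hB : HasBoundedNhds R A) {P : RegularPoint R A}
    {s : JetSpace R A → RegularPoint R A} (hs : IsLocalSection s (jetOf P)) (hsP : s (jetOf P) = P)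
    (f : R) (η : Module.Dual ℝ A) :
    ∃ (c : Fin (Module.finrank ℝ A) → smoothPoint R A) (F : smoothJet R A),
      jetPullback R A F = ∑ j, c j * smoothComponent ((Module.finBasis ℝ A).coord j) f ∧
      (∀ j, (c j).1 P = η (Module.finBasis ℝ A j)) ∧
      ∀ᶠ r in 𝓝 (jetOf P), F.1 r = component η f (s r) := by
  obtain ⟨lam, hlam⟩ := exists_linearSection P
  set u := Module.finBasis ℝ A with hu
  choose Fr hFr using fun (j k : Fin (Module.finrank ℝ A)) =>
    hs.2 (smoothComponent (u.coord j) (lam (u k)))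
  have hO : IsOpen {Q : RegularPoint R A | IsUnit (frameMap lam Q)} :=
    Units.isOpen.preimage (continuous_frameMap lam)
  have hPu : jetOf P ∈ jetOf '' {Q : RegularPoint R A | IsUnit (frameMap lam Q)} := by
    refine ⟨P, ?_, rfl⟩
    rw [Set.mem_ofPred_eq, frameMap_eq_one hlam]
    exact isUnit_one
  obtain ⟨U, hU, hUo, hPU⟩ := eventually_nhds_iff.mp (hs.1.and
    ((Filter.eventually_all.mpr fun j => Filter.eventually_all.mpr fun k => hFr j k).and
      ((isOpenMap_jetOf _ hO).mem_nhds hPu)))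
  have hunit : ∀ Q, jetOf Q ∈ U → IsUnit (frameMap lam Q) := fun Q hQ => by
    obtain ⟨Q', hQ', h⟩ := (hU _ hQ).2.2
    obtain ⟨g, rfl⟩ := exists_actPoint_eq h
    rw [frameMap_actPoint]
    exact (isUnit_autMap g).mul hQ'
  obtain ⟨b, C, hC, hCU, hb, hb1⟩ := exists_bump_jet hB (hUo.mem_nhds hPU)
  -- The frame of s(r), assembled from globally smooth representatives of its matrix entries.
  let L : JetSpace R A → A →L[ℝ] A := fun r => ∑ k, ContinuousLinearMap.smulRight
    (LinearMap.toContinuousLinearMap (u.coord k)) (∑ j, (Fr j k).1 r • u j)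
  have hLU : ∀ r ∈ U, L r = frameMap lam (s r) := fun r hr => by
    ext a
    conv_rhs => rw [← u.sum_repr a, map_sum]
    simp only [L, sum_apply, map_smul]
    refine Finset.sum_congr rfl fun k _ => ?_
    rw [frameMap_apply, ← u.sum_repr ((s r).1 (lam (u k)))]
    refine congrArg (fun x : A => u.coord k a • x) (Finset.sum_congr rfl fun j _ => ?_)
    rw [(hU r hr).2.1 j k]
    rfl
  have hLs : ∀ Q, SmoothPtAt (fun Q => L (jetOf Q)) Q := fun Q => by
    refine smoothPtAt_of_apply fun a => ?_
    simp only [L, sum_apply]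
    refine SmoothPtAt.sum fun k => ?_
    refine SmoothPtAt.smul (G := fun _ => u.coord k a) (smoothPtAt_const _ _) ?_
    exact SmoothPtAt.sum fun j => (smoothPtAt_smoothJet (Fr j k) Q).smul (smoothPtAt_const _ _)
  have hact : ∀ Q, jetOf Q ∈ U → ∃ g : A ≃ₐ[ℝ] A, s (jetOf Q) = actPoint g Q ∧
      ∀ a, L (jetOf Q) (Ring.inverse (frameMap lam Q) a) = g a := fun Q hQ => by
    obtain ⟨g, hg⟩ := exists_actPoint_eq (hU _ hQ).1.symm
    refine ⟨g, hg, fun a => ?_⟩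
    rw [hLU _ hQ, hg, frameMap_actPoint, endomorphism_mul_apply,
      isUnit_mul_inverse_apply (hunit Q hQ), autMap_apply]
  -- For the automorphism g with s(ker Q) = gQ this is η(g u_j), so expanding Q(f) in the basis
  -- writes f_η ∘ s as a combination of real components of f. At P one has g = 1.
  let c₀ : Fin (Module.finrank ℝ A) → RegularPoint R A → ℝ := fun j Q =>
    η (L (jetOf Q) (Ring.inverse (frameMap lam Q) (u j)))
  have hc₀ : ∀ j Q, jetOf Q ∈ U → SmoothPtAt (c₀ j) Q := fun j Q hQ => by
    have h1 := (hLs Q).clm_apply (((smoothPtAt_frameMap lam Q).ringInverse (hunit Q hQ)).clm_apply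
      (smoothPtAt_const (u j) Q))
    exact h1.comp_contDiff (Ψ := fun a => η a) (LinearMap.toContinuousLinearMap η).contDiff
  let c : Fin (Module.finrank ℝ A) → smoothPoint R A := fun j =>
    ⟨_, bump_mul_mem_smoothPoint hC hCU hb (hc₀ j)⟩
  have hF : ∀ Q, b.1 (jetOf Q) * component η f (s (jetOf Q)) =
      (∑ j, c j * smoothComponent (u.coord j) f).1 Q := fun Q => by
    have e : (∑ j, c j * smoothComponent (u.coord j) f).1 Q =
        b.1 (jetOf Q) * ∑ j, c₀ j Q * u.coord j (Q.1 f) := by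
      rw [AddSubmonoidClass.coe_finsetSum, Finset.sum_apply, Finset.mul_sum]
      exact Finset.sum_congr rfl fun j _ => mul_assoc _ _ _
    rw [e]
    by_cases hQ : jetOf Q ∈ U
    · obtain ⟨g, hg, hga⟩ := hact Q hQ
      congr 1
      rw [hg]
      simp only [c₀, hga]
      change η (g (Q.1 f)) = _
      conv_lhs => rw [← u.sum_repr (Q.1 f), map_sum, map_sum]
      refine Finset.sum_congr rfl fun j _ => ?_
      rw [map_smul, map_smul, smul_eq_mul, mul_comm]
      rfl
    · rw [hb _ fun h => hQ (hCU h), zero_mul, zero_mul]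
  refine ⟨c, ⟨fun r => b.1 r * component η f (s r), mem_smoothJet_iff.mpr fun Q => ?_⟩,
    Subtype.ext (funext fun Q => hF Q), fun j => ?_, ?_⟩
  · exact (smoothPtAt_smoothPoint (∑ j, c j * smoothComponent (u.coord j) f) Q).congr
      (Filter.Eventually.of_forall hF)
  · change b.1 (jetOf P) * η _ = _
    obtain ⟨g, hg, hga⟩ := hact P hPU
    rw [hb1.self_of_nhds, one_mul, hLU _ hPU, hsP, frameMap_eq_one hlam, Ring.inverse_one]
    rfl
  · filter_upwards [hb1] with r hr
    rw [hr, one_mul]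

end JetBump

/-! ## The tangent spaces of the manifolds of regular points and of jets -/

theorem exists_quotientEquiv {R M N : Type*} [CommRing R] [Algebra ℝ R] [AddCommGroup M] [Module ℝ M]
    [Module R M] [IsScalarTower ℝ R M] [AddCommGroup N] [Module ℝ N] (I : Submodule R M)
    (k : M →ₗ[ℝ] N) (hker : ∀ x, k x = 0 ↔ x ∈ I) (hk : Function.Surjective k) :
    ∃ κ : (M ⧸ I) ≃ₗ[ℝ] N, ∀ x, κ (I.mkQ x) = k x := by
  have h : LinearMap.ker k = I.restrictScalars ℝ := by
    ext x
    exact hker x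
  exact ⟨(Submodule.Quotient.restrictScalarsEquiv ℝ I).symm.trans
    ((Submodule.quotEquivOfEq _ _ h.symm).trans (k.quotKerEquivOfSurjective hk)), fun x => rfl⟩

section Residue

variable {R : Type*} [CommRing R] [Algebra ℝ R] {A : Type*} [CommRing A] [Algebra ℝ A]

/-- `D` is a derivation over the regular `A`-point `P`. -/
def IsDerivationOver (P : RegularPoint R A) (D : R →ₗ[ℝ] A) : Prop :=
  ∀ f g, D (f * g) = P.1 f * D g + P.1 g * D f

variable {P : RegularPoint R A} {q : JetSpace R A}

theorem residueMap_mk (hP : jetOf P = q) (f : R) :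
    residueMap P hP (Ideal.Quotient.mk q.1 f) = P.1 f :=
  rfl

theorem residueMap_bijective (hP : jetOf P = q) : Function.Bijective (residueMap P hP) := by
  subst hP
  constructor
  · rw [injective_iff_map_eq_zero]
    intro x hx
    obtain ⟨f, rfl⟩ := Ideal.Quotient.mk_surjective x
    exact Ideal.Quotient.eq_zero_iff_mem.mpr hx
  · intro a
    obtain ⟨f, hf⟩ := P.2 a
    exact ⟨Ideal.Quotient.mk _ f, hf⟩

/-- The isomorphism `R ⧸ q ≃ A` induced by a regular `A`-point. -/
def residueEquiv (hP : jetOf P = q) : (R ⧸ q.1) ≃ₐ[ℝ] A :=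
  AlgEquiv.ofBijective (residueMap P hP) (residueMap_bijective hP)

theorem residueMap_smul (hP : jetOf P = q) (f : R) (x : R ⧸ q.1) :
    residueMap P hP (f • x) = P.1 f * residueMap P hP x := by
  obtain ⟨g, rfl⟩ := Ideal.Quotient.mk_surjective x
  change residueMap P hP (Ideal.Quotient.mk q.1 (f * g)) = _
  rw [residueMap_mk, residueMap_mk, map_mul]

/-- A derivation with values in `R ⧸ q`, read in `A`. -/
def residueDerivation (hP : jetOf P = q) (D : Derivation ℝ R (R ⧸ q.1)) : R →ₗ[ℝ] A :=
  (residueMap P hP).toLinearMap ∘ₗ (D : R →ₗ[ℝ] R ⧸ q.1)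

theorem isDerivationOver_residueDerivation (hP : jetOf P = q) (D : Derivation ℝ R (R ⧸ q.1)) :
    IsDerivationOver P (residueDerivation hP D) := fun f g => by
  change residueMap P hP (D (f * g)) = _
  rw [D.leibniz, map_add, residueMap_smul, residueMap_smul]
  rfl

theorem exists_residueDerivation_eq (hP : jetOf P = q) {D : R →ₗ[ℝ] A} (hD : IsDerivationOver P D) :
    ∃ D' : Derivation ℝ R (R ⧸ q.1), ∀ f, residueMap P hP (D' f) = D f := by
  refine ⟨Derivation.mk' ((residueEquiv hP).symm.toLinearMap ∘ₗ D) fun f g => ?_, fun f => ?_⟩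
  · apply (residueMap_bijective hP).1
    have h : ∀ a, residueMap P hP ((residueEquiv hP).symm a) = a := (residueEquiv hP).apply_symm_apply
    rw [map_add, residueMap_smul, residueMap_smul]
    change residueMap P hP ((residueEquiv hP).symm (D (f * g))) =
      P.1 f * residueMap P hP ((residueEquiv hP).symm (D g)) +
        P.1 g * residueMap P hP ((residueEquiv hP).symm (D f))
    rw [h, h, h, hD]
  · exact (residueEquiv hP).apply_symm_apply (D f)

variable (R A) in
/-- The pull-back of smooth functions induces a map of tangent spaces. -/
theorem comp_jetPullback_mem (hP : jetOf P = q) {V : Module.Dual ℝ (smoothPoint R A)}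
    (hV : V ∈ PointTangent (smoothPoint R A) P) :
    V ∘ₗ (jetPullback R A).toLinearMap ∈ PointTangent (smoothJet R A) q := by
  subst hP
  intro F G
  refine (congrArg V (map_mul (jetPullback R A) F G)).trans ?_
  exact hV _ _

/-- The tangent map of `P ↦ ker P`. -/
def jetTangentMap (hP : jetOf P = q) :
    PointTangent (smoothPoint R A) P →ₗ[ℝ] PointTangent (smoothJet R A) q :=
  LinearMap.codRestrict _
    ((Module.Dual.transpose (R := ℝ) (jetPullback R A).toLinearMap) ∘ₗ Submodule.subtype _)
    fun V => comp_jetPullback_mem R A hP V.2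

theorem jetTangentMap_apply (hP : jetOf P = q) (V : PointTangent (smoothPoint R A) P)
    (F : smoothJet R A) : (jetTangentMap hP V).1 F = V.1 (jetPullback R A F) :=
  rfl

end Residue

section Curves

variable {R : Type*} [CommRing R] [Algebra ℝ R] {A : Type*} [NormedCommRing A] [NormedAlgebra ℝ A]
  [FiniteDimensional ℝ A]

variable (R A) in
/-- Every derivation over a regular `A`-point is the velocity of a curve of regular `A`-points. -/
def HasCurves : Prop :=
  ∀ (P : RegularPoint R A) (D : R →ₗ[ℝ] A), IsDerivationOver P D →
    ∃ γ : ℝ → RegularPoint R A, γ 0 = P ∧ ∀ f, HasDerivAt (fun t => (γ t).1 f) (D f) 0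

variable {P : RegularPoint R A} {q : JetSpace R A} {γ : ℝ → RegularPoint R A} {D : R →ₗ[ℝ] A}

theorem differentiableAt_comp_curve (h0 : γ 0 = P)
    (hγ : ∀ f, HasDerivAt (fun t => (γ t).1 f) (D f) 0) (F : smoothPoint R A) :
    DifferentiableAt ℝ (fun t => F.1 (γ t)) 0 := by
  obtain ⟨ι, _, η, f, Φ, hΦ, h⟩ := F.2 P
  have hc : Filter.Tendsto γ (𝓝 0) (𝓝 P) := by
    rw [← h0]
    exact tendsto_eval.mpr fun f => (hγ f).continuousAt
  have h1 : DifferentiableAt ℝ (fun t => Φ fun i => component (η i) (f i) (γ t)) 0 := by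
    refine (hΦ.differentiable (by simp) _).comp (0 : ℝ) (f := fun t i => component (η i) (f i) (γ t))
      (differentiableAt_pi.mpr fun i => ?_)
    exact ((LinearMap.toContinuousLinearMap (η i)).differentiableAt).comp (0 : ℝ)
      (hγ (f i)).differentiableAt
  exact h1.congr_of_eventuallyEq (hc.eventually h)

theorem exists_pointTangent_of_curve (h0 : γ 0 = P)
    (hγ : ∀ f, HasDerivAt (fun t => (γ t).1 f) (D f) 0) :
    ∃ V ∈ PointTangent (smoothPoint R A) P,
      ∀ F : smoothPoint R A, HasDerivAt (fun t => F.1 (γ t)) (V F) 0 := by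
  have hd := differentiableAt_comp_curve h0 hγ
  refine ⟨{ toFun := fun F => deriv (fun t => F.1 (γ t)) 0
            map_add' := fun F G => ((hd F).hasDerivAt.add (hd G).hasDerivAt).deriv
            map_smul' := fun c F => ((hd F).hasDerivAt.const_smul c).deriv }, fun F G => ?_,
    fun F => (hd F).hasDerivAt⟩
  have := ((hd F).hasDerivAt.mul (hd G).hasDerivAt).deriv
  rw [h0] at this
  refine this.trans ?_
  rw [add_comm, mul_comm (deriv _ _)]
  rfl

theorem hasDerivAt_component_curve (hγ : ∀ f, HasDerivAt (fun t => (γ t).1 f) (D f) 0)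
    (η : Module.Dual ℝ A) (f : R) :
    HasDerivAt (fun t => component η f (γ t)) (η (D f)) 0 :=
  (LinearMap.toContinuousLinearMap η).hasFDerivAt.comp_hasDerivAt (0 : ℝ) (hγ f)

/-- A tangent vector at a regular `A`-point is the velocity of every curve that has the right
velocity on the real components. -/
theorem hasDerivAt_comp_curve (h0 : γ 0 = P) (hγ : ∀ f, HasDerivAt (fun t => (γ t).1 f) (D f) 0)
    {V : Module.Dual ℝ (smoothPoint R A)} (hV : V ∈ PointTangent (smoothPoint R A) P)
    (hVD : ∀ f η, V (smoothComponent η f) = η (D f)) (F : smoothPoint R A) :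
    HasDerivAt (fun t => F.1 (γ t)) (V F) 0 := by
  obtain ⟨W, hW, h⟩ := exists_pointTangent_of_curve h0 hγ
  have : V = W := pointTangent_ext hV hW fun η f => by
    rw [hVD]
    exact (hasDerivAt_component_curve hγ η f).unique (h (smoothComponent η f))
  rw [this]
  exact h F

theorem exists_pointTangent (hC : HasCurves R A) (hD : IsDerivationOver P D) :
    ∃ V ∈ PointTangent (smoothPoint R A) P, ∀ f η, V (smoothComponent η f) = η (D f) := by
  obtain ⟨γ, h0, hγ⟩ := hC P D hD
  obtain ⟨V, hV, h⟩ := exists_pointTangent_of_curve h0 hγ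
  exact ⟨V, hV, fun f η => (h (smoothComponent η f)).unique (hasDerivAt_component_curve hγ η f)⟩

/-- The curves are chosen without any linearity; linearity of the lift comes from uniqueness,
tangent vectors being determined by the real components. -/
theorem exists_tangentLift (hC : HasCurves R A) (hP : jetOf P = q) :
    ∃ T : Derivation ℝ R (R ⧸ q.1) →ₗ[ℝ] PointTangent (smoothPoint R A) P,
      ∀ D f η, (T D).1 (smoothComponent η f) = η (residueMap P hP (D f)) := by
  choose V hV h using fun D : Derivation ℝ R (R ⧸ q.1) =>
    exists_pointTangent hC (isDerivationOver_residueDerivation hP D)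
  refine ⟨{ toFun := fun D => ⟨V D, hV D⟩, map_add' := fun D E => ?_, map_smul' := fun c D => ?_ },
    h⟩
  · refine Subtype.ext (pointTangent_ext (hV _) (Submodule.add_mem _ (hV _) (hV _)) fun η f => ?_)
    change V (D + E) _ = V D _ + V E _
    rw [h, h, h, ← map_add]
    exact congrArg η (map_add (residueMap P hP) _ _)
  · refine Subtype.ext (pointTangent_ext (hV _) (Submodule.smul_mem _ _ (hV _)) fun η f => ?_)
    change V (c • D) _ = c • V D _
    rw [h, h, ← map_smul]
    exact congrArg η (map_smul (residueMap P hP) _ _)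

/-- The derivative, along a tangent vector, of a real component of `f` along a local section. -/
theorem pointTangent_component_section (hB : HasBoundedNhds R A) (hP : jetOf P = q)
    {V : PointTangent (smoothPoint R A) P} (hVD : ∀ f η, V.1 (smoothComponent η f) = η (D f))
    {s : JetSpace R A → RegularPoint R A} (hs : IsLocalSection s q) (hsP : s q = P) {f : R}
    (hf : f ∈ q.1) (η : Module.Dual ℝ A) {F : smoothJet R A}
    (hF : ∀ᶠ r in 𝓝 q, F.1 r = component η f (s r)) :
    (jetTangentMap hP V).1 F = η (D f) := by
  subst hP
  obtain ⟨c, F', h1, h2, h3⟩ := exists_smoothJet_component_section hB hs hsP f η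
  have hFF' : ∀ᶠ r in 𝓝 (jetOf P), F.1 r = F'.1 r := by
    filter_upwards [hF, h3] with r h h'
    rw [h, h']
  rw [pointTangent_jet_apply_eq hB (jetTangentMap rfl V).2 hFF', jetTangentMap_apply, h1, map_sum]
  have h0 : ∀ j, (smoothComponent ((Module.finBasis ℝ A).coord j) f).1 P = 0 := fun j => by
    change (Module.finBasis ℝ A).coord j (P.1 f) = 0
    rw [mem_jetOf.mp hf, map_zero]
  conv_rhs => rw [← (Module.finBasis ℝ A).sum_repr (D f), map_sum]
  refine Finset.sum_congr rfl fun j _ => ?_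
  rw [V.2, h0, zero_mul, add_zero, h2, hVD, map_smul, smul_eq_mul, mul_comm]
  rfl

/-- A local section s through P lifts W to the vector g ↦ W(g ∘ s), where g ∘ s is replaced by a
smooth function with the same germ. It projects back to W since s is a section. -/
theorem jetTangentMap_surjective (hB : HasBoundedNhds R A) (hP : jetOf P = q) :
    Function.Surjective (jetTangentMap (R := R) (A := A) hP) := by
  subst hP
  rintro ⟨W, hW⟩
  obtain ⟨s, hs, hsP⟩ := exists_isLocalSection hB P
  choose S hS using hs.2
  have hWeq : ∀ {F G : smoothJet R A}, (∀ᶠ r in 𝓝 (jetOf P), F.1 r = G.1 r) → W F = W G :=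
    fun h => pointTangent_jet_apply_eq hB hW h
  let V : Module.Dual ℝ (smoothPoint R A) :=
    { toFun := fun g => W (S g)
      map_add' := fun g g' => by
        rw [← map_add]
        refine hWeq ?_
        filter_upwards [hS g, hS g', hS (g + g')] with r h1 h2 h3
        rw [h3]
        exact (congrArg₂ (· + ·) h1 h2).symm
      map_smul' := fun c g => by
        rw [← map_smul]
        refine hWeq ?_
        filter_upwards [hS g, hS (c • g)] with r h1 h2
        rw [h2]
        exact (congrArg (c * ·) h1).symm }
  refine ⟨⟨V, fun g g' => ?_⟩, Subtype.ext (LinearMap.ext fun F => ?_)⟩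
  · have h1 := hW (S g) (S g')
    rw [(hS g).self_of_nhds, (hS g').self_of_nhds, hsP] at h1
    rw [← show W (S (g * g')) = V (g * g') from rfl, ← show W (S g) = V g from rfl,
      ← show W (S g') = V g' from rfl, ← h1]
    refine hWeq ?_
    filter_upwards [hS g, hS g', hS (g * g')] with r h1 h2 h3
    rw [h3]
    exact (congrArg₂ (· * ·) h1 h2).symm
  · refine hWeq ?_
    filter_upwards [hS (jetPullback R A F), hs.1] with r h1 h2
    exact h1.trans (congrArg F.1 h2)

/-- The map D is assembled from the values of V on the components in a basis of A. The components of
fg are quadratic in those of f and g, with the structure constants of A as coefficients, so Leibniz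
for V becomes Leibniz for D. -/
theorem exists_derivation_of_pointTangent (hP : jetOf P = q)
    (V : PointTangent (smoothPoint R A) P) :
    ∃ D : Derivation ℝ R (R ⧸ q.1),
      ∀ f η, V.1 (smoothComponent η f) = η (residueMap P hP (D f)) := by
  set u := Module.finBasis ℝ A with hu
  have hadd : ∀ (η : Module.Dual ℝ A) (f g : R),
      smoothComponent η (f + g) = smoothComponent η f + smoothComponent η g := fun η f g =>
    Subtype.ext (funext fun Q => (congrArg η (map_add Q.1 f g)).trans (map_add η _ _))
  have hsmul : ∀ (η : Module.Dual ℝ A) (c : ℝ) (f : R),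
      smoothComponent η (c • f) = c • smoothComponent η f := fun η c f =>
    Subtype.ext (funext fun Q => (congrArg η (map_smul Q.1 c f)).trans (map_smul η _ _))
  let D₀ : R →ₗ[ℝ] A :=
    { toFun := fun f => ∑ j, V.1 (smoothComponent (u.coord j) f) • u j
      map_add' := fun f g => by
        simp only [hadd, map_add, add_smul, Finset.sum_add_distrib]
      map_smul' := fun c f => by
        simp only [hsmul, map_smul, smul_eq_mul, mul_smul, Finset.smul_sum, RingHom.id_apply] }
  have hD₀ : ∀ f η, V.1 (smoothComponent η f) = η (D₀ f) := fun f η => by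
    have e : smoothComponent (R := R) η f = ∑ j, η (u j) • smoothComponent (u.coord j) f := by
      refine Subtype.ext (funext fun Q => ?_)
      rw [AddSubmonoidClass.coe_finsetSum, Finset.sum_apply]
      change η (Q.1 f) = _
      conv_lhs => rw [← u.sum_repr (Q.1 f), map_sum]
      refine Finset.sum_congr rfl fun j _ => ?_
      rw [map_smul, smul_eq_mul, mul_comm]
      rfl
    rw [e, map_sum]
    change _ = η (∑ j, V.1 (smoothComponent (u.coord j) f) • u j)
    rw [map_sum]
    refine Finset.sum_congr rfl fun j _ => ?_
    rw [map_smul, map_smul, smul_eq_mul, smul_eq_mul, mul_comm]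
  have hder : IsDerivationOver P D₀ := fun f g => by
    have hext : ∀ a b : A, (∀ η : Module.Dual ℝ A, η a = η b) → a = b := fun a b h =>
      u.ext_elem fun j => h (u.coord j)
    refine hext _ _ fun η => ?_
    have e : smoothComponent (R := R) η (f * g) = ∑ j, ∑ k, η (u j * u k) •
        (smoothComponent (u.coord j) f * smoothComponent (u.coord k) g) := by
      refine Subtype.ext (funext fun Q => ?_)
      simp only [AddSubmonoidClass.coe_finsetSum, Finset.sum_apply]
      change η (Q.1 (f * g)) = _
      rw [map_mul]
      conv_lhs => rw [← u.sum_repr (Q.1 f), ← u.sum_repr (Q.1 g), Finset.sum_mul_sum, map_sum]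
      refine Finset.sum_congr rfl fun j _ => ?_
      rw [map_sum]
      refine Finset.sum_congr rfl fun k _ => ?_
      rw [smul_mul_smul_comm, map_smul, smul_eq_mul, mul_comm]
      rfl
    rw [← hD₀, e, map_sum]
    have e2 : ∀ j k, V.1 (η (u j * u k) •
        (smoothComponent (u.coord j) f * smoothComponent (u.coord k) g)) =
        η ((u.coord j (P.1 f) • u j) * (u.coord k (D₀ g) • u k)) +
        η ((u.coord k (P.1 g) • u k) * (u.coord j (D₀ f) • u j)) := fun j k => by
      rw [map_smul, V.2, hD₀, hD₀, smul_mul_smul_comm, smul_mul_smul_comm, map_smul, map_smul,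
        mul_comm (u k) (u j)]
      simp only [smul_eq_mul]
      change η (u j * u k) * (u.coord j (P.1 f) * u.coord k (D₀ g) +
        u.coord k (P.1 g) * u.coord j (D₀ f)) = _
      ring
    simp only [map_sum, e2, Finset.sum_add_distrib, map_add]
    have s1 : ∀ a b : A, ∑ j, ∑ k, η ((u.coord j a • u j) * (u.coord k b • u k)) = η (a * b) :=
      fun a b => by
        conv_rhs => rw [← u.sum_repr a, ← u.sum_repr b, Finset.sum_mul_sum]
        simp only [map_sum]
        rfl
    rw [s1]
    congr 1
    rw [Finset.sum_comm]
    exact s1 _ _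
  obtain ⟨D, hD⟩ := exists_residueDerivation_eq hP hder
  exact ⟨D, fun f η => by rw [hD, hD₀]⟩

/-- A tangent vector given by a derivation of `R ⧸ q` is vertical. -/
theorem jetTangentMap_eq_zero_iff (hB : HasBoundedNhds R A) (hP : jetOf P = q)
    {V : PointTangent (smoothPoint R A) P} {D : Derivation ℝ R (R ⧸ q.1)}
    (hVD : ∀ f η, V.1 (smoothComponent η f) = η (residueMap P hP (D f))) :
    jetTangentMap hP V = 0 ↔ D ∈ inducedDerivations q.1 := by
  rw [mem_inducedDerivations_iff]
  constructor
  · intro h f hf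
    apply (residueMap_bijective hP).1
    rw [map_zero]
    refine (Module.finBasis ℝ A).ext_elem fun j => ?_
    subst hP
    obtain ⟨s, hs, hsP⟩ := exists_isLocalSection hB P
    -- The test function f_η ∘ s with f in q: its derivative along the projected vector is η(Df).
    obtain ⟨c, F, h1, h2, h3⟩ :=
      exists_smoothJet_component_section hB hs hsP f ((Module.finBasis ℝ A).coord j)
    have := pointTangent_component_section hB rfl
      (D := residueDerivation rfl D) hVD hs hsP hf _ h3
    rw [h] at this
    rw [map_zero]
    exact this.symm
  · intro h
    have : CompleteSpace A := FiniteDimensional.complete ℝ A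
    obtain ⟨lam, hlam⟩ := exists_linearSection P
    set D' := residueDerivation hP D with hD'
    have hker : ∀ f, P.1 f = 0 → D' f = 0 := fun f hf => by
      have : f ∈ q.1 := by
        subst hP
        exact hf
      exact (congrArg (residueMap P hP) (h f this)).trans (map_zero _)
    let δ : A →L[ℝ] A := LinearMap.toContinuousLinearMap (D' ∘ₗ lam)
    have hδ : ∀ f, δ (P.1 f) = D' f := fun f => by
      have := hker (lam (P.1 f) - f) (by rw [map_sub, hlam, sub_self])
      rw [map_sub, sub_eq_zero] at this
      exact this
    have hδm : ∀ t : ℝ, t • δ ∈ derivationSubspace A := fun t => Submodule.smul_mem _ t fun a b => by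
      obtain ⟨f, rfl⟩ := P.2 a
      obtain ⟨g, rfl⟩ := P.2 b
      rw [← map_mul, hδ, hδ, hδ, isDerivationOver_residueDerivation hP D]
      ring
    let _ : NormedAlgebra ℚ (A →L[ℝ] A) := NormedAlgebra.restrictScalars ℚ ℝ (A →L[ℝ] A)
    -- The automorphisms exp(tδ) move P inside its fibre with velocity `D'`, and functions pulled
    -- back from the jets are constant along this curve.
    choose g hg using fun t : ℝ =>
      (isMulMap_exp (hδm t)).exists_algEquiv (NormedSpace.isUnit_exp (t • δ))
    have h0 : actPoint (g 0) P = P := Subtype.ext (AlgHom.ext fun f => by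
      rw [actPoint_apply, hg, exp_zero_smul]
      rfl)
    have hγ : ∀ f, HasDerivAt (fun t => (actPoint (g t) P).1 f) (D' f) 0 := fun f => by
      have := hasDerivAt_exp_smul_apply δ (P.1 f) 0
      rw [exp_zero_smul] at this
      simp only [actPoint_apply, hg, ← hδ]
      exact this
    refine Subtype.ext (LinearMap.ext fun F => ?_)
    have h1 := hasDerivAt_comp_curve h0 hγ V.2 hVD (jetPullback R A F)
    have h2 : (fun t => (jetPullback R A F).1 (actPoint (g t) P)) =
        fun _ => F.1 (jetOf P) := funext fun t => congrArg F.1 (jetOf_actPoint (g t) P)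
    rw [h2] at h1
    exact h1.unique (hasDerivAt_const _ _)

/-- The vectors given by the same derivation at different regular points over a jet project to the
same tangent vector of the space of jets. -/
theorem jetTangentMap_eq_of_jetOf_eq (hC : HasCurves R A) {P' : RegularPoint R A} (hP : jetOf P = q)
    (hP' : jetOf P' = q) {D : Derivation ℝ R (R ⧸ q.1)} {V : PointTangent (smoothPoint R A) P}
    (hVD : ∀ f η, V.1 (smoothComponent η f) = η (residueMap P hP (D f)))
    {V' : PointTangent (smoothPoint R A) P'}
    (hVD' : ∀ f η, V'.1 (smoothComponent η f) = η (residueMap P' hP' (D f))) :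
    jetTangentMap hP V = jetTangentMap hP' V' := by
  obtain ⟨γ, h0, hγ⟩ := hC P _ (isDerivationOver_residueDerivation hP D)
  obtain ⟨g, rfl⟩ := exists_actPoint_eq (hP.trans hP'.symm)
  have hres : ∀ x, residueMap (actPoint g P) hP' x = g (residueMap P hP x) := fun x => by
    obtain ⟨f, rfl⟩ := Ideal.Quotient.mk_surjective x
    rfl
  have hγ' : ∀ f, HasDerivAt (fun t => (actPoint g (γ t)).1 f)
      (residueDerivation hP' D f) 0 := fun f => by
    have := (autMap g).hasFDerivAt.comp_hasDerivAt (0 : ℝ) (hγ f)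
    rw [show residueDerivation hP' D f = g (residueMap P hP (D f)) from hres _]
    exact this
  refine Subtype.ext (LinearMap.ext fun F => ?_)
  have h1 := hasDerivAt_comp_curve h0 hγ V.2 hVD (jetPullback R A F)
  have h2 := hasDerivAt_comp_curve (γ := fun t => actPoint g (γ t)) (by rw [h0]) hγ' V'.2 hVD'
    (jetPullback R A F)
  -- The curves γ and gγ have the same projection to the space of jets, so both derivatives belong
  -- to the same function of t.
  refine h1.unique ?_
  have h3 : (fun t => (jetPullback R A F).1 (actPoint g (γ t))) =
      fun t => (jetPullback R A F).1 (γ t) :=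
    funext fun t => congrArg F.1 (jetOf_actPoint g (γ t))
  rw [h3] at h2
  exact h2

/-- One point over q suffices to construct κ; the defining property at the other points of the fibre
is the independence statement `jetTangentMap_eq_of_jetOf_eq`. -/
theorem exists_isCanonicalIso (hB : HasBoundedNhds R A) (hC : HasCurves R A) (q : JetSpace R A) :
    ∃ κ : TangentModule q.1 ≃ₗ[ℝ] PointTangent (smoothJet R A) q, IsCanonicalIso q κ := by
  obtain ⟨P, hP⟩ := jetOf_surjective q
  obtain ⟨T, hT⟩ := exists_tangentLift hC hP
  let k : Derivation ℝ R (R ⧸ q.1) →ₗ[ℝ] PointTangent (smoothJet R A) q := jetTangentMap hP ∘ₗ T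
  have hker : ∀ D, k D = 0 ↔ D ∈ inducedDerivations q.1 := fun D =>
    jetTangentMap_eq_zero_iff hB hP (hT D)
  have hsurj : Function.Surjective k := fun W => by
    obtain ⟨V, rfl⟩ := jetTangentMap_surjective hB hP W
    obtain ⟨D, hD⟩ := exists_derivation_of_pointTangent hP V
    refine ⟨D, congrArg (jetTangentMap hP) (Subtype.ext (pointTangent_ext (T D).2 V.2 ?_))⟩
    intro η f
    rw [hT, hD]
  obtain ⟨κ, hκ⟩ := exists_quotientEquiv (R := R) (M := Derivation ℝ R (R ⧸ q.1))
    (N := PointTangent (smoothJet R A) q) (inducedDerivations q.1) k hker hsurj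
  refine ⟨κ, fun P' hP' D => ?_⟩
  obtain ⟨V', hV', hVD'⟩ := exists_pointTangent hC (isDerivationOver_residueDerivation hP' D)
  refine ⟨V', hV', hVD', fun F => ?_⟩
  rw [show κ (tangentClass q.1 D) = k D from hκ D]
  exact congrArg (fun W : PointTangent (smoothJet R A) q => W.1 F)
    (jetTangentMap_eq_of_jetOf_eq hC hP hP' (hT D) (V' := ⟨V', hV'⟩) hVD')

end Curves

/-! ## The contact system and the prolongation -/

section Prolongation

variable {R : Type*} [CommRing R] [Algebra ℝ R] {A : Type*} [NormedCommRing A] [NormedAlgebra ℝ A]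
  {p : Ideal R} {q : JetSpace R A} {P : RegularPoint R A}

theorem tangentClass_surjective (p : Ideal R) : Function.Surjective (tangentClass p) :=
  (inducedDerivations p).mkQ_surjective

theorem toJetTangent_tangentClass (h : p ≤ q.1) (hs : IsDerStable h)
    (κ : TangentModule q.1 ≃ₗ[ℝ] PointTangent (smoothJet R A) q) (D : Derivation ℝ R (R ⧸ p)) :
    toJetTangent h hs κ (tangentClass p D) =
      κ (tangentClass q.1 ((quotientProj h).compDer D)) :=
  rfl

theorem pairDifferential_tangentClass {p' : Ideal R} (h : p ≤ p') (f : p)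
    (D : Derivation ℝ R (R ⧸ p)) :
    pairDifferential h f (tangentClass p D) = (quotientProj h).compDer D f :=
  rfl

theorem toJetTangent_surjective (h : p ≤ q.1) (hs : IsDerStable h)
    (κ : TangentModule q.1 ≃ₗ[ℝ] PointTangent (smoothJet R A) q)
    (hlift : ∀ D : Derivation ℝ R (R ⧸ q.1), ∃ D' : Derivation ℝ R (R ⧸ p),
      (quotientProj h).compDer D' = D) : Function.Surjective (toJetTangent h hs κ) := by
  intro V
  obtain ⟨t, rfl⟩ := κ.surjective V
  obtain ⟨D, rfl⟩ := tangentClass_surjective q.1 t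
  obtain ⟨D', rfl⟩ := hlift D
  exact ⟨tangentClass p D', rfl⟩

/-- A tangent vector at `P` induces on the ideal generated by the real components of the elements
of `p` a form that belongs to the real components of the contact system. -/
theorem exists_realComponent_of_mem_span (h : p ≤ q.1) (hP : jetOf P = q)
    {V : Derivation ℝ R (R ⧸ p) → PointTangent (smoothPoint R A) P}
    (hV : ∀ D f η, (V D).1 (smoothComponent η f) =
      η (residueMap P hP ((quotientProj h).compDer D f)))
    {G : smoothPoint R A}
    (hG : G ∈ Ideal.span {g : smoothPoint R A | ∃ f ∈ p, ∃ η : Module.Dual ℝ A,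
      g = smoothComponent η f}) :
    -- Vanishing at P is carried through the induction: in the derivative of aG it leaves only a(P)
    -- times that of G.
    G.1 P = 0 ∧ ∃ c ∈ realComponents (contactSystemPair h), ∀ D,
      (V D).1 G = c (tangentClass p D) := by
  induction hG using Submodule.span_induction with
  | mem G hG =>
    obtain ⟨f, hf, η, rfl⟩ := hG
    constructor
    · subst hP
      change η (P.1 f) = 0
      rw [mem_jetOf.mp (h hf), map_zero]
    · refine ⟨_, Submodule.subset_span ⟨pairDifferential h ⟨f, hf⟩, ⟨_, rfl⟩,
        η ∘ₗ (residueMap P hP).toLinearMap, rfl⟩, fun D => ?_⟩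
      rw [hV]
      rfl
  | zero => exact ⟨rfl, 0, Submodule.zero_mem _, fun D => map_zero _⟩
  | add G G' _ _ hG hG' =>
    obtain ⟨h0, c, hc, hD⟩ := hG
    obtain ⟨h0', c', hc', hD'⟩ := hG'
    refine ⟨?_, c + c', Submodule.add_mem _ hc hc', fun D => ?_⟩
    · change G.1 P + G'.1 P = 0
      rw [h0, h0', add_zero]
    · rw [map_add, hD, hD']
      rfl
  | smul a G _ hG =>
    obtain ⟨h0, c, hc, hD⟩ := hG
    refine ⟨?_, a.1 P • c, Submodule.smul_mem _ _ hc, fun D => ?_⟩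
    · change a.1 P * G.1 P = 0
      rw [h0, mul_zero]
    · rw [smul_eq_mul, (V D).2, h0, zero_mul, add_zero, hD]
      rfl

variable [FiniteDimensional ℝ A]

/-- The differential of a real component of `f` along a local section. -/
theorem canonicalIso_component_section (hB : HasBoundedNhds R A)
    {κ : TangentModule q.1 ≃ₗ[ℝ] PointTangent (smoothJet R A) q} (hκ : IsCanonicalIso q κ)
    (hP : jetOf P = q) {s : JetSpace R A → RegularPoint R A} (hs : IsLocalSection s q)
    (hsP : s q = P) {f : R} (hf : f ∈ q.1) (η : Module.Dual ℝ A) {F : smoothJet R A}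
    (hF : ∀ᶠ r in 𝓝 q, F.1 r = component η f (s r)) (D : Derivation ℝ R (R ⧸ q.1)) :
    (κ (tangentClass q.1 D)).1 F = η (residueMap P hP (D f)) := by
  obtain ⟨V, hV, hVD, h⟩ := hκ P hP D
  rw [h F]
  exact pointTangent_component_section hB hP (V := ⟨V, hV⟩)
    (D := residueDerivation hP D) hVD hs hsP hf η hF

theorem toJetTangent_component_section (hB : HasBoundedNhds R A)
    {κ : TangentModule q.1 ≃ₗ[ℝ] PointTangent (smoothJet R A) q} (hκ : IsCanonicalIso q κ)
    (h : p ≤ q.1) (hst : IsDerStable h) (hP : jetOf P = q)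
    {s : JetSpace R A → RegularPoint R A} (hs : IsLocalSection s q) (hsP : s q = P) (f : p)
    (η : Module.Dual ℝ A) {F : smoothJet R A}
    (hF : ∀ᶠ r in 𝓝 q, F.1 r = component η f.1 (s r)) (t : TangentModule p) :
    pointDifferential (smoothJet R A) q F (toJetTangent h hst κ t) =
      η (residueMap P hP (pairDifferential h f t)) := by
  obtain ⟨D, rfl⟩ := tangentClass_surjective p t
  rw [toJetTangent_tangentClass, pairDifferential_tangentClass]
  exact canonicalIso_component_section hB hκ hP hs hsP (h f.2) η hF _

theorem exists_mem_prolongation_component_section (hB : HasBoundedNhds R A) (hP : jetOf P = q)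
    {s : JetSpace R A → RegularPoint R A} (hs : IsLocalSection s q) (hsP : s q = P) {f : R}
    (hf : f ∈ p) (η : Module.Dual ℝ A) :
    ∃ F ∈ prolongation A p, ∀ᶠ r in 𝓝 q, F.1 r = component η f (s r) := by
  subst hP
  obtain ⟨c, F, h1, -, h3⟩ := exists_smoothJet_component_section hB hs hsP f η
  refine ⟨F, ?_, h3⟩
  rw [prolongation, Ideal.mem_comap, h1]
  exact Ideal.sum_mem _ fun j _ =>
    Ideal.mul_mem_left _ _ (Ideal.subset_span ⟨f, hf, _, rfl⟩)

/-- From left to right, differentiate the pull-back at P inside the ideal of components. From right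
to left, a component of d'f is the differential of a component of f along a section, with the linear
form transported to A by the residue isomorphism. -/
theorem map_prolongationDifferentials (hB : HasBoundedNhds R A) (h : p ≤ q.1) (hs : IsDerStable h)
    {κ : TangentModule q.1 ≃ₗ[ℝ] PointTangent (smoothJet R A) q} (hκ : IsCanonicalIso q κ) :
    (prolongationDifferentials p q).map (toJetTangent h hs κ).dualMap =
      realComponents (contactSystemPair h) := by
  obtain ⟨P, hP⟩ := jetOf_surjective q
  apply le_antisymm
  · rintro _ ⟨_, ⟨F, hF, rfl⟩, rfl⟩
    choose V hVt hV hVF using fun D : Derivation ℝ R (R ⧸ p) =>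
      hκ P hP ((quotientProj h).compDer D)
    obtain ⟨-, c, hc, hcD⟩ := exists_realComponent_of_mem_span h hP (V := fun D => ⟨V D, hVt D⟩)
      hV (Ideal.mem_comap.mp hF)
    have : (toJetTangent h hs κ).dualMap (pointDifferential (smoothJet R A) q F) = c := by
      refine LinearMap.ext fun t => ?_
      obtain ⟨D, rfl⟩ := tangentClass_surjective p t
      rw [← hcD]
      exact hVF D F
    rw [this]
    exact hc
  · refine Submodule.span_le.mpr ?_
    rintro _ ⟨_, ⟨f, rfl⟩, η, rfl⟩
    have hsec : ∃ s, IsLocalSection s q ∧ s q = P := by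
      subst hP
      exact exists_isLocalSection hB P
    obtain ⟨s, hsl, hsP⟩ := hsec
    obtain ⟨F, hF, hFs⟩ := exists_mem_prolongation_component_section hB hP hsl hsP f.2
      (η ∘ₗ (residueEquiv hP).symm.toLinearMap)
    refine ⟨_, ⟨F, hF, rfl⟩, LinearMap.ext fun t => ?_⟩
    have := toJetTangent_component_section hB hκ h hs hP hsl hsP f _ hFs t
    refine this.trans ?_
    exact congrArg η ((residueEquiv hP).symm_apply_apply _)

end Prolongation

/-! ### Characters of the algebra of smooth functions -/

section Milnor

variable {n : ℕ} {M : Type*} [TopologicalSpace M] [ChartedSpace (EuclideanSpace ℝ (Fin n)) M]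

theorem smoothRing_sum_apply {ι : Type*} (s : Finset ι) (f : ι → SmoothRing n M) (x : M) :
    (∑ i ∈ s, f i) x = ∑ i ∈ s, f i x :=
  map_sum (ContMDiffMap.evalRingHom x) f s

theorem smoothRing_isUnit_of_ne_zero {f : SmoothRing n M} (h : ∀ x, f x ≠ 0) : IsUnit f := by
  refine IsUnit.of_mul_eq_one (⟨fun x => (f x)⁻¹, f.contMDiff.inv₀ h⟩ : SmoothRing n M) ?_
  ext x
  exact mul_inv_cancel₀ (h x)

variable [T2Space M] [SecondCountableTopology M] [IsManifold (𝓡 n) ∞ M]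

variable (n M) in
/-- A smooth function with compact sublevel sets. -/
theorem exists_smooth_exhaustion :
    ∃ g : SmoothRing n M, ∀ c : ℝ, ∃ K : Set M, IsCompact K ∧ ∀ x, g x ≤ c → x ∈ K := by
  have : LocallyCompactSpace M := Manifold.locallyCompact_of_finiteDimensional (𝓡 n)
  let K : CompactExhaustion M := default
  obtain ⟨g, hg⟩ := exists_contMDiffMap_forall_mem_convex_of_local_const (𝓡 n) (n := ⊤)
    -- Near x the exhaustion index exceeds that of x by at most one, so a constant is a local
    -- solution of the convex constraint.
    (t := fun x : M => Set.Ici (K.find x : ℝ)) (fun x => convex_Ici _) (fun x => by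
      refine ⟨(K.find x : ℝ) + 1, ?_⟩
      filter_upwards [isOpen_interior.mem_nhds (K.subset_interior_succ _ (K.mem_find x))] with y hy
      have := K.mem_iff_find_le.mp (interior_subset hy)
      rw [Set.mem_Ici]
      exact_mod_cast this)
  refine ⟨g, fun c => ⟨K ⌈c⌉₊, K.isCompact _, fun x hx => ?_⟩⟩
  have h1 : (K.find x : ℝ) ≤ ⌈c⌉₊ := ((hg x).trans hx).trans (Nat.le_ceil c)
  exact K.mem_iff_find_le.mpr (by exact_mod_cast h1)

/-- The characters of the algebra of smooth functions are the evaluations. -/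
theorem exists_eq_eval (ρ : SmoothRing n M →ₐ[ℝ] ℝ) : ∃ x : M, ∀ f, ρ f = f x := by
  by_contra! hx
  choose f hf using hx
  obtain ⟨g, hg⟩ := exists_smooth_exhaustion n M
  obtain ⟨K, hK, hgK⟩ := hg (ρ g)
  obtain ⟨t, -, ht⟩ := hK.elim_nhds_subcover (fun x => {y : M | f x y ≠ ρ (f x)}) fun x _ =>
    (isOpen_ne_fun (f x).contMDiff.continuous continuous_const).mem_nhds (hf x).symm
  -- An element of the kernel of ρ without zeros: g = ρ(g) only inside `K`, where some term of the
  -- finite sum is positive. It would then be a unit.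
  let G : SmoothRing n M := (g - algebraMap ℝ (SmoothRing n M) (ρ g)) ^ 2 +
    ∑ x ∈ t, (f x - algebraMap ℝ (SmoothRing n M) (ρ (f x))) ^ 2
  have hρ : ρ G = 0 := by
    simp [G]
  have hG : ∀ y, G y ≠ 0 := fun y => by
    have hy : G y = (g y - ρ g) ^ 2 + ∑ x ∈ t, (f x y - ρ (f x)) ^ 2 := by
      have := smoothRing_sum_apply t
        (fun x => (f x - algebraMap ℝ (SmoothRing n M) (ρ (f x))) ^ 2) y
      exact congrArg (fun z => (g y - ρ g) ^ 2 + z) this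
    have hs : 0 ≤ ∑ x ∈ t, (f x y - ρ (f x)) ^ 2 := Finset.sum_nonneg fun x _ => sq_nonneg _
    rw [hy]
    by_cases h : g y = ρ g
    · obtain ⟨x, hxt, hxy⟩ := Set.mem_iUnion₂.mp (ht (hgK y h.le))
      have h1 : 0 < (f x y - ρ (f x)) ^ 2 := sq_pos_of_ne_zero (sub_ne_zero.mpr hxy)
      have h2 := Finset.single_le_sum (f := fun x => (f x y - ρ (f x)) ^ 2)
        (fun x _ => sq_nonneg _) hxt
      have := sq_nonneg (g y - ρ g)
      linarith
    · have : 0 < (g y - ρ g) ^ 2 := sq_pos_of_ne_zero (sub_ne_zero.mpr h)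
      linarith
  have := (smoothRing_isUnit_of_ne_zero hG).map ρ
  rw [hρ] at this
  exact not_isUnit_zero this

end Milnor

/-! ### Local coordinates given by global functions -/

section LocalCoord

variable {n : ℕ} {M : Type*} [TopologicalSpace M] [ChartedSpace (EuclideanSpace ℝ (Fin n)) M]

/-- The map to a Euclidean space whose components are given smooth functions. -/
def tupleMap (c : Fin n → SmoothRing n M) (y : M) : EuclideanSpace ℝ (Fin n) :=
  WithLp.toLp 2 fun i => c i y

theorem contMDiff_tupleMap (c : Fin n → SmoothRing n M) :
    ContMDiff (𝓡 n) (𝓡 n) ∞ (tupleMap c) := by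
  have h : ContMDiff (𝓡 n) 𝓘(ℝ, Fin n → ℝ) ∞ fun y i => c i y :=
    contMDiff_pi_space.mpr fun i => (c i).contMDiff
  have h2 : ContDiff ℝ ∞ (WithLp.toLp 2 : (Fin n → ℝ) → EuclideanSpace ℝ (Fin n)) :=
    (PiLp.continuousLinearEquiv 2 ℝ fun _ : Fin n => ℝ).symm.contDiff
  exact h2.contMDiff.comp h

theorem continuous_tupleMap (c : Fin n → SmoothRing n M) : Continuous (tupleMap c) :=
  (contMDiff_tupleMap c).continuous

/-- Composition with `tupleMap`. -/
def tuplePullback (c : Fin n → SmoothRing n M) :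
    SmoothRing n (EuclideanSpace ℝ (Fin n)) →ₐ[ℝ] SmoothRing n M where
  toFun f := f.comp ⟨tupleMap c, contMDiff_tupleMap c⟩
  map_one' := rfl
  map_mul' _ _ := rfl
  map_zero' := rfl
  map_add' _ _ := rfl
  commutes' _ := rfl

theorem tuplePullback_coordFun (c : Fin n → SmoothRing n M) (i : Fin n) :
    tuplePullback c (coordFun i) = c i :=
  rfl

variable (n M) in
/-- Smooth functions on `M` which are coordinates on an open set, with an extension of the smooth
functions in these coordinates. -/
structure LocalCoord where
  /-- the open set -/
  dom : Set M
  isOpen_dom : IsOpen dom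
  /-- the coordinates -/
  coord : Fin n → SmoothRing n M
  /-- the extension of functions -/
  ext : SmoothRing n M →ₗ[ℝ] SmoothRing n (EuclideanSpace ℝ (Fin n))
  ext_apply : ∀ f, ∀ y ∈ dom, ext f (tupleMap coord y) = f y
  isOpen_image : ∀ V ⊆ dom, IsOpen V → IsOpen (tupleMap coord '' V)

variable [T2Space M] [IsManifold (𝓡 n) ∞ M]

theorem exists_smooth_bump {x : M} {U : Set M} (hU : U ∈ 𝓝 x) :
    ∃ ψ : SmoothRing n M, (∀ᶠ y in 𝓝 x, ψ y = 1) ∧ tsupport ψ ⊆ U := by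
  obtain ⟨f, -, hf⟩ := (SmoothBumpFunction.nhds_basis_tsupport (I := 𝓡 n) x).mem_iff.mp hU
  exact ⟨⟨f, f.contMDiff⟩, f.eventuallyEq_one, hf⟩

/-- Bump functions on the source and on the target make the coordinates and the functions read in
the chart global; the domain is cut down to where both bumps equal 1. -/
theorem exists_localCoord {φ : OpenPartialHomeomorph M (EuclideanSpace ℝ (Fin n))}
    (hφ : φ ∈ IsManifold.maximalAtlas (𝓡 n) ∞ M) {x : M} (hx : x ∈ φ.source) :
    ∃ L : LocalCoord n M, x ∈ L.dom ∧ L.dom ⊆ φ.source ∧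
      ∀ y ∈ L.dom, tupleMap L.coord y = φ y := by
  obtain ⟨ψ, hψ1, hψ⟩ := exists_smooth_bump (n := n) (φ.open_source.mem_nhds hx)
  obtain ⟨χ, hχ1, hχ⟩ := exists_smooth_bump (n := n) (φ.open_target.mem_nhds (φ.map_source hx))
  obtain ⟨V, hV1, hVo, hxV⟩ := eventually_nhds_iff.mp hψ1
  obtain ⟨W, hW1, hWo, hxW⟩ := eventually_nhds_iff.mp hχ1
  have hcoord : ∀ i, ContMDiff (𝓡 n) 𝓘(ℝ, ℝ) ∞ fun y => ψ y • φ y i := fun i =>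
    contMDiff_of_tsupport fun y hy => by
      have hy' := hψ (tsupport_smul_subset_left ψ (fun y => φ y i) hy)
      have h1 : ContMDiffAt (𝓡 n) (𝓡 n) ∞ φ y := contMDiffAt_of_mem_maximalAtlas hφ hy'
      have h2 : ContDiff ℝ ∞ fun z : EuclideanSpace ℝ (Fin n) => z i := by fun_prop
      exact ψ.contMDiff.contMDiffAt.smul (h2.contMDiff.contMDiffAt.comp y h1)
  have hext : ∀ f : SmoothRing n M, ContMDiff (𝓡 n) 𝓘(ℝ, ℝ) ∞ fun z => χ z • f (φ.symm z) :=
    fun f => contMDiff_of_tsupport fun z hz => by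
      have hz' := hχ (tsupport_smul_subset_left χ (fun z => f (φ.symm z)) hz)
      have h1 : ContMDiffAt (𝓡 n) (𝓡 n) ∞ φ.symm z :=
        contMDiffAt_symm_of_mem_maximalAtlas hφ hz'
      exact χ.contMDiff.contMDiffAt.smul (f.contMDiff.contMDiffAt.comp z h1)
  have hO : IsOpen (V ∩ (φ.source ∩ φ ⁻¹' W)) := hVo.inter (φ.isOpen_inter_preimage hWo)
  have hmap : ∀ y ∈ V ∩ (φ.source ∩ φ ⁻¹' W),
      tupleMap (fun i => (⟨fun y => ψ y • φ y i, hcoord i⟩ : SmoothRing n M)) y = φ y := by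
    intro y hy
    ext i
    change ψ y • φ y i = φ y i
    rw [hV1 y hy.1, one_smul]
  refine ⟨⟨V ∩ (φ.source ∩ φ ⁻¹' W), hO, fun i => ⟨fun y => ψ y • φ y i, hcoord i⟩,
    { toFun := fun f => ⟨fun z => χ z • f (φ.symm z), hext f⟩
      map_add' := fun f g => ?_
      map_smul' := fun c f => ?_ }, fun f y hy => ?_, fun U hU hUo => ?_⟩, ⟨hxV, hx, hxW⟩,
    fun y hy => hy.2.1, hmap⟩
  · ext z
    exact smul_add (χ z) (f (φ.symm z)) (g (φ.symm z))
  · ext z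
    exact smul_comm (χ z) c (f (φ.symm z))
  · rw [hmap y hy]
    change χ (φ y) • f (φ.symm (φ y)) = f y
    rw [hW1 _ hy.2.2, one_smul, φ.left_inv hy.2.1]
  · rw [Set.image_congr fun y hy => hmap y (hU hy)]
    exact φ.isOpen_image_of_subset_source hUo fun y hy => (hU hy).2.1

end LocalCoord

/-! ### Reduction of morphisms and derivations to Euclidean space -/

section LocalCoordAlgebra

variable {n : ℕ} {M : Type*} [TopologicalSpace M] [ChartedSpace (EuclideanSpace ℝ (Fin n)) M]

namespace LocalCoord

variable (L : LocalCoord n M)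

theorem mul_tuplePullback_eq {ψ : SmoothRing n M} (hψ : ∀ y, ψ y ≠ 0 → y ∈ L.dom)
    {f g : SmoothRing n (EuclideanSpace ℝ (Fin n))}
    (h : ∀ y ∈ L.dom, f (tupleMap L.coord y) = g (tupleMap L.coord y)) :
    ψ * tuplePullback L.coord f = ψ * tuplePullback L.coord g := by
  ext y
  change ψ y * f (tupleMap L.coord y) = ψ y * g (tupleMap L.coord y)
  by_cases hy : ψ y = 0
  · rw [hy, zero_mul, zero_mul]
  · rw [h y (hψ y hy)]

theorem mul_sub_tuplePullback_ext {ψ : SmoothRing n M} (hψ : ∀ y, ψ y ≠ 0 → y ∈ L.dom)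
    (f : SmoothRing n M) : ψ * (f - tuplePullback L.coord (L.ext f)) = 0 := by
  ext y
  change ψ y * (f y - L.ext f (tupleMap L.coord y)) = 0
  by_cases hy : ψ y = 0
  · rw [hy, zero_mul]
  · rw [L.ext_apply f y (hψ y hy), sub_self, mul_zero]

variable {A : Type*} [CommRing A] [Algebra ℝ A] [IsWeilAlgebra A]

theorem apply_tuplePullback_ext {ψ : SmoothRing n M} (hψ : ∀ y, ψ y ≠ 0 → y ∈ L.dom)
    (Q : SmoothRing n M →ₐ[ℝ] A) (hQ : weilAug A (Q ψ) ≠ 0) (f : SmoothRing n M) :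
    Q (tuplePullback L.coord (L.ext f)) = Q f := by
  have := map_eq_zero_of_mul_eq_zero Q hQ (L.mul_sub_tuplePullback_ext hψ f)
  rw [map_sub, sub_eq_zero] at this
  exact this.symm

theorem derivation_apply_tuplePullback_ext {ψ : SmoothRing n M} (hψ : ∀ y, ψ y ≠ 0 → y ∈ L.dom)
    (Q : SmoothRing n M →ₐ[ℝ] A) (hQ : weilAug A (Q ψ) ≠ 0) {D : SmoothRing n M →ₗ[ℝ] A}
    (hD : ∀ f g, D (f * g) = Q f * D g + Q g * D f) (f : SmoothRing n M) :
    D (tuplePullback L.coord (L.ext f)) = D f := by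
  have := derivation_eq_zero_of_mul_eq_zero Q hD hQ (L.mul_sub_tuplePullback_ext hψ f)
  rw [map_sub, sub_eq_zero] at this
  exact this.symm

/-- A derivation over a morphism to a Weil algebra is determined by its values at coordinates. -/
theorem derivation_eq_zero {ψ : SmoothRing n M} (hψ : ∀ y, ψ y ≠ 0 → y ∈ L.dom)
    (Q : SmoothRing n M →ₐ[ℝ] A) (hQ : weilAug A (Q ψ) ≠ 0) {D : SmoothRing n M →ₗ[ℝ] A}
    (hD : ∀ f g, D (f * g) = Q f * D g + Q g * D f) (h0 : ∀ i, D (L.coord i) = 0) : D = 0 := by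
  have h := euclidean_derivation_eq_zero (Q.comp (tuplePullback L.coord))
    (D ∘ₗ (tuplePullback L.coord).toLinearMap) (fun f g => by
      simp only [LinearMap.comp_apply, AlgHom.toLinearMap_apply, map_mul, hD, AlgHom.comp_apply])
    (fun i => h0 i)
  ext f
  rw [← L.derivation_apply_tuplePullback_ext hψ Q hQ hD f]
  exact congrArg (fun T : SmoothRing n (EuclideanSpace ℝ (Fin n)) →ₗ[ℝ] A => T (L.ext f)) h

end LocalCoord

end LocalCoordAlgebra

/-! ### Locality of morphisms to Weil algebras -/

section LocalPoints

variable {n : ℕ} {M : Type*} [TopologicalSpace M] [T2Space M]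
  [ChartedSpace (EuclideanSpace ℝ (Fin n)) M] [IsManifold (𝓡 n) ∞ M]

variable (n) in
theorem exists_localCoord_bump (x : M) : ∃ (L : LocalCoord n M) (ψ : SmoothRing n M),
    x ∈ L.dom ∧ (∀ᶠ y in 𝓝 x, ψ y = 1) ∧ ∀ y, ψ y ≠ 0 → y ∈ L.dom := by
  obtain ⟨L, hL, -, -⟩ := exists_localCoord (n := n)
    (IsManifold.chart_mem_maximalAtlas (I := 𝓡 n) (n := ∞) x)
    (mem_chart_source (EuclideanSpace ℝ (Fin n)) x)
  obtain ⟨ψ, h1, h2⟩ := exists_smooth_bump (n := n) (L.isOpen_dom.mem_nhds hL)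
  exact ⟨L, ψ, hL, h1, fun y hy => h2 (subset_tsupport _ hy)⟩

/-- A morphism to a Weil algebra kills the functions vanishing near its point. -/
theorem map_eq_zero_of_eventually {A : Type*} [CommRing A] [Algebra ℝ A] [IsWeilAlgebra A]
    {P : SmoothRing n M →ₐ[ℝ] A} {x : M} (hx : ∀ f, weilAug A (P f) = f x) {f : SmoothRing n M}
    (hf : ∀ᶠ y in 𝓝 x, f y = 0) : P f = 0 := by
  obtain ⟨ψ, h1, h2⟩ := exists_smooth_bump (n := n) hf
  refine map_eq_zero_of_mul_eq_zero P (ψ := ψ) ?_ ?_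
  · rw [hx, h1.self_of_nhds]
    exact one_ne_zero
  · ext y
    change ψ y * f y = 0
    by_cases hy : ψ y = 0
    · rw [hy, zero_mul]
    · rw [show f y = 0 from h2 (subset_tsupport _ hy), mul_zero]

theorem map_eq_of_eventuallyEq {A : Type*} [CommRing A] [Algebra ℝ A] [IsWeilAlgebra A]
    {P : SmoothRing n M →ₐ[ℝ] A} {x : M} (hx : ∀ f, weilAug A (P f) = f x) {f g : SmoothRing n M}
    (hf : ∀ᶠ y in 𝓝 x, f y = g y) : P f = P g := by
  rw [← sub_eq_zero, ← map_sub]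
  refine map_eq_zero_of_eventually hx ?_
  filter_upwards [hf] with y hy
  exact sub_eq_zero.mpr hy

/-- For small t the perturbed coordinates still send a neighbourhood of x into W, so the pull-back
of h vanishes near x. The range of t does not depend on h, which later serves all products fg at
once. -/
theorem eventually_apply_tuplePullback_eq_zero {A : Type*}
    [CommRing A] [Algebra ℝ A] [IsWeilAlgebra A] {P : SmoothRing n M →ₐ[ℝ] A} {x : M}
    (hx : ∀ f, weilAug A (P f) = f x) (c G : Fin n → SmoothRing n M)
    {W : Set (EuclideanSpace ℝ (Fin n))} (hW : IsOpen W) (hxW : tupleMap c x ∈ W) :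
    ∀ᶠ t : ℝ in 𝓝 0, ∀ h : SmoothRing n (EuclideanSpace ℝ (Fin n)), (∀ z ∈ W, h z = 0) →
      P (tuplePullback (c + t • G) h) = 0 := by
  have hs : ∀ (t : ℝ) (y : M), tupleMap (c + t • G) y = tupleMap c y + t • tupleMap G y :=
    fun t y => rfl
  have hc : Continuous fun t : ℝ => tupleMap (c + t • G) x := by
    simp only [hs]
    fun_prop
  have h0 : tupleMap (c + (0 : ℝ) • G) x ∈ W := by
    rw [hs, zero_smul, add_zero]
    exact hxW
  filter_upwards [hc.continuousAt.eventually_mem (hW.mem_nhds h0)] with t ht h hh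
  refine map_eq_zero_of_eventually hx ?_
  filter_upwards [(continuous_tupleMap (c + t • G)).continuousAt.eventually_mem (hW.mem_nhds ht)]
    with y hy
  exact hh _ hy

end LocalPoints

/-! ### Perturbation of the coordinates along a derivation -/

section TuplePullback

variable {n : ℕ} {M : Type*} [TopologicalSpace M] [ChartedSpace (EuclideanSpace ℝ (Fin n)) M]
  {A : Type*} [NormedCommRing A] [NormedAlgebra ℝ A] [IsWeilAlgebra A]

theorem exists_contDiff_apply_tuplePullback (P : SmoothRing n M →ₐ[ℝ] A)
    (c G : Fin n → SmoothRing n M) (h : SmoothRing n (EuclideanSpace ℝ (Fin n))) :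
    ∃ Θ : (Fin n → A) → A, ContDiff ℝ ∞ Θ ∧ (fun t : ℝ => P (tuplePullback (c + t • G) h)) =
      fun t : ℝ => Θ fun i => P (c i) + t • P (G i) := by
  obtain ⟨Θ, hΘ, hQ⟩ := exists_functionalCalculus (A := A) h
  refine ⟨Θ, hΘ, ?_⟩
  funext t
  have := hQ (P.comp (tuplePullback (c + t • G)))
  rw [AlgHom.comp_apply] at this
  rw [this]
  congr 1
  funext i
  change P (c i + t • G i) = _
  rw [map_add, map_smul]

/-- The functional calculus makes the family differentiable, and its derivative at 0 is a derivation
over the same morphism as D along c. Both agree on coordinates by the choice of G, hence everywhere.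
-/
theorem hasDerivAt_apply_tuplePullback (P : SmoothRing n M →ₐ[ℝ] A) (c G : Fin n → SmoothRing n M)
    {D : SmoothRing n M →ₗ[ℝ] A} (hD : ∀ f g, D (f * g) = P f * D g + P g * D f)
    (hG : ∀ i, P (G i) = D (c i)) (h : SmoothRing n (EuclideanSpace ℝ (Fin n))) :
    HasDerivAt (fun t : ℝ => P (tuplePullback (c + t • G) h)) (D (tuplePullback c h)) 0 := by
  have hdiff : ∀ h : SmoothRing n (EuclideanSpace ℝ (Fin n)),
      DifferentiableAt ℝ (fun t : ℝ => P (tuplePullback (c + t • G) h)) 0 := fun h => by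
    obtain ⟨Θ, hΘ, h1⟩ := exists_contDiff_apply_tuplePullback P c G h
    rw [h1]
    exact (hΘ.differentiable (by simp) _).comp (0 : ℝ)
      (f := fun t : ℝ => fun i => P (c i) + t • P (G i)) (by fun_prop)
  let E : SmoothRing n (EuclideanSpace ℝ (Fin n)) →ₗ[ℝ] A :=
    { toFun := fun h => deriv (fun t : ℝ => P (tuplePullback (c + t • G) h)) 0
      map_add' := fun f g => by
        simp only [map_add]
        exact deriv_fun_add (hdiff f) (hdiff g)
      map_smul' := fun r f => by
        simp only [map_smul]
        exact deriv_fun_const_smul r (hdiff f) }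
  have h0 : c + (0 : ℝ) • G = c := by rw [zero_smul, add_zero]
  have hE : ∀ f g, E (f * g) = P (tuplePullback c f) * E g + P (tuplePullback c g) * E f := by
    intro f g
    change deriv (fun t : ℝ => P (tuplePullback (c + t • G) (f * g))) 0 = _
    simp only [map_mul]
    have := ((hdiff f).hasDerivAt.mul (hdiff g).hasDerivAt).deriv
    rw [h0] at this
    refine this.trans ?_
    change E f * _ + _ * E g = _
    ring
  have key := euclidean_derivation_eq_zero (P.comp (tuplePullback c))
    (E - D ∘ₗ (tuplePullback c).toLinearMap) (fun f g => by
      simp only [LinearMap.sub_apply, LinearMap.comp_apply, AlgHom.toLinearMap_apply, map_mul, hD,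
        hE, AlgHom.comp_apply]
      ring) (fun i => by
      rw [LinearMap.sub_apply, sub_eq_zero]
      change deriv (fun t : ℝ => P (c i + t • G i)) 0 = D (c i)
      simp only [map_add, map_smul, hG]
      have := ((hasDerivAt_id (0 : ℝ)).smul_const (D (c i))).const_add (P (c i))
      rw [one_smul] at this
      exact this.deriv)
  have h2 : E h = D (tuplePullback c h) := by
    have := congrArg (fun T : SmoothRing n (EuclideanSpace ℝ (Fin n)) →ₗ[ℝ] A => T h) key
    exact sub_eq_zero.mp this
  rw [← h2]
  exact (hdiff h).hasDerivAt

theorem continuous_apply_tuplePullback (P : SmoothRing n M →ₐ[ℝ] A) (c G : Fin n → SmoothRing n M)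
    (h : SmoothRing n (EuclideanSpace ℝ (Fin n))) :
    Continuous fun t : ℝ => P (tuplePullback (c + t • G) h) := by
  obtain ⟨Θ, hΘ, h1⟩ := exists_contDiff_apply_tuplePullback P c G h
  rw [h1]
  exact hΘ.continuous.comp (by fun_prop)

end TuplePullback

/-! ### Bounded neighbourhoods and curves of regular points on a manifold -/

section ManifoldPoints

variable {n : ℕ} {M : Type*} [TopologicalSpace M] [T2Space M] [SecondCountableTopology M]
  [ChartedSpace (EuclideanSpace ℝ (Fin n)) M] [IsManifold (𝓡 n) ∞ M]

/-- Local coordinates at the point of a morphism to a Weil algebra. -/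
theorem exists_point {A : Type*} [CommRing A] [Algebra ℝ A] [IsWeilAlgebra A]
    (P : SmoothRing n M →ₐ[ℝ] A) : ∃ x : M, ∀ f, weilAug A (P f) = f x :=
  exists_eq_eval ((weilAug A).comp P)

variable {A : Type*} [NormedCommRing A] [NormedAlgebra ℝ A] [FiniteDimensional ℝ A]
  [IsWeilAlgebra A]

/-- Near P every value Q(f) is a fixed continuous function of the values at the coordinates, which
range over a compact ball. -/
theorem hasBoundedNhds : HasBoundedNhds (SmoothRing n M) A := by
  intro P
  have : ProperSpace A := FiniteDimensional.proper ℝ A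
  obtain ⟨x, hx⟩ := exists_point P.1
  obtain ⟨L, ψ, hxL, hψ1, hψ⟩ := exists_localCoord_bump n x
  have hc : ∀ f : SmoothRing n M, ContinuousAt (fun Q : RegularPoint (SmoothRing n M) A => Q.1 f) P :=
    fun f => (smoothPtAt_eval f P).continuousAt
  have h1 : ∀ᶠ Q : RegularPoint (SmoothRing n M) A in 𝓝 P, weilAug A (Q.1 ψ) ≠ 0 := by
    have hw : Continuous (weilAug A) := contDiff_weilAug.continuous
    refine (hw.continuousAt.comp (hc ψ)).eventually_ne ?_
    change weilAug A (P.1 ψ) ≠ 0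
    rw [hx, hψ1.self_of_nhds]
    exact one_ne_zero
  have h2 : ∀ᶠ Q : RegularPoint (SmoothRing n M) A in 𝓝 P, (fun i => Q.1 (L.coord i)) ∈
      Metric.closedBall (fun i => P.1 (L.coord i)) 1 :=
    (continuousAt_pi.mpr fun i => hc (L.coord i)).eventually_mem
      (Metric.closedBall_mem_nhds _ one_pos)
  refine ⟨_, h1.and h2, fun f => ?_⟩
  obtain ⟨Θ, hΘ, h⟩ := exists_functionalCalculus (A := A) (L.ext f)
  obtain ⟨C, hC⟩ := (isCompact_closedBall (fun i => P.1 (L.coord i)) 1).exists_bound_of_continuousOn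
    hΘ.continuous.continuousOn
  refine ⟨C, fun Q hQ => ?_⟩
  rw [← L.apply_tuplePullback_ext hψ Q.1 hQ.1 f]
  have h3 := h (Q.1.comp (tuplePullback L.coord))
  rw [AlgHom.comp_apply] at h3
  rw [h3]
  exact hC _ hQ.2

/-- The curve is f ↦ P(ext(f) ∘ (x + tG)). The extension is multiplicative only on the image of the
coordinate domain, but the error vanishes there and is killed for small t. Surjectivity persists
because the frames are continuous in t and equal 1 at t = 0. -/
theorem hasCurves : HasCurves (SmoothRing n M) A := by
  classical
  intro P D hD
  have : CompleteSpace A := FiniteDimensional.complete ℝ A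
  obtain ⟨x, hx⟩ := exists_point P.1
  obtain ⟨L, ψ, hxL, hψ1, hψ⟩ := exists_localCoord_bump n x
  have hPψ : weilAug A (P.1 ψ) ≠ 0 := by
    rw [hx, hψ1.self_of_nhds]
    exact one_ne_zero
  choose G hG using fun i => P.2 (D (L.coord i))
  let N : ℝ → SmoothRing n (EuclideanSpace ℝ (Fin n)) →ₐ[ℝ] A := fun t =>
    P.1.comp (tuplePullback (L.coord + t • G))
  let T : ℝ → SmoothRing n M →ₗ[ℝ] A := fun t => (N t).toLinearMap ∘ₗ L.ext
  have hT0 : ∀ f, T 0 f = P.1 f := fun f => by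
    change P.1 (tuplePullback (L.coord + (0 : ℝ) • G) (L.ext f)) = _
    rw [zero_smul, add_zero, L.apply_tuplePullback_ext hψ P.1 hPψ]
  have hTd : ∀ f, HasDerivAt (fun t => T t f) (D f) 0 := fun f => by
    have := hasDerivAt_apply_tuplePullback P.1 L.coord G hD hG (L.ext f)
    rw [L.derivation_apply_tuplePullback_ext hψ P.1 hPψ hD] at this
    exact this
  have hz := eventually_apply_tuplePullback_eq_zero hx L.coord G
    (L.isOpen_image L.dom subset_rfl L.isOpen_dom) (Set.mem_image_of_mem _ hxL)
  have hmul : ∀ᶠ t in 𝓝 (0 : ℝ), T t 1 = 1 ∧ ∀ f g, T t (f * g) = T t f * T t g := by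
    filter_upwards [hz] with t ht
    refine ⟨?_, fun f g => ?_⟩
    · have := ht (L.ext 1 - 1) (by
        rintro _ ⟨y, hy, rfl⟩
        exact sub_eq_zero.mpr (L.ext_apply 1 y hy))
      exact (sub_eq_zero.mp ((map_sub (N t) _ _).symm.trans this)).trans (map_one (N t))
    · have := ht (L.ext (f * g) - L.ext f * L.ext g) (by
        rintro _ ⟨y, hy, rfl⟩
        change L.ext (f * g) _ - L.ext f _ * L.ext g _ = 0
        rw [L.ext_apply _ y hy, L.ext_apply _ y hy, L.ext_apply _ y hy]
        exact sub_self _)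
      exact (sub_eq_zero.mp ((map_sub (N t) _ _).symm.trans this)).trans (map_mul (N t) _ _)
  obtain ⟨lam, hlam⟩ := exists_linearSection P
  let F : ℝ → A →L[ℝ] A := fun t => LinearMap.toContinuousLinearMap (T t ∘ₗ lam)
  have hF : Continuous F := continuous_clm_apply.mpr fun a =>
    continuous_apply_tuplePullback P.1 L.coord G (L.ext (lam a))
  have hF0 : F 0 = 1 := by
    ext a
    exact (hT0 (lam a)).trans (hlam a)
  have hunit : ∀ᶠ t in 𝓝 (0 : ℝ), IsUnit (F t) :=
    hF.continuousAt.eventually_mem (Units.isOpen.mem_nhds (by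
      rw [hF0]
      exact isUnit_one))
  have hsurj : ∀ᶠ t in 𝓝 (0 : ℝ), Function.Surjective (T t) := by
    filter_upwards [hunit] with t ht a
    exact ⟨lam (Ring.inverse (F t) a), isUnit_mul_inverse_apply ht a⟩
  -- Away from small t the curve takes the arbitrary value `P`; only its germ at 0 matters.
  have hγ : ∀ t, ∃ Q : RegularPoint (SmoothRing n M) A,
      ((T t 1 = 1 ∧ ∀ f g, T t (f * g) = T t f * T t g) ∧ Function.Surjective (T t)) →
        ∀ f, Q.1 f = T t f := fun t => by
    by_cases h : (T t 1 = 1 ∧ ∀ f g, T t (f * g) = T t f * T t g) ∧ Function.Surjective (T t)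
    · exact ⟨⟨AlgHom.ofLinearMap (T t) h.1.1 h.1.2, h.2⟩, fun _ _ => rfl⟩
    · exact ⟨P, fun h' => absurd h' h⟩
  choose γ hγ using hγ
  have hev : ∀ᶠ t in 𝓝 (0 : ℝ), ∀ f, (γ t).1 f = T t f := by
    filter_upwards [hmul, hsurj] with t h1 h2
    exact hγ t ⟨h1, h2⟩
  refine ⟨γ, Subtype.ext (AlgHom.ext fun f => (hev.self_of_nhds f).trans (hT0 f)), fun f => ?_⟩
  exact (hTd f).congr_of_eventuallyEq (hev.mono fun t ht => ht f)

end ManifoldPoints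

/-! ### Partial derivatives and coordinate fields -/

section PartialDeriv

variable {n : ℕ}

/-- The partial derivatives on a Euclidean space. -/
def partialDeriv (i : Fin n) : Derivation ℝ (SmoothRing n (EuclideanSpace ℝ (Fin n)))
    (SmoothRing n (EuclideanSpace ℝ (Fin n))) :=
  Derivation.mk'
    { toFun := fun f => smoothFun (fun y => fderiv ℝ f y (EuclideanSpace.single i 1))
        (((contDiff_smoothRing f).fderiv_right (by simp)).clm_apply contDiff_const)
      map_add' := fun f g => by
        ext y
        change fderiv ℝ (fun z => f z + g z) y _ = fderiv ℝ f y _ + fderiv ℝ g y _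
        rw [fderiv_fun_add ((contDiff_smoothRing f).differentiable (by simp) y)
          ((contDiff_smoothRing g).differentiable (by simp) y)]
        rfl
      map_smul' := fun c f => by
        ext y
        change fderiv ℝ (fun z => c • f z) y _ = c • fderiv ℝ f y _
        rw [fderiv_fun_const_smul ((contDiff_smoothRing f).differentiable (by simp) y)]
        rfl }
    fun f g => by
      ext y
      change fderiv ℝ (fun z => f z * g z) y _ = f y * fderiv ℝ g y _ + g y * fderiv ℝ f y _
      rw [fderiv_fun_mul ((contDiff_smoothRing f).differentiable (by simp) y)
          ((contDiff_smoothRing g).differentiable (by simp) y)]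
      rfl

theorem partialDeriv_apply (i : Fin n) (f : SmoothRing n (EuclideanSpace ℝ (Fin n)))
    (y : EuclideanSpace ℝ (Fin n)) :
    partialDeriv i f y = fderiv ℝ f y (EuclideanSpace.single i 1) :=
  rfl

theorem partialDeriv_eq_of_eqOn (i : Fin n) {f g : SmoothRing n (EuclideanSpace ℝ (Fin n))}
    {W : Set (EuclideanSpace ℝ (Fin n))} (hW : IsOpen W) (h : ∀ y ∈ W, f y = g y)
    {y : EuclideanSpace ℝ (Fin n)} (hy : y ∈ W) : partialDeriv i f y = partialDeriv i g y := by
  rw [partialDeriv_apply, partialDeriv_apply]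
  have : (f : EuclideanSpace ℝ (Fin n) → ℝ) =ᶠ[𝓝 y] g := by
    filter_upwards [hW.mem_nhds hy] with z hz
    exact h z hz
  rw [this.fderiv_eq]

theorem partialDeriv_eq_zero_of_line (i : Fin n) {f : SmoothRing n (EuclideanSpace ℝ (Fin n))}
    {y : EuclideanSpace ℝ (Fin n)}
    (h : ∀ᶠ t : ℝ in 𝓝 0, f (y + t • EuclideanSpace.single i 1) = 0) : partialDeriv i f y = 0 := by
  have h1 : HasFDerivAt f (fderiv ℝ f y) (y + (0 : ℝ) • EuclideanSpace.single i (1 : ℝ)) := by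
    rw [zero_smul, add_zero]
    exact ((contDiff_smoothRing f).differentiable (by simp) y).hasFDerivAt
  have h2 : HasDerivAt (fun t : ℝ => y + t • EuclideanSpace.single i (1 : ℝ))
      ((1 : ℝ) • EuclideanSpace.single i (1 : ℝ)) 0 :=
    ((hasDerivAt_id (0 : ℝ)).smul_const _).const_add y
  rw [one_smul] at h2
  have h3 := h1.comp_hasDerivAt (0 : ℝ) h2
  rw [partialDeriv_apply]
  exact h3.unique ((hasDerivAt_const (0 : ℝ) (0 : ℝ)).congr_of_eventuallyEq h)

theorem partialDeriv_coordFun (i j : Fin n) :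
    partialDeriv i (coordFun j) = if i = j then 1 else 0 := by
  ext y
  have h : HasFDerivAt (fun y : EuclideanSpace ℝ (Fin n) => y j)
      (EuclideanSpace.proj j : EuclideanSpace ℝ (Fin n) →L[ℝ] ℝ) y :=
    (EuclideanSpace.proj j : EuclideanSpace ℝ (Fin n) →L[ℝ] ℝ).hasFDerivAt
  have h2 : partialDeriv i (coordFun j) y = (EuclideanSpace.single i (1 : ℝ) : EuclideanSpace ℝ (Fin n)) j :=
    congrArg (fun l : EuclideanSpace ℝ (Fin n) →L[ℝ] ℝ => l (EuclideanSpace.single i 1)) h.fderiv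
  rw [h2, PiLp.single_apply]
  by_cases hij : i = j
  · rw [if_pos hij.symm, if_pos hij]
    rfl
  · rw [if_neg (Ne.symm hij), if_neg hij]
    rfl

end PartialDeriv

section CoordAt

variable {n : ℕ} {M : Type*} [TopologicalSpace M] [ChartedSpace (EuclideanSpace ℝ (Fin n)) M]

variable (n) in
/-- Local coordinates near a point, with a bump function. -/
structure CoordAt (x : M) extends LocalCoord n M where
  /-- the bump function -/
  bump : SmoothRing n M
  eventually_bump : ∀ᶠ y in 𝓝 x, bump y = 1
  mem_dom_of_bump_ne_zero : ∀ y, bump y ≠ 0 → y ∈ dom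

namespace CoordAt

variable {x : M} (L : CoordAt n x)

theorem mem_dom : x ∈ L.dom :=
  L.mem_dom_of_bump_ne_zero x (by
    rw [L.eventually_bump.self_of_nhds]
    exact one_ne_zero)

theorem ext_eq_on_image {f : SmoothRing n M} {g : SmoothRing n (EuclideanSpace ℝ (Fin n))}
    (h : ∀ y ∈ L.dom, g (tupleMap L.coord y) = f y) :
    ∀ z ∈ tupleMap L.coord '' L.dom, L.ext f z = g z := by
  rintro _ ⟨y, hy, rfl⟩
  rw [L.ext_apply f y hy, h y hy]

theorem isOpen_image_dom : IsOpen (tupleMap L.coord '' L.dom) :=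
  L.isOpen_image L.dom subset_rfl L.isOpen_dom

theorem bump_mul_pullback_partialDeriv (i : Fin n) {f : SmoothRing n M}
    {g : SmoothRing n (EuclideanSpace ℝ (Fin n))}
    (h : ∀ y ∈ L.dom, g (tupleMap L.coord y) = f y) :
    L.bump * tuplePullback L.coord (partialDeriv i (L.ext f)) =
      L.bump * tuplePullback L.coord (partialDeriv i g) :=
  L.mul_tuplePullback_eq L.mem_dom_of_bump_ne_zero fun y hy =>
    partialDeriv_eq_of_eqOn i L.isOpen_image_dom (L.ext_eq_on_image h) ⟨y, hy, rfl⟩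

/-- The coordinate fields, cut off by the bump function. -/
def field (i : Fin n) : Derivation ℝ (SmoothRing n M) (SmoothRing n M) :=
  Derivation.mk'
    { toFun := fun f => L.bump * tuplePullback L.coord (partialDeriv i (L.ext f))
      map_add' := fun f g => by rw [map_add, map_add, map_add, mul_add]
      map_smul' := fun c f => by
        rw [map_smul, Derivation.map_smul, map_smul, mul_smul_comm, RingHom.id_apply] }
    fun f g => by
      change L.bump * tuplePullback L.coord (partialDeriv i (L.ext (f * g))) =
        f * (L.bump * tuplePullback L.coord (partialDeriv i (L.ext g))) +
          g * (L.bump * tuplePullback L.coord (partialDeriv i (L.ext f)))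
      -- The extension of fg and the product of the extensions agree only over the domain, which the
      -- bump factor makes sufficient.
      rw [L.bump_mul_pullback_partialDeriv i (g := L.ext f * L.ext g) fun y hy => ?_]
      · have h1 := fun f : SmoothRing n M =>
          L.mul_sub_tuplePullback_ext L.mem_dom_of_bump_ne_zero f
        rw [Derivation.leibniz, smul_eq_mul, smul_eq_mul, map_add, map_mul, map_mul]
        linear_combination
          -(tuplePullback L.coord (partialDeriv i (L.ext g))) * h1 f -
            (tuplePullback L.coord (partialDeriv i (L.ext f))) * h1 g
      · change L.ext f _ * L.ext g _ = f y * g y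
        rw [L.ext_apply f y hy, L.ext_apply g y hy]

theorem field_apply_apply (i : Fin n) (f : SmoothRing n M) (y : M) :
    L.field i f y = L.bump y * partialDeriv i (L.ext f) (tupleMap L.coord y) :=
  rfl

theorem field_tuplePullback (i : Fin n) (g : SmoothRing n (EuclideanSpace ℝ (Fin n))) :
    L.field i (tuplePullback L.coord g) = L.bump * tuplePullback L.coord (partialDeriv i g) :=
  L.bump_mul_pullback_partialDeriv i fun _ _ => rfl

theorem field_coord (i j : Fin n) : L.field i (L.coord j) = if i = j then L.bump else 0 := by
  rw [← tuplePullback_coordFun L.coord j, field_tuplePullback, partialDeriv_coordFun]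
  split_ifs
  · rw [map_one, mul_one]
  · rw [map_zero, mul_zero]

end CoordAt

end CoordAt

section CompDerivation

variable {n : ℕ} {M : Type*} [TopologicalSpace M] [ChartedSpace (EuclideanSpace ℝ (Fin n)) M]
  {A : Type*} [CommRing A] [Algebra ℝ A]

/-- The composition of a derivation of the ring with an algebra morphism. -/
def compDerivation (Q : SmoothRing n M →ₐ[ℝ] A)
    (Y : Derivation ℝ (SmoothRing n M) (SmoothRing n M)) : SmoothRing n M →ₗ[ℝ] A :=
  Q.toLinearMap ∘ₗ (Y : SmoothRing n M →ₗ[ℝ] SmoothRing n M)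

theorem compDerivation_mul (Q : SmoothRing n M →ₐ[ℝ] A)
    (Y : Derivation ℝ (SmoothRing n M) (SmoothRing n M)) (f g : SmoothRing n M) :
    compDerivation Q Y (f * g) = Q f * compDerivation Q Y g + Q g * compDerivation Q Y f := by
  change Q (Y (f * g)) = Q f * Q (Y g) + Q g * Q (Y f)
  rw [Y.leibniz, smul_eq_mul, smul_eq_mul, map_add, map_mul, map_mul]

theorem derivation_quotient_mul {p : Ideal (SmoothRing n M)}
    (D : Derivation ℝ (SmoothRing n M) (SmoothRing n M ⧸ p)) (f g : SmoothRing n M) :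
    (D : SmoothRing n M →ₗ[ℝ] SmoothRing n M ⧸ p) (f * g) =
      Ideal.Quotient.mkₐ ℝ p f * (D : SmoothRing n M →ₗ[ℝ] SmoothRing n M ⧸ p) g +
      Ideal.Quotient.mkₐ ℝ p g * (D : SmoothRing n M →ₗ[ℝ] SmoothRing n M ⧸ p) f :=
  D.leibniz f g

end CompDerivation

/-! ### Coordinate fields modulo a jet -/

section CoordAtWeil

variable {n : ℕ} {M : Type*} [TopologicalSpace M] [T2Space M]
  [ChartedSpace (EuclideanSpace ℝ (Fin n)) M] [IsManifold (𝓡 n) ∞ M]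

variable (n) in
theorem nonempty_coordAt (x : M) : Nonempty (CoordAt n x) := by
  obtain ⟨L, ψ, -, h1, h2⟩ := exists_localCoord_bump n x
  exact ⟨⟨L, ψ, h1, h2⟩⟩

variable {A : Type*} [CommRing A] [Algebra ℝ A] [IsWeilAlgebra A]
  {Q : SmoothRing n M →ₐ[ℝ] A} {x : M}

theorem derivation_eq_zero_of_eventually (hx : ∀ f, weilAug A (Q f) = f x)
    {D : SmoothRing n M →ₗ[ℝ] A} (hD : ∀ f g, D (f * g) = Q f * D g + Q g * D f)
    {f : SmoothRing n M} (hf : ∀ᶠ y in 𝓝 x, f y = 0) : D f = 0 := by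
  obtain ⟨ψ, h1, h2⟩ := exists_smooth_bump (n := n) hf
  refine derivation_eq_zero_of_mul_eq_zero Q hD (ψ := ψ) ?_ ?_
  · rw [hx, h1.self_of_nhds]
    exact one_ne_zero
  · ext y
    change ψ y * f y = 0
    by_cases hy : ψ y = 0
    · rw [hy, zero_mul]
    · rw [show f y = 0 from h2 (subset_tsupport _ hy), mul_zero]

theorem derivation_sum_apply {ι R : Type*} [CommRing R] [Algebra ℝ R] (s : Finset ι)
    (Y : ι → Derivation ℝ R R) (f : R) : (∑ i ∈ s, Y i) f = ∑ i ∈ s, Y i f := by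
  have := congrFun (map_sum (Derivation.coeFnAddMonoidHom (R := ℝ) (A := R) (M := R)) Y s) f
  rw [Finset.sum_apply] at this
  exact this

namespace CoordAt

variable (L : CoordAt n x)

theorem map_bump (hx : ∀ f, weilAug A (Q f) = f x) : Q L.bump = 1 := by
  rw [map_eq_of_eventuallyEq hx (g := 1) L.eventually_bump, map_one]

theorem weilAug_bump_ne_zero (hx : ∀ f, weilAug A (Q f) = f x) : weilAug A (Q L.bump) ≠ 0 := by
  rw [L.map_bump hx, map_one]
  exact one_ne_zero

theorem map_field_bump (hx : ∀ f, weilAug A (Q f) = f x) (i : Fin n) :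
    Q (L.field i L.bump) = 0 := by
  have h := derivation_eq_zero_of_eventually hx (compDerivation_mul Q (L.field i))
    (f := L.bump - 1) (by
      filter_upwards [L.eventually_bump] with y hy
      exact sub_eq_zero.mpr hy)
  have h1 : L.field i (L.bump - 1) = L.field i L.bump := by
    rw [map_sub, Derivation.map_one_eq_zero, sub_zero]
  rw [← h1]
  exact h

theorem map_field_coord (hx : ∀ f, weilAug A (Q f) = f x) (i j : Fin n) :
    Q (L.field i (L.coord j)) = if i = j then 1 else 0 := by
  rw [L.field_coord]
  split_ifs
  · exact L.map_bump hx
  · exact map_zero Q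

/-- The expansion of a derivation in coordinates. -/
theorem derivation_apply (hx : ∀ f, weilAug A (Q f) = f x)
    {D : SmoothRing n M →ₗ[ℝ] A} (hD : ∀ f g, D (f * g) = Q f * D g + Q g * D f)
    (f : SmoothRing n M) : D f = ∑ i, D (L.coord i) * Q (L.field i f) := by
  have h := L.derivation_eq_zero L.mem_dom_of_bump_ne_zero Q (L.weilAug_bump_ne_zero hx)
    (D := D - ∑ i, LinearMap.mulLeft ℝ (D (L.coord i)) ∘ₗ compDerivation Q (L.field i))
    (fun f g => by
      simp only [LinearMap.sub_apply, LinearMap.sum_apply, LinearMap.comp_apply,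
        LinearMap.mulLeft_apply, compDerivation_mul, hD, mul_sub, Finset.mul_sum, mul_add,
        Finset.sum_add_distrib]
      simp only [mul_left_comm (Q f), mul_left_comm (Q g)]
      ring) (fun j => by
      simp only [LinearMap.sub_apply, LinearMap.sum_apply, LinearMap.comp_apply,
        LinearMap.mulLeft_apply]
      rw [sub_eq_zero]
      have : ∀ i, compDerivation Q (L.field i) (L.coord j) = if i = j then 1 else 0 :=
        fun i => L.map_field_coord hx i j
      simp [this])
  have h2 := congrArg (fun T : SmoothRing n M →ₗ[ℝ] A => T f) h
  simp only [LinearMap.sub_apply, LinearMap.sum_apply, LinearMap.comp_apply,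
    LinearMap.mulLeft_apply, LinearMap.zero_apply] at h2
  exact sub_eq_zero.mp h2

/-- The fields are cut off and need not commute on M, but after Q their bracket is a derivation over
Q that kills the coordinates, hence zero. -/
theorem map_field_field (hx : ∀ f, weilAug A (Q f) = f x) (i j : Fin n) (f : SmoothRing n M) :
    Q (L.field i (L.field j f)) = Q (L.field j (L.field i f)) := by
  have h := L.derivation_eq_zero L.mem_dom_of_bump_ne_zero Q (L.weilAug_bump_ne_zero hx)
    (compDerivation_mul Q ⁅L.field i, L.field j⁆) (fun k => by
      change Q (⁅L.field i, L.field j⁆ (L.coord k)) = 0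
      have : ∀ i j, Q (L.field i (L.field j (L.coord k))) = 0 := fun i j => by
        rw [L.field_coord]
        split_ifs
        · exact L.map_field_bump hx i
        · rw [map_zero, map_zero]
      rw [Derivation.commutator_apply, map_sub, this, this, sub_zero])
  have h2 := congrArg (fun T : SmoothRing n M →ₗ[ℝ] A => T f) h
  change Q (⁅L.field i, L.field j⁆ f) = 0 at h2
  rwa [Derivation.commutator_apply, map_sub, sub_eq_zero] at h2

end CoordAt

theorem CoordAt.fieldValue_sum (L : CoordAt n x) {p : Ideal (SmoothRing n M)} [IsJet p]
    (hx : ∀ f, weilAug _ (Ideal.Quotient.mkₐ ℝ p f) = f x)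
    (D : Derivation ℝ (SmoothRing n M) (SmoothRing n M ⧸ p)) {g : Fin n → SmoothRing n M}
    (hg : ∀ i, Ideal.Quotient.mkₐ ℝ p (g i) = D (L.coord i)) :
    fieldValue p (∑ i, g i • L.field i) = D := by
  ext f
  have h := L.derivation_apply hx (derivation_quotient_mul D) f
  refine Eq.trans ?_ h.symm
  change Ideal.Quotient.mkₐ ℝ p ((∑ i, g i • L.field i) f) = _
  rw [derivation_sum_apply, map_sum]
  refine Finset.sum_congr rfl fun i _ => ?_
  rw [Derivation.smul_apply, smul_eq_mul, map_mul, hg]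
  rfl

end CoordAtWeil

section FieldValue

variable {n : ℕ} {M : Type*} [TopologicalSpace M] [T2Space M] [SecondCountableTopology M]
  [ChartedSpace (EuclideanSpace ℝ (Fin n)) M] [IsManifold (𝓡 n) ∞ M]

/-- Every derivation at a jet is the value of a field. -/
theorem fieldValue_surjective (p : Ideal (SmoothRing n M)) [IsJet p] :
    Function.Surjective (fieldValue p) := fun D => by
  obtain ⟨x, hx⟩ := exists_point (Ideal.Quotient.mkₐ ℝ p)
  obtain ⟨L⟩ := nonempty_coordAt n x
  choose g hg using fun i => Ideal.Quotient.mkₐ_surjective ℝ p (D (L.coord i))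
  exact ⟨_, L.fieldValue_sum hx D hg⟩

/-- A derivation at q is the value of a field, and the value of the same field at p is a lift. -/
theorem exists_compDer_quotientProj_eq {p q : Ideal (SmoothRing n M)} [IsJet q] (h : p ≤ q)
    (D : Derivation ℝ (SmoothRing n M) (SmoothRing n M ⧸ q)) :
    ∃ D' : Derivation ℝ (SmoothRing n M) (SmoothRing n M ⧸ p), (quotientProj h).compDer D' = D := by
  obtain ⟨Y, rfl⟩ := fieldValue_surjective q D
  exact ⟨fieldValue p Y, rfl⟩

end FieldValue

/-! ### Quotients and cotangent spaces of Weil algebras -/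

section WeilQuotient

/-- Rationality: b minus its augmentation is nilpotent, so it dies in the residue field of C, which
is therefore covered by the reals. -/
theorem isWeilAlgebra_of_surjective {B C : Type*} [CommRing B] [Algebra ℝ B] [IsWeilAlgebra B]
    [CommRing C] [Algebra ℝ C] [Nontrivial C] (f : B →ₐ[ℝ] C) (hf : Function.Surjective f) :
    IsWeilAlgebra C := by
  have : IsLocalRing C := IsLocalRing.of_surjective' (f : B →+* C) hf
  have : Module.Finite ℝ B := IsWeilAlgebra.finite
  refine ⟨Module.Finite.of_surjective f.toLinearMap hf, fun r => ?_⟩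
  obtain ⟨c, rfl⟩ := IsLocalRing.residue_surjective r
  obtain ⟨b, rfl⟩ := hf c
  refine ⟨weilAug B b, ?_⟩
  have h1 : algebraMap ℝ (IsLocalRing.ResidueField C) (weilAug B b) =
      IsLocalRing.residue C (f (algebraMap ℝ B (weilAug B b))) := by
    rw [AlgHom.commutes]
    rfl
  obtain ⟨k, hk⟩ := exists_maximalIdeal_pow_eq_bot B
  have h2 : (b - algebraMap ℝ B (weilAug B b)) ^ k = 0 := by
    rw [← Ideal.mem_bot, ← hk]
    exact Ideal.pow_mem_pow (sub_weilAug_mem b) k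
  have h3 : IsLocalRing.residue C (f (b - algebraMap ℝ B (weilAug B b))) ^ k = 0 := by
    rw [← map_pow, ← map_pow, h2, map_zero, map_zero]
  have h4 := (IsReduced.eq_zero _ ⟨k, h3⟩)
  rw [map_sub, map_sub, sub_eq_zero] at h4
  rw [h1, h4]

variable (B : Type*) [CommRing B] [Algebra ℝ B] [IsWeilAlgebra B]

/-- The class in the cotangent space of `b` minus its augmentation. -/
def weilCotangent : B →ₗ[ℝ] (IsLocalRing.maximalIdeal B).Cotangent :=
  (IsLocalRing.maximalIdeal B).toCotangent.restrictScalars ℝ ∘ₗ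
    LinearMap.codRestrict ((IsLocalRing.maximalIdeal B).restrictScalars ℝ)
      (LinearMap.id - (Algebra.linearMap ℝ B) ∘ₗ (weilAug B).toLinearMap) sub_weilAug_mem

variable {B}

theorem weilCotangent_eq_zero_iff {b : B} :
    weilCotangent B b = 0 ↔
      b - algebraMap ℝ B (weilAug B b) ∈ IsLocalRing.maximalIdeal B ^ 2 :=
  Ideal.toCotangent_eq_zero _ _

theorem weilCotangent_surjective : Function.Surjective (weilCotangent B) := fun y => by
  obtain ⟨⟨b, hb⟩, rfl⟩ := Ideal.toCotangent_surjective _ y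
  refine ⟨b, ?_⟩
  refine congrArg (IsLocalRing.maximalIdeal B).toCotangent (Subtype.ext ?_)
  change b - algebraMap ℝ B (weilAug B b) = b
  rw [weilAug_eq_zero_iff.mpr hb, map_zero, sub_zero]

theorem maximalIdeal_sq_ne_top : IsLocalRing.maximalIdeal B ^ 2 ≠ ⊤ := fun h =>
  (IsLocalRing.maximalIdeal.isMaximal B).ne_top (top_le_iff.mp (h ▸ Ideal.pow_le_self two_ne_zero))

end WeilQuotient

/-! ### Linear algebra of adapted bases -/

section LinearAlgebra

variable {n : ℕ} {C : Type*} [AddCommGroup C] [Module ℝ C]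

/-- A basis whose last vectors are in the kernel of a surjective linear map. -/
theorem exists_basis_adapted (T : (Fin n → ℝ) →ₗ[ℝ] C) (hT : Function.Surjective T) :
    Module.finrank ℝ C ≤ n ∧ ∃ b : Module.Basis (Fin n) ℝ (Fin n → ℝ),
      ∀ j : Fin n, Module.finrank ℝ C ≤ (j : ℕ) → T (b j) = 0 := by
  have h1 := T.finrank_range_add_finrank_ker
  rw [LinearMap.range_eq_top.mpr hT, finrank_top, Module.finrank_fin_fun] at h1
  obtain ⟨W, hW⟩ := (LinearMap.ker T).exists_isCompl
  have h2 := Submodule.finrank_add_eq_of_isCompl hW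
  rw [Module.finrank_fin_fun] at h2
  have h3 : Module.finrank ℝ W = Module.finrank ℝ C := by omega
  refine ⟨by omega, ?_⟩
  generalize Module.finrank ℝ C = m at *
  let bW := Module.finBasisOfFinrankEq ℝ W h3
  let bK := Module.finBasis ℝ (LinearMap.ker T)
  let e : Fin m ⊕ Fin (Module.finrank ℝ (LinearMap.ker T)) ≃ Fin n :=
    finSumFinEquiv.trans (finCongr h1)
  refine ⟨((bW.prod bK).map (Submodule.prodEquivOfIsCompl W _ hW.symm)).reindex e, fun j hj => ?_⟩
  obtain ⟨i | i, rfl⟩ := e.surjective j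
  · have : ((e (Sum.inl i) : Fin n) : ℕ) = i := rfl
    omega
  · simp

theorem map_eq_sum_single (T : (Fin n → ℝ) →ₗ[ℝ] C) (w : Fin n → ℝ) :
    T w = ∑ i, w i • T (Pi.single i 1) := by
  conv_lhs => rw [← (Pi.basisFun ℝ (Fin n)).sum_repr w]
  simp

/-- The images of the first m basis vectors span a space of dimension m, so they are independent. -/
theorem apply_castAdd_eq_zero_of_surjective {m k : ℕ} (hm : Module.finrank ℝ C = m)
    (T : (Fin (m + k) → ℝ) →ₗ[ℝ] C) (hT : Function.Surjective T)
    (h0 : ∀ j : Fin k, T (Pi.single (Fin.natAdd m j) 1) = 0) {v : Fin (m + k) → ℝ}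
    (hv : T v = 0) (i : Fin m) : v (Fin.castAdd k i) = 0 := by
  have hsum : ∀ w, T w = ∑ i : Fin m, w (Fin.castAdd k i) • T (Pi.single (Fin.castAdd k i) 1) := by
    intro w
    rw [map_eq_sum_single, Fin.sum_univ_add]
    simp [h0]
  have hspan : ⊤ ≤ Submodule.span ℝ
      (Set.range fun i : Fin m => T (Pi.single (Fin.castAdd k i) 1)) := by
    rintro c -
    obtain ⟨w, rfl⟩ := hT c
    rw [hsum]
    exact Submodule.sum_mem _ fun i _ => Submodule.smul_mem _ _ (Submodule.subset_span ⟨i, rfl⟩)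
  have hli := linearIndependent_of_top_le_span_of_card_eq_finrank hspan
    (by rw [Fintype.card_fin, hm])
  exact Fintype.linearIndependent_iff.mp hli (fun i => v (Fin.castAdd k i))
    (by rw [← hsum, hv]) i

theorem apply_eq_zero_of_surjective {m : ℕ} (hm : Module.finrank ℝ C = m)
    (T : (Fin n → ℝ) →ₗ[ℝ] C) (hT : Function.Surjective T)
    (h0 : ∀ j : Fin n, m ≤ (j : ℕ) → T (Pi.single j 1) = 0) {v : Fin n → ℝ}
    (hv : T v = 0) (i : Fin n) (hi : (i : ℕ) < m) : v i = 0 := by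
  obtain ⟨k, rfl⟩ := Nat.exists_eq_add_of_le (hm ▸ (exists_basis_adapted T hT).1 : m ≤ n)
  exact apply_castAdd_eq_zero_of_surjective hm T hT
    (fun j => h0 _ (by simp)) hv ⟨i, hi⟩

end LinearAlgebra

/-! ### The width of a jet and the differentials at its point -/

section Width

variable {n : ℕ} {M : Type*} [TopologicalSpace M]
  [ChartedSpace (EuclideanSpace ℝ (Fin n)) M] {x : M}

namespace CoordAt

variable (L : CoordAt n x)

/-- The differential at a point, in coordinates. -/
def grad : SmoothRing n M →ₗ[ℝ] (Fin n → ℝ) where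
  toFun f i := L.field i f x
  map_add' f g := by
    funext i
    rw [map_add]
    rfl
  map_smul' c f := by
    funext i
    rw [Derivation.map_smul]
    rfl

theorem grad_apply (f : SmoothRing n M) (i : Fin n) : L.grad f i = L.field i f x :=
  rfl

theorem grad_coord (j : Fin n) : L.grad (L.coord j) = Pi.single j 1 := by
  funext i
  rw [grad_apply, field_coord, Pi.single_apply]
  split_ifs
  · exact L.eventually_bump.self_of_nhds
  · rfl

theorem grad_algebraMap (c : ℝ) : L.grad (algebraMap ℝ _ c) = 0 := by
  funext i
  rw [grad_apply, Derivation.map_algebraMap]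
  rfl

theorem grad_mul (f g : SmoothRing n M) : L.grad (f * g) = f x • L.grad g + g x • L.grad f := by
  funext i
  rw [grad_apply, Derivation.leibniz]
  rfl

theorem grad_surjective : Function.Surjective L.grad := fun v => by
  refine ⟨∑ j, v j • L.coord j, ?_⟩
  rw [map_sum]
  simp only [map_smul, grad_coord]
  exact (map_eq_sum_single LinearMap.id v).symm

variable {B : Type*} [CommRing B] [Algebra ℝ B] [IsWeilAlgebra B] {Q : SmoothRing n M →ₐ[ℝ] B}

/-- The map from the coordinate cotangent space at a point to the cotangent space of a Weil
algebra. -/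
def cotangentMap (Q : SmoothRing n M →ₐ[ℝ] B) :
    (Fin n → ℝ) →ₗ[ℝ] (IsLocalRing.maximalIdeal B).Cotangent :=
  Fintype.linearCombination ℝ fun i => weilCotangent B (Q (L.coord i))

theorem exists_grad_eq_zero_of_mem_sq (hx : ∀ f, weilAug B (Q f) = f x)
    (hQ : Function.Surjective Q) {b : B} (hb : b ∈ IsLocalRing.maximalIdeal B ^ 2) :
    ∃ f, Q f = b ∧ L.grad f = 0 := by
  rw [pow_two] at hb
  refine Submodule.mul_induction_on hb (fun b hb c hc => ?_) fun b c hb hc => ?_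
  · obtain ⟨f, rfl⟩ := hQ b
    obtain ⟨g, rfl⟩ := hQ c
    refine ⟨f * g, map_mul Q f g, ?_⟩
    rw [grad_mul, ← hx f, ← hx g, weilAug_eq_zero_iff.mpr hb, weilAug_eq_zero_iff.mpr hc, zero_smul,
      zero_smul, add_zero]
  · obtain ⟨f, rfl, hf⟩ := hb
    obtain ⟨g, rfl, hg⟩ := hc
    exact ⟨f + g, map_add Q f g, by rw [map_add, hf, hg, add_zero]⟩

variable [T2Space M] [IsManifold (𝓡 n) ∞ M]

/-- Modulo the square of the maximal ideal, Q(f) - f(x) is a derivation over evaluation at x, the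
defect being a product of two elements of the maximal ideal. Its expansion in coordinates is the
claim. -/
theorem cotangentMap_grad (hx : ∀ f, weilAug B (Q f) = f x) (f : SmoothRing n M) :
    L.cotangentMap Q (L.grad f) = weilCotangent B (Q f) := by
  have : Nontrivial (B ⧸ IsLocalRing.maximalIdeal B ^ 2) :=
    Ideal.Quotient.nontrivial_iff.mpr maximalIdeal_sq_ne_top
  have hW : IsWeilAlgebra (B ⧸ IsLocalRing.maximalIdeal B ^ 2) :=
    isWeilAlgebra_of_surjective (Ideal.Quotient.mkₐ ℝ _) (Ideal.Quotient.mkₐ_surjective ℝ _)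
  let π := Ideal.Quotient.mkₐ ℝ (IsLocalRing.maximalIdeal B ^ 2)
  let aug : SmoothRing n M →ₐ[ℝ] B := (Algebra.ofId ℝ B).comp ((weilAug B).comp Q)
  have haug : ∀ f, aug f = algebraMap ℝ B (f x) := fun f => congrArg (algebraMap ℝ B) (hx f)
  have hQ : ∀ f, weilAug _ (π (aug f)) = f x := fun f => by
    rw [haug, AlgHom.commutes, AlgHom.commutes]
    rfl
  have hmem : ∀ f, Q f - aug f ∈ IsLocalRing.maximalIdeal B := fun f => sub_weilAug_mem (Q f)
  have h := L.derivation_apply (Q := π.comp aug) hQ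
    (D := π.toLinearMap ∘ₗ (Q.toLinearMap - aug.toLinearMap)) (fun f g => by
      change π (Q (f * g) - aug (f * g)) = π (aug f) * π (Q g - aug g) +
        π (aug g) * π (Q f - aug f)
      rw [← map_mul, ← map_mul, ← map_add, ← sub_eq_zero, ← map_sub]
      refine Ideal.Quotient.eq_zero_iff_mem.mpr ?_
      have : Q (f * g) - aug (f * g) - (aug f * (Q g - aug g) + aug g * (Q f - aug f)) =
          (Q f - aug f) * (Q g - aug g) := by
        rw [map_mul, map_mul]
        ring
      rw [this, pow_two]
      exact Ideal.mul_mem_mul (hmem f) (hmem g)) f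
  have hz : ∀ b, weilCotangent B b = 0 ↔ π (b - algebraMap ℝ B (weilAug B b)) = 0 := fun b =>
    weilCotangent_eq_zero_iff.trans Ideal.Quotient.eq_zero_iff_mem.symm
  have h2 : weilCotangent B (∑ i, L.grad f i • Q (L.coord i) - Q f) = 0 := by
    rw [hz]
    have h3 : ∀ g, algebraMap ℝ B (weilAug B (Q g)) = aug g := fun g => rfl
    have h4 : ∑ i, L.grad f i • Q (L.coord i) - Q f = Q (∑ i, L.grad f i • L.coord i - f) := by
      rw [map_sub, map_sum]
      simp only [map_smul]
    rw [h4, h3]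
    have h5 : ∀ i, π (aug (L.field i f)) = algebraMap ℝ _ (L.grad f i) := fun i => by
      rw [haug, AlgHom.commutes]
      rfl
    change π (Q f - aug f) = ∑ i, π (Q (L.coord i) - aug (L.coord i)) * π (aug (L.field i f)) at h
    have h6 : Q (∑ i, L.grad f i • L.coord i - f) - aug (∑ i, L.grad f i • L.coord i - f) =
        ∑ i, L.grad f i • (Q (L.coord i) - aug (L.coord i)) - (Q f - aug f) := by
      simp only [map_sub, map_sum, map_smul, smul_sub, Finset.sum_sub_distrib]
      ring
    rw [h6, map_sub, h, sub_eq_zero, map_sum]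
    refine Finset.sum_congr rfl fun i _ => ?_
    rw [h5, map_smul, Algebra.smul_def, mul_comm]
  rw [map_sub, sub_eq_zero, map_sum] at h2
  simp only [map_smul] at h2
  exact h2

theorem cotangentMap_surjective (hx : ∀ f, weilAug B (Q f) = f x) (hQ : Function.Surjective Q) :
    Function.Surjective (L.cotangentMap Q) := fun c => by
  obtain ⟨b, rfl⟩ := weilCotangent_surjective c
  obtain ⟨f, rfl⟩ := hQ b
  exact ⟨L.grad f, L.cotangentMap_grad hx f⟩

/-- A function with differential v has, up to a constant, its value in the square of the maximal
ideal. That value is also taken by a function with zero differential, which can be subtracted. -/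
theorem exists_grad_eq_of_cotangentMap_eq_zero (hx : ∀ f, weilAug B (Q f) = f x)
    (hQ : Function.Surjective Q) {v : Fin n → ℝ} (hv : L.cotangentMap Q v = 0) :
    ∃ f, Q f = 0 ∧ L.grad f = v := by
  obtain ⟨f, rfl⟩ := L.grad_surjective v
  rw [L.cotangentMap_grad hx, weilCotangent_eq_zero_iff] at hv
  obtain ⟨g, hg, hg0⟩ := L.exists_grad_eq_zero_of_mem_sq hx hQ hv
  refine ⟨f - algebraMap ℝ _ (weilAug B (Q f)) - g, ?_, ?_⟩
  · rw [map_sub, map_sub, AlgHom.commutes, hg, sub_self]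
  · rw [map_sub, map_sub, grad_algebraMap, hg0, sub_zero, sub_zero]

/-- There are functions with independent differentials, the last of which vanish at a given
jet. -/
theorem exists_adapted_tuple (hx : ∀ f, weilAug B (Q f) = f x) (hQ : Function.Surjective Q) :
    weilWidth B ≤ n ∧ ∃ y : Fin n → SmoothRing n M, LinearIndependent ℝ (fun j => L.grad (y j)) ∧
      ∀ j : Fin n, weilWidth B ≤ (j : ℕ) → Q (y j) = 0 := by
  have : Module.Finite ℝ B := IsWeilAlgebra.finite
  have : Module.Finite ℝ (IsLocalRing.maximalIdeal B).Cotangent :=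
    Module.Finite.of_surjective _ (weilCotangent_surjective (B := B))
  obtain ⟨h1, b, hb⟩ := exists_basis_adapted _ (L.cotangentMap_surjective hx hQ)
  have h2 : ∀ j : Fin n, ∃ f, (weilWidth B ≤ (j : ℕ) → Q f = 0) ∧ L.grad f = b j := fun j => by
    by_cases hj : weilWidth B ≤ (j : ℕ)
    · obtain ⟨f, hf, hfj⟩ := L.exists_grad_eq_of_cotangentMap_eq_zero hx hQ (hb j hj)
      exact ⟨f, fun _ => hf, hfj⟩
    · obtain ⟨f, hf⟩ := L.grad_surjective (b j)
      exact ⟨f, fun h => absurd h hj, hf⟩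
  choose y hy hyb using h2
  refine ⟨h1, y, ?_, hy⟩
  simp only [hyb]
  exact b.linearIndependent

/-- If the last coordinates vanish at a jet, the first partial derivatives of the functions of that
jet vanish at its point. -/
theorem field_apply_eq_zero (hx : ∀ f, weilAug B (Q f) = f x) (hQ : Function.Surjective Q)
    (hL : ∀ j : Fin n, weilWidth B ≤ (j : ℕ) → Q (L.coord j) = 0) {f : SmoothRing n M}
    (hf : Q f = 0) {i : Fin n} (hi : (i : ℕ) < weilWidth B) : L.field i f x = 0 := by
  have : Module.Finite ℝ B := IsWeilAlgebra.finite
  have : Module.Finite ℝ (IsLocalRing.maximalIdeal B).Cotangent :=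
    Module.Finite.of_surjective _ (weilCotangent_surjective (B := B))
  refine apply_eq_zero_of_surjective (m := weilWidth B) rfl _ (L.cotangentMap_surjective hx hQ)
    (fun j hj => ?_) (v := L.grad f) ?_ i hi
  · rw [← L.grad_coord, L.cotangentMap_grad hx, hL j hj, map_zero]
  · rw [L.cotangentMap_grad hx, hf, map_zero]

end CoordAt

end Width

/-! ### Charts from functions with independent differentials -/

section InverseFunction

/-- A smooth map whose differential at a point is bijective is near this point a smooth open partial
homeomorphism with smooth inverse. -/
theorem exists_openPartialHomeomorph_of_fderiv {E : Type*} [NormedAddCommGroup E] [NormedSpace ℝ E]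
    [CompleteSpace E] {h : E → E} (hh : ContDiff ℝ ∞ h) {z : E} (hz : IsUnit (fderiv ℝ h z)) :
    ∃ e : OpenPartialHomeomorph E E, z ∈ e.source ∧ (∀ y, e y = h y) ∧
      ContDiffOn ℝ ∞ e.symm e.target := by
  have hequiv : ∀ y, IsUnit (fderiv ℝ h y) → ∃ T : E ≃L[ℝ] E, HasFDerivAt h (T : E →L[ℝ] E) y := by
    rintro y ⟨T, hT⟩
    refine ⟨ContinuousLinearEquiv.unitsEquiv ℝ E T, ?_⟩
    have : ((ContinuousLinearEquiv.unitsEquiv ℝ E T : E ≃L[ℝ] E) : E →L[ℝ] E) = fderiv ℝ h y := by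
      rw [← hT]
      rfl
    rw [this]
    exact (hh.differentiable (by simp) y).hasFDerivAt
  have hU : IsOpen {y | IsUnit (fderiv ℝ h y)} :=
    Units.isOpen.preimage (hh.continuous_fderiv (by simp))
  obtain ⟨T, hT⟩ := hequiv z hz
  let e := hh.contDiffAt.toOpenPartialHomeomorph h hT (by simp)
  -- Restricting to the points with invertible differential makes the inverse smooth on the whole
  -- target, not only at one point.
  refine ⟨e.restrOpen _ hU, ⟨hh.contDiffAt.mem_toOpenPartialHomeomorph_source hT (by simp), hz⟩,
    fun y => rfl, fun y hy => ?_⟩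
  have hy' := (e.restrOpen _ hU).map_target hy
  obtain ⟨T', hT'⟩ := hequiv _ hy'.2
  exact ((e.restrOpen _ hU).contDiffAt_symm hy hT' hh.contDiffAt).contDiffWithinAt

end InverseFunction

section AdaptedChart

variable {n : ℕ} {M : Type*} [TopologicalSpace M] [T2Space M]
  [ChartedSpace (EuclideanSpace ℝ (Fin n)) M] [IsManifold (𝓡 n) ∞ M] {x : M}

theorem exists_coordAt_of_chart {φ : OpenPartialHomeomorph M (EuclideanSpace ℝ (Fin n))}
    (hφ : φ ∈ IsManifold.maximalAtlas (𝓡 n) ∞ M) (hx : x ∈ φ.source) :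
    ∃ L : CoordAt n x, L.dom ⊆ φ.source ∧ ∀ y ∈ L.dom, tupleMap L.coord y = φ y := by
  obtain ⟨L, hL, h1, h2⟩ := exists_localCoord hφ hx
  obtain ⟨ψ, h3, h4⟩ := exists_smooth_bump (n := n) (L.isOpen_dom.mem_nhds hL)
  exact ⟨⟨L, ψ, h3, fun y hy => h4 (subset_tsupport _ hy)⟩, h1, h2⟩

theorem fderiv_tupleMap_apply (c : Fin n → SmoothRing n (EuclideanSpace ℝ (Fin n)))
    (z v : EuclideanSpace ℝ (Fin n)) (j : Fin n) :
    fderiv ℝ (tupleMap c) z v j = ∑ i, v i * partialDeriv i (c j) z := by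
  have h1 : HasFDerivAt (tupleMap c) (fderiv ℝ (tupleMap c) z) z :=
    ((contMDiff_tupleMap c).contDiff.differentiable (by simp) z).hasFDerivAt
  have h2 := ((EuclideanSpace.proj j : EuclideanSpace ℝ (Fin n) →L[ℝ] ℝ).hasFDerivAt.comp z h1).fderiv
  have h3 : fderiv ℝ (c j) z v = fderiv ℝ (tupleMap c) z v j :=
    congrArg (fun l : EuclideanSpace ℝ (Fin n) →L[ℝ] ℝ => l v) h2
  have hv : v = ∑ i, v i • EuclideanSpace.single i (1 : ℝ) := by
    ext k
    simp [Finset.sum_apply, Pi.single_apply]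
  rw [← h3]
  conv_lhs => rw [hv]
  rw [map_sum]
  refine Finset.sum_congr rfl fun i _ => ?_
  rw [map_smul]
  rfl

/-- Functions with independent differentials at a point are coordinates near this point. -/
theorem exists_chart_of_linearIndependent (x : M) : ∃ L : CoordAt n x,
    ∀ y : Fin n → SmoothRing n M, LinearIndependent ℝ (fun j => L.grad (y j)) →
      ∃ φ ∈ IsManifold.maximalAtlas (𝓡 n) ∞ M, x ∈ φ.source ∧ ∀ z ∈ φ.source, φ z = tupleMap y z := by
  obtain ⟨φ, hφ, hxφ⟩ : ∃ φ ∈ IsManifold.maximalAtlas (𝓡 n) ∞ M, x ∈ φ.source :=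
    ⟨chartAt (EuclideanSpace ℝ (Fin n)) x, IsManifold.chart_mem_maximalAtlas x,
      mem_chart_source (EuclideanSpace ℝ (Fin n)) x⟩
  obtain ⟨L, hL1, hL2⟩ := exists_coordAt_of_chart hφ hxφ
  refine ⟨L, fun y hy => ?_⟩
  let c : Fin n → SmoothRing n (EuclideanSpace ℝ (Fin n)) := fun j => L.ext (y j)
  have hunit : IsUnit (fderiv ℝ (tupleMap c) (φ x)) := by
    have hinj : Function.Injective (fderiv ℝ (tupleMap c) (φ x)) := by
      rw [injective_iff_map_eq_zero]
      intro v hv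
      have hspan : Submodule.span ℝ (Set.range fun j => L.grad (y j)) = ⊤ :=
        hy.span_eq_top_of_card_eq_finrank' (by simp)
      -- A vector in the kernel pairs to zero with the differentials of all the y_j, and these span.
      have hz : ∀ w : Fin n → ℝ, ∑ i, v i * w i = 0 := fun w => by
        have hw : w ∈ Submodule.span ℝ (Set.range fun j => L.grad (y j)) := hspan ▸ trivial
        induction hw using Submodule.span_induction with
        | mem w hw =>
          obtain ⟨j, rfl⟩ := hw
          have h1 := congrArg (fun u : EuclideanSpace ℝ (Fin n) => u j) hv
          simp only [fderiv_tupleMap_apply] at h1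
          refine Eq.trans (Finset.sum_congr rfl fun i _ => ?_) h1
          have h2 := L.field_apply_apply i (y j) x
          rw [L.eventually_bump.self_of_nhds, one_mul, hL2 x L.mem_dom] at h2
          exact congrArg (fun r => v i * r) h2
        | zero => simp
        | add a b _ _ ha hb => simp [mul_add, Finset.sum_add_distrib, ha, hb]
        | smul r a _ ha => simp [mul_left_comm _ r, ← Finset.mul_sum, ha]
      ext i
      simpa [Pi.single_apply] using hz (Pi.single i 1)
    have hsurj := LinearMap.injective_iff_surjective (f := (fderiv ℝ (tupleMap c) (φ x) :
      EuclideanSpace ℝ (Fin n) →ₗ[ℝ] EuclideanSpace ℝ (Fin n))).mp hinj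
    let T := ContinuousLinearEquiv.ofBijective (fderiv ℝ (tupleMap c) (φ x))
      (LinearMap.ker_eq_bot.mpr hinj) (LinearMap.range_eq_top.mpr hsurj)
    exact ⟨(ContinuousLinearEquiv.unitsEquiv ℝ _).symm T, rfl⟩
  obtain ⟨e, he, heq, hsymm⟩ := exists_openPartialHomeomorph_of_fderiv
    (contMDiff_tupleMap c).contDiff hunit
  let φ' := (φ.restrOpen L.dom L.isOpen_dom).trans e
  have hsrc : ∀ z ∈ φ'.source, z ∈ φ.source ∧ z ∈ L.dom ∧ φ z ∈ e.source := fun z hz => by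
    rw [OpenPartialHomeomorph.trans_source] at hz
    exact ⟨hz.1.1, hz.1.2, hz.2⟩
  have hmap : ∀ z ∈ φ'.source, φ' z = tupleMap y z := fun z hz => by
    obtain ⟨-, hzL, -⟩ := hsrc z hz
    change e (φ z) = _
    rw [heq, ← hL2 z hzL]
    ext j
    exact L.ext_apply (y j) z hzL
  refine ⟨φ', ?_, ?_, hmap⟩
  · refine OpenPartialHomeomorph.mem_maximalAtlas_of_contMDiffOn φ'
      ((contMDiff_tupleMap y).contMDiffOn.congr hmap) ?_
    have htgt : ∀ z ∈ φ'.target, z ∈ e.target ∧ e.symm z ∈ φ.target := fun z hz => by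
      rw [OpenPartialHomeomorph.trans_target] at hz
      exact ⟨hz.1, hz.2.1⟩
    refine (contMDiffOn_symm_of_mem_maximalAtlas hφ).comp
      (hsymm.contMDiffOn.mono fun z hz => (htgt z hz).1) fun z hz => (htgt z hz).2
  · rw [OpenPartialHomeomorph.trans_source]
    exact ⟨⟨hxφ, L.mem_dom⟩, he⟩

variable {B : Type*} [CommRing B] [Algebra ℝ B] [IsWeilAlgebra B]

/-- Coordinates adapted to a jet: the last ones belong to the jet. -/
theorem exists_adapted_coordAt {Q : SmoothRing n M →ₐ[ℝ] B} (hx : ∀ f, weilAug B (Q f) = f x)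
    (hQ : Function.Surjective Q) :
    weilWidth B ≤ n ∧ ∃ φ ∈ IsManifold.maximalAtlas (𝓡 n) ∞ M, ∃ L : CoordAt n x,
      L.dom ⊆ φ.source ∧ (∀ y ∈ L.dom, tupleMap L.coord y = φ y) ∧
      ∀ j : Fin n, weilWidth B ≤ (j : ℕ) → Q (L.coord j) = 0 := by
  obtain ⟨L₀, hL₀⟩ := exists_chart_of_linearIndependent (n := n) x
  obtain ⟨hn, y, hy, hQy⟩ := L₀.exists_adapted_tuple hx hQ
  obtain ⟨φ, hφ, hxφ, hφy⟩ := hL₀ y hy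
  obtain ⟨L, h1, h2⟩ := exists_coordAt_of_chart hφ hxφ
  refine ⟨hn, φ, hφ, L, h1, h2, fun j hj => ?_⟩
  rw [← hQy j hj]
  refine map_eq_of_eventuallyEq hx ?_
  filter_upwards [L.isOpen_dom.mem_nhds L.mem_dom] with z hz
  have := (h2 z hz).trans (hφy z (h1 hz))
  exact congrArg (fun u : EuclideanSpace ℝ (Fin n) => u j) this

end AdaptedChart

/-! ### Uniqueness of the augmentation -/

section Augmentation

variable {B C : Type*} [CommRing B] [Algebra ℝ B] [IsWeilAlgebra B] [CommRing C] [Algebra ℝ C]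
  [IsWeilAlgebra C]

theorem algHom_eq_weilAug (ρ : B →ₐ[ℝ] ℝ) (b : B) : ρ b = weilAug B b := by
  obtain ⟨k, hk⟩ := exists_maximalIdeal_pow_eq_bot B
  have h2 : (b - algebraMap ℝ B (weilAug B b)) ^ k = 0 := by
    rw [← Ideal.mem_bot, ← hk]
    exact Ideal.pow_mem_pow (sub_weilAug_mem b) k
  have h3 : IsNilpotent (ρ (b - algebraMap ℝ B (weilAug B b))) :=
    ⟨k, by rw [← map_pow, h2, map_zero]⟩
  have h4 := IsReduced.eq_zero _ h3
  rw [map_sub, AlgHom.commutes, sub_eq_zero] at h4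
  exact h4

theorem weilAug_map (f : B →ₐ[ℝ] C) (b : B) : weilAug C (f b) = weilAug B b :=
  algHom_eq_weilAug ((weilAug C).comp f) b

end Augmentation

section DerivationSpan

theorem derivation_mem_of_mem_span {R : Type*} [CommRing R] [Algebra ℝ R] (Y : Derivation ℝ R R)
    {s : Set R} (h : ∀ g ∈ s, Y g ∈ Ideal.span s) {g : R} (hg : g ∈ Ideal.span s) :
    Y g ∈ Ideal.span s := by
  induction hg using Submodule.span_induction with
  | mem g hg => exact h g hg
  | zero => rw [map_zero]; exact zero_mem _
  | add a b _ _ ha hb => rw [map_add]; exact add_mem ha hb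
  | smul a b hb' hb =>
    rw [smul_eq_mul, Y.leibniz]
    exact add_mem (Ideal.mul_mem_left _ _ hb) (Ideal.mul_mem_right _ _ hb')

end DerivationSpan

/-! ### The ideal of first derivatives in adapted coordinates -/

section AdaptedIdeal

variable {n : ℕ} {M : Type*} [TopologicalSpace M]
  [ChartedSpace (EuclideanSpace ℝ (Fin n)) M] {x : M}
  {p : Ideal (SmoothRing n M)}

namespace CoordAt

variable (L : CoordAt n x)

/-- The ideal generated by an ideal and the derivatives of its elements along the first
coordinates. -/
def firstDerivedIdeal (m : ℕ) (p : Ideal (SmoothRing n M)) : Ideal (SmoothRing n M) :=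
  Ideal.span {g | g ∈ p ∨ ∃ i : Fin n, (i : ℕ) < m ∧ ∃ f ∈ p, g = L.field i f}

theorem le_firstDerivedIdeal (m : ℕ) (p : Ideal (SmoothRing n M)) :
    p ≤ L.firstDerivedIdeal m p :=
  fun _ hf => Ideal.subset_span (Or.inl hf)

theorem field_mem_firstDerivedIdeal {m : ℕ} {i : Fin n} (hi : (i : ℕ) < m) {f : SmoothRing n M}
    (hf : f ∈ p) : L.field i f ∈ L.firstDerivedIdeal m p :=
  Ideal.subset_span (Or.inr ⟨i, hi, f, hf, rfl⟩)

variable [T2Space M] [IsManifold (𝓡 n) ∞ M] [IsJet p]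

theorem firstDerivedIdeal_le_idealOf
    (hx : ∀ f, weilAug _ (Ideal.Quotient.mkₐ ℝ p f) = f x)
    (hL : ∀ j : Fin n, weilWidth (SmoothRing n M ⧸ p) ≤ (j : ℕ) → L.coord j ∈ p) :
    L.firstDerivedIdeal (weilWidth (SmoothRing n M ⧸ p)) p ≤ idealOf n {x} := by
  refine Ideal.span_le.mpr ?_
  rintro g (hg | ⟨i, hi, f, hf, rfl⟩) y rfl
  · rw [← hx, show Ideal.Quotient.mkₐ ℝ p g = 0 from Ideal.Quotient.eq_zero_iff_mem.mpr hg, map_zero]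
  · exact L.field_apply_eq_zero hx (Ideal.Quotient.mkₐ_surjective ℝ p)
      (fun j hj => Ideal.Quotient.eq_zero_iff_mem.mpr (hL j hj))
      (Ideal.Quotient.eq_zero_iff_mem.mpr hf) hi

theorem isJet_firstDerivedIdeal
    (hx : ∀ f, weilAug _ (Ideal.Quotient.mkₐ ℝ p f) = f x)
    (hL : ∀ j : Fin n, weilWidth (SmoothRing n M ⧸ p) ≤ (j : ℕ) → L.coord j ∈ p) :
    IsJet (L.firstDerivedIdeal (weilWidth (SmoothRing n M ⧸ p)) p) := by
  have hne : L.firstDerivedIdeal (weilWidth (SmoothRing n M ⧸ p)) p ≠ ⊤ := fun h => by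
    have h1 := L.firstDerivedIdeal_le_idealOf hx hL (h ▸ Submodule.mem_top (x := 1)) x rfl
    exact one_ne_zero h1
  have : Nontrivial (SmoothRing n M ⧸ L.firstDerivedIdeal (weilWidth (SmoothRing n M ⧸ p)) p) :=
    Ideal.Quotient.nontrivial_iff.mpr hne
  exact isWeilAlgebra_of_surjective (Ideal.Quotient.factorₐ ℝ (L.le_firstDerivedIdeal _ p))
    (Ideal.Quotient.factor_surjective (L.le_firstDerivedIdeal _ p))

/-- The chain rule, modulo a jet. -/
theorem sub_sum_mem (hx : ∀ f, weilAug _ (Ideal.Quotient.mkₐ ℝ p f) = f x)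
    (Y : Derivation ℝ (SmoothRing n M) (SmoothRing n M)) (f : SmoothRing n M) :
    Y f - ∑ i, Y (L.coord i) * L.field i f ∈ p := by
  have h := L.derivation_apply hx (compDerivation_mul (Ideal.Quotient.mkₐ ℝ p) Y) f
  rw [← Ideal.Quotient.eq_zero_iff_mem]
  change Ideal.Quotient.mkₐ ℝ p _ = 0
  rw [map_sub, map_sum, sub_eq_zero]
  simp only [map_mul]
  exact h

/-- Change of adapted coordinates. -/
theorem firstDerivedIdeal_le (hx : ∀ f, weilAug _ (Ideal.Quotient.mkₐ ℝ p f) = f x)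
    (hL : ∀ j : Fin n, weilWidth (SmoothRing n M ⧸ p) ≤ (j : ℕ) → L.coord j ∈ p) {L' : CoordAt n x}
    (hL' : ∀ j : Fin n, weilWidth (SmoothRing n M ⧸ p) ≤ (j : ℕ) → L'.coord j ∈ p) :
    L'.firstDerivedIdeal (weilWidth (SmoothRing n M ⧸ p)) p ≤
      L.firstDerivedIdeal (weilWidth (SmoothRing n M ⧸ p)) p := by
  have hJ := L.isJet_firstDerivedIdeal hx hL
  have hpJ := L.le_firstDerivedIdeal (weilWidth (SmoothRing n M ⧸ p)) p
  have hfield := fun {i : Fin n} (hi : (i : ℕ) < weilWidth (SmoothRing n M ⧸ p))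
    {f : SmoothRing n M} (hf : f ∈ p) => L.field_mem_firstDerivedIdeal hi hf
  set m := weilWidth (SmoothRing n M ⧸ p)
  set J := L.firstDerivedIdeal m p
  have hxJ : ∀ f, weilAug _ (Ideal.Quotient.mkₐ ℝ J f) = f x := fun f => by
    rw [← hx]
    exact weilAug_map (Ideal.Quotient.factorₐ ℝ hpJ) (Ideal.Quotient.mkₐ ℝ p f)
  -- The two Jacobian matrices modulo J, mutually inverse by the chain rule. In `T` the derivatives
  -- of the last new coordinates along the first old fields vanish, since these coordinates lie in
  -- p; the inverse has the same block shape.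
  let T : Matrix (Fin n) (Fin n) (SmoothRing n M ⧸ J) :=
    Matrix.of fun i k => Ideal.Quotient.mkₐ ℝ J (L.field i (L'.coord k))
  let T' : Matrix (Fin n) (Fin n) (SmoothRing n M ⧸ J) :=
    Matrix.of fun k i => Ideal.Quotient.mkₐ ℝ J (L'.field k (L.coord i))
  have hTT' : T * T' = 1 := by
    ext i j
    rw [Matrix.mul_apply, Matrix.one_apply]
    have h1 := L'.derivation_apply hxJ (compDerivation_mul (Ideal.Quotient.mkₐ ℝ J) (L.field i))
      (L.coord j)
    exact h1.symm.trans (L.map_field_coord hxJ i j)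
  have hblock : T.BlockTriangular fun i => if (i : ℕ) < m then 1 else 0 := by
    intro i k hik
    by_cases hi : (i : ℕ) < m
    · by_cases hk : (k : ℕ) < m
      · simp [hi, hk] at hik
      · exact Ideal.Quotient.eq_zero_iff_mem.mpr (hfield hi (hL' k (not_lt.mp hk)))
    · simp [hi] at hik
  have : Invertible T := invertibleOfRightInverse T T' hTT'
  have hinv := Matrix.blockTriangular_inv_of_blockTriangular hblock
  rw [Matrix.inv_eq_right_inv hTT'] at hinv
  have hmem : ∀ k i : Fin n, (k : ℕ) < m → m ≤ (i : ℕ) → L'.field k (L.coord i) ∈ J := by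
    intro k i hk hi
    refine Ideal.Quotient.eq_zero_iff_mem.mp (hinv (i := k) (j := i) ?_)
    simp [hk, not_lt.mpr hi]
  refine Ideal.span_le.mpr ?_
  rintro g (hg | ⟨k, hk, f, hf, rfl⟩)
  · exact hpJ hg
  -- In the chain rule for ∂'_k f, the terms with i < m contain ∂_i f, in J by definition, and the
  -- others contain ∂'_k x_i, in J by the block shape.
  · have h := hpJ (L.sub_sum_mem hx (L'.field k) f)
    refine (Submodule.sub_mem_iff_left J (Ideal.sum_mem _ fun i _ => ?_)).mp h
    by_cases hi : (i : ℕ) < m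
    · exact Ideal.mul_mem_left _ _ (hfield hi hf)
    · exact Ideal.mul_mem_right _ _ (hmem k i hk (not_lt.mp hi))

/-- A field which maps the last coordinates and the ideal to the ideal leaves stable the ideal of
first derivatives. -/
theorem derivation_mem_firstDerivedIdeal
    (hx : ∀ f, weilAug _ (Ideal.Quotient.mkₐ ℝ p f) = f x) {m : ℕ} {g : Fin n → SmoothRing n M}
    (hg : ∀ j : Fin n, m ≤ (j : ℕ) → g j ∈ p)
    (hY : ∀ f ∈ p, (∑ j, g j • L.field j) f ∈ p) {a : SmoothRing n M}
    (ha : a ∈ L.firstDerivedIdeal m p) :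
    (∑ j, g j • L.field j) a ∈ L.firstDerivedIdeal m p := by
  have hpJ := L.le_firstDerivedIdeal m p
  have happ : ∀ f, (∑ j, g j • L.field j) f = ∑ j, g j * L.field j f := fun f => by
    rw [derivation_sum_apply]
    rfl
  refine derivation_mem_of_mem_span _ ?_ ha
  rintro b (hb | ⟨i, hi, f, hf, rfl⟩)
  · exact hpJ (hY b hb)
  · have h1 : L.field i (∑ j, g j * L.field j f) ∈ L.firstDerivedIdeal m p := by
      rw [← happ]
      exact L.field_mem_firstDerivedIdeal hi (hY f hf)
    -- With Y the field, Y ∂_i f equals ∂_i(Y f) minus the sum of the ∂_i g_j ∂_j f, up to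
    -- commutators that lie in p. In that sum ∂_j f is in the ideal for j < m, and ∂_i g_j is for
    -- the other j.
    have h2 : ∑ j, g j * L.field j (L.field i f) - ∑ j, g j * L.field i (L.field j f) ∈
        L.firstDerivedIdeal m p := by
      rw [← Finset.sum_sub_distrib]
      refine Ideal.sum_mem _ fun j _ => ?_
      rw [← mul_sub]
      refine Ideal.mul_mem_left _ _ (hpJ (Ideal.Quotient.eq_zero_iff_mem.mp ?_))
      change Ideal.Quotient.mkₐ ℝ p _ = 0
      rw [map_sub, sub_eq_zero]
      exact L.map_field_field hx j i f
    have h3 : ∑ j, L.field j f * L.field i (g j) ∈ L.firstDerivedIdeal m p := by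
      refine Ideal.sum_mem _ fun j _ => ?_
      by_cases hj : (j : ℕ) < m
      · exact Ideal.mul_mem_right _ _ (L.field_mem_firstDerivedIdeal hj hf)
      · exact Ideal.mul_mem_left _ _ (L.field_mem_firstDerivedIdeal hi (hg j (not_lt.mp hj)))
    have h4 : L.field i (∑ j, g j * L.field j f) =
        ∑ j, g j * L.field i (L.field j f) + ∑ j, L.field j f * L.field i (g j) := by
      rw [map_sum, ← Finset.sum_add_distrib]
      exact Finset.sum_congr rfl fun j _ => (L.field i).leibniz _ _
    rw [h4] at h1
    have h5 := add_mem h2 (sub_mem h1 h3)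
    rw [add_sub_cancel_right, sub_add_cancel] at h5
    rw [happ]
    exact h5

end CoordAt

end AdaptedIdeal

/-! ### Functions relative to a coordinate subspace -/

section RelativeHadamard

variable {n : ℕ}

/-- The linear projection to the first coordinates, as a tuple of functions. -/
def firstCoords (n m : ℕ) (j : Fin n) : SmoothRing n (EuclideanSpace ℝ (Fin n)) :=
  if (j : ℕ) < m then coordFun j else 0

theorem tupleMap_firstCoords_apply (m : ℕ) (z : EuclideanSpace ℝ (Fin n)) (j : Fin n) :
    tupleMap (firstCoords n m) z j = if (j : ℕ) < m then z j else 0 := by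
  change firstCoords n m j z = _
  rw [firstCoords]
  split_ifs <;> rfl

theorem tupleMap_firstCoords_eq_self {m : ℕ} {z : EuclideanSpace ℝ (Fin n)}
    (h : ∀ j : Fin n, m ≤ (j : ℕ) → z j = 0) : tupleMap (firstCoords n m) z = z := by
  ext j
  rw [tupleMap_firstCoords_apply]
  split_ifs with hj
  · rfl
  · exact (h j (not_lt.mp hj)).symm

/-- Hadamard's lemma relative to a coordinate subspace. -/
theorem exists_relative_hadamard (m : ℕ) (F : SmoothRing n (EuclideanSpace ℝ (Fin n))) :
    ∃ g : Fin n → SmoothRing n (EuclideanSpace ℝ (Fin n)),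
      F = tuplePullback (firstCoords n m) F + ∑ j, (coordFun j - firstCoords n m j) * g j := by
  obtain ⟨G, hG, h⟩ := exists_hadamard (contDiff_smoothRing F)
  have hpr : ContDiff ℝ ∞ (tupleMap (firstCoords n m)) := (contMDiff_tupleMap _).contDiff
  refine ⟨fun j => smoothFun
    (fun z => G (tupleMap (firstCoords n m) z, z) (EuclideanSpace.single j 1))
    ((hG.comp (hpr.prodMk contDiff_id)).clm_apply contDiff_const), ?_⟩
  ext z
  have h2 : z - tupleMap (firstCoords n m) z =
      ∑ j, (z j - firstCoords n m j z) • EuclideanSpace.single j (1 : ℝ) := by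
    ext k
    have : tupleMap (firstCoords n m) z k = firstCoords n m k z := rfl
    simp [Finset.sum_apply, Pi.single_apply, this]
  have h1 := h (tupleMap (firstCoords n m) z) z
  rw [h2, map_sum] at h1
  refine h1.trans ?_
  have h3 := smoothRing_sum_apply Finset.univ (fun j : Fin n => (coordFun j - firstCoords n m j) *
    smoothFun (fun z => G (tupleMap (firstCoords n m) z, z) (EuclideanSpace.single j 1))
    ((hG.comp (hpr.prodMk contDiff_id)).clm_apply contDiff_const)) z
  refine congrArg (fun r => F (tupleMap (firstCoords n m) z) + r) (Eq.trans ?_ h3.symm)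
  refine Finset.sum_congr rfl fun j _ => ?_
  rw [map_smul]
  rfl

end RelativeHadamard

/-! ### Submanifolds through a jet and the Cartan system -/

section CartanSystem

variable {n : ℕ} {M : Type*} [TopologicalSpace M]
  [ChartedSpace (EuclideanSpace ℝ (Fin n)) M] {x : M}
  {p : Ideal (SmoothRing n M)}

/-- The submanifold given in a chart by the vanishing of the last coordinates. -/
def chartSlice (φ : OpenPartialHomeomorph M (EuclideanSpace ℝ (Fin n))) (m : ℕ) : Set M :=
  {y | y ∈ φ.source ∧ ∀ j : Fin n, m ≤ (j : ℕ) → φ y j = 0}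

variable {φ : OpenPartialHomeomorph M (EuclideanSpace ℝ (Fin n))} {m : ℕ}

theorem isEmbeddedSubmanifold_chartSlice (hφ : φ ∈ IsManifold.maximalAtlas (𝓡 n) ∞ M)
    (hm : m ≤ n) : IsEmbeddedSubmanifold n m (chartSlice φ m) :=
  ⟨hm, fun _ hy => ⟨φ, hφ, hy.1, fun _ hz => ⟨fun h => h.2, fun h => ⟨hz, h⟩⟩⟩⟩

theorem apply_eq_zero_of_mem_jet [IsJet p] (hx : ∀ f, weilAug _ (Ideal.Quotient.mkₐ ℝ p f) = f x)
    {f : SmoothRing n M} (hf : f ∈ p) : f x = 0 := by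
  rw [← hx, show Ideal.Quotient.mkₐ ℝ p f = 0 from Ideal.Quotient.eq_zero_iff_mem.mpr hf, map_zero]

/-- For fixed f in p the map [D] ↦ Df modulo J is linear over the ring, so it vanishes on the Cartan
system once it vanishes on the generating fields. -/
theorem derivedIdeal_le_of_forall [IsJet p] {J : Ideal (SmoothRing n M)} (hpJ : p ≤ J)
    (h : ∀ (X : Set M) (Y : Derivation ℝ (SmoothRing n M) (SmoothRing n M)),
      IsEmbeddedSubmanifold n (weilWidth (SmoothRing n M ⧸ p)) X → PassesThrough X p →
      (∀ f ∈ idealOf n X, Y f ∈ idealOf n X) → ∀ f ∈ p, Y f ∈ J) : derivedIdeal p ≤ J := by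
  refine sup_le hpJ (Ideal.span_le.mpr ?_)
  rintro g ⟨D, hD, f, hf, hg⟩
  have h1 : cartanSystem p ≤ LinearMap.ker (pairDifferential hpJ ⟨f, hf⟩) := by
    refine Submodule.span_le.mpr ?_
    rintro t ⟨Y, ⟨X, hX, hXp, hY⟩, rfl⟩
    exact Ideal.Quotient.eq_zero_iff_mem.mpr (h X Y hX hXp hY f hf)
  have h2 : quotientProj hpJ (D f) = 0 := h1 hD
  rw [← hg] at h2
  exact Ideal.Quotient.eq_zero_iff_mem.mp h2

namespace CoordAt

variable (L : CoordAt n x)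

theorem ext_eq_zero_of_mem_chartSlice (hLφ : L.dom ⊆ φ.source)
    (hLm : ∀ y ∈ L.dom, tupleMap L.coord y = φ y) {f : SmoothRing n M}
    (hf : f ∈ idealOf n (chartSlice φ m)) {z : EuclideanSpace ℝ (Fin n)}
    (hz : z ∈ tupleMap L.coord '' L.dom) (hz0 : ∀ j : Fin n, m ≤ (j : ℕ) → z j = 0) :
    L.ext f z = 0 := by
  obtain ⟨y, hy, rfl⟩ := hz
  rw [L.ext_apply f y hy]
  refine hf y ⟨hLφ hy, fun j hj => ?_⟩
  rw [← hLm y hy]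
  exact hz0 j hj

/-- The first coordinate fields are tangent to the slice. -/
theorem field_mem_idealOf_chartSlice (hLφ : L.dom ⊆ φ.source)
    (hLm : ∀ y ∈ L.dom, tupleMap L.coord y = φ y) {i : Fin n} (hi : (i : ℕ) < m)
    {f : SmoothRing n M} (hf : f ∈ idealOf n (chartSlice φ m)) :
    L.field i f ∈ idealOf n (chartSlice φ m) := by
  intro y hy
  rw [field_apply_apply]
  by_cases hb : L.bump y = 0
  · rw [hb, zero_mul]
  have hyL := L.mem_dom_of_bump_ne_zero y hb
  refine mul_eq_zero_of_right _ (partialDeriv_eq_zero_of_line i ?_)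
  have hc : Continuous fun t : ℝ => tupleMap L.coord y + t • EuclideanSpace.single i (1 : ℝ) := by
    fun_prop
  have h0 : tupleMap L.coord y + (0 : ℝ) • EuclideanSpace.single i (1 : ℝ) ∈
      tupleMap L.coord '' L.dom := by
    rw [zero_smul, add_zero]
    exact Set.mem_image_of_mem _ hyL
  filter_upwards [hc.continuousAt.eventually_mem (L.isOpen_image_dom.mem_nhds h0)] with t ht
  refine L.ext_eq_zero_of_mem_chartSlice hLφ hLm hf ht fun j hj => ?_
  -- Moving in the direction of one of the first coordinates leaves the last ones zero, so the line
  -- stays in the slice.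
  have hij : j ≠ i := fun h => absurd (h ▸ hj) (not_le.mpr hi)
  have h1 : tupleMap L.coord y j = 0 := by
    rw [hLm y hyL]
    exact hy.2 j hj
  simp [h1, hij]

variable [T2Space M] [IsManifold (𝓡 n) ∞ M] [IsJet p]

/-- By the relative Hadamard lemma f is its restriction to the slice, extended constantly along the
last coordinates, plus a combination of these coordinates. The first term vanishes near x and the
rest is in p. -/
theorem idealOf_chartSlice_le (hx : ∀ f, weilAug _ (Ideal.Quotient.mkₐ ℝ p f) = f x)
    (hLφ : L.dom ⊆ φ.source) (hLm : ∀ y ∈ L.dom, tupleMap L.coord y = φ y)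
    (hL : ∀ j : Fin n, m ≤ (j : ℕ) → L.coord j ∈ p) : idealOf n (chartSlice φ m) ≤ p := by
  intro f hf
  obtain ⟨g, hg⟩ := exists_relative_hadamard m (L.ext f)
  have h1 := congrArg (fun F => Ideal.Quotient.mkₐ ℝ p (tuplePullback L.coord F)) hg
  simp only [map_add, map_sum, map_mul, map_sub] at h1
  rw [L.apply_tuplePullback_ext L.mem_dom_of_bump_ne_zero _ (L.weilAug_bump_ne_zero hx)] at h1
  have h2 : ∀ j, Ideal.Quotient.mkₐ ℝ p (tuplePullback L.coord (coordFun j)) -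
      Ideal.Quotient.mkₐ ℝ p (tuplePullback L.coord (firstCoords n m j)) = 0 := fun j => by
    rw [firstCoords]
    split_ifs with hj
    · exact sub_self _
    · rw [map_zero, map_zero, sub_zero]
      exact Ideal.Quotient.eq_zero_iff_mem.mpr (hL j (not_lt.mp hj))
  have h3 : Ideal.Quotient.mkₐ ℝ p
      (tuplePullback L.coord (tuplePullback (firstCoords n m) (L.ext f))) = 0 := by
    refine map_eq_zero_of_eventually hx ?_
    have hc : Continuous fun y : M => tupleMap (firstCoords n m) (tupleMap L.coord y) :=
      (continuous_tupleMap _).comp (continuous_tupleMap _)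
    have h0 : tupleMap (firstCoords n m) (tupleMap L.coord x) ∈ tupleMap L.coord '' L.dom := by
      rw [tupleMap_firstCoords_eq_self fun j hj => apply_eq_zero_of_mem_jet hx (hL j hj)]
      exact Set.mem_image_of_mem _ L.mem_dom
    filter_upwards [hc.continuousAt.eventually_mem (L.isOpen_image_dom.mem_nhds h0)] with y hy
    refine L.ext_eq_zero_of_mem_chartSlice (m := m) hLφ hLm hf hy fun j hj => ?_
    exact (tupleMap_firstCoords_apply m _ j).trans (if_neg (not_lt.mpr hj))
  simp only [h2, zero_mul, Finset.sum_const_zero, add_zero, h3] at h1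
  exact Ideal.Quotient.eq_zero_iff_mem.mp h1

theorem passesThrough_chartSlice (hx : ∀ f, weilAug _ (Ideal.Quotient.mkₐ ℝ p f) = f x)
    (hLφ : L.dom ⊆ φ.source) (hLm : ∀ y ∈ L.dom, tupleMap L.coord y = φ y)
    (hL : ∀ j : Fin n, m ≤ (j : ℕ) → L.coord j ∈ p) : PassesThrough (chartSlice φ m) p := by
  refine ⟨L.idealOf_chartSlice_le hx hLφ hLm hL, x, ⟨hLφ L.mem_dom, fun j hj => ?_⟩, ?_⟩
  · rw [← hLm x L.mem_dom]
    exact apply_eq_zero_of_mem_jet hx (hL j hj)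
  · rintro f hf _ rfl
    exact apply_eq_zero_of_mem_jet hx hf

theorem firstDerivedIdeal_le_derivedIdeal
    (hx : ∀ f, weilAug _ (Ideal.Quotient.mkₐ ℝ p f) = f x)
    (hφ : φ ∈ IsManifold.maximalAtlas (𝓡 n) ∞ M) (hm : weilWidth (SmoothRing n M ⧸ p) ≤ n)
    (hLφ : L.dom ⊆ φ.source) (hLm : ∀ y ∈ L.dom, tupleMap L.coord y = φ y)
    (hL : ∀ j : Fin n, weilWidth (SmoothRing n M ⧸ p) ≤ (j : ℕ) → L.coord j ∈ p) :
    L.firstDerivedIdeal (weilWidth (SmoothRing n M ⧸ p)) p ≤ derivedIdeal p := by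
  refine Ideal.span_le.mpr ?_
  rintro g (hg | ⟨i, hi, f, hf, rfl⟩)
  · exact le_derivedIdeal p hg
  · refine Ideal.mem_sup_right (Ideal.subset_span
      ⟨fieldValue p (L.field i), Submodule.subset_span ⟨L.field i, ⟨_,
        isEmbeddedSubmanifold_chartSlice hφ hm, L.passesThrough_chartSlice hx hLφ hLm hL,
        fun f hf => L.field_mem_idealOf_chartSlice hLφ hLm hi hf⟩, rfl⟩, f, hf, rfl⟩)

end CoordAt

variable [T2Space M] [IsManifold (𝓡 n) ∞ M] [IsJet p]

theorem eq_point_of_le_idealOf (hx : ∀ f, weilAug _ (Ideal.Quotient.mkₐ ℝ p f) = f x) {y : M}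
    (hy : p ≤ idealOf n {y}) : y = x := by
  by_contra hne
  obtain ⟨U, V, hU, hV, hyU, hxV, hUV⟩ := t2_separation hne
  obtain ⟨ψ, h1, h2⟩ := exists_smooth_bump (n := n) (hU.mem_nhds hyU)
  have h3 : Ideal.Quotient.mkₐ ℝ p ψ = 0 := by
    refine map_eq_zero_of_eventually hx ?_
    filter_upwards [hV.mem_nhds hxV] with z hz
    by_contra hz0
    exact Set.disjoint_left.mp hUV (h2 (subset_tsupport _ hz0)) hz
  have h4 : ψ y = 0 := hy (Ideal.Quotient.eq_zero_iff_mem.mp h3) y rfl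
  rw [h1.self_of_nhds] at h4
  exact one_ne_zero h4

/-- A submanifold through a jet yields coordinates adapted to the jet, the last of which are mapped
to the jet by the fields tangent to the submanifold. -/
theorem exists_coordAt_of_passesThrough (hx : ∀ f, weilAug _ (Ideal.Quotient.mkₐ ℝ p f) = f x)
    {X : Set M} (hX : IsEmbeddedSubmanifold n m X) (hXp : PassesThrough X p) :
    ∃ L : CoordAt n x, ∀ j : Fin n, m ≤ (j : ℕ) → L.coord j ∈ p ∧
      ∀ Y : Derivation ℝ (SmoothRing n M) (SmoothRing n M),
        (∀ f ∈ idealOf n X, Y f ∈ idealOf n X) → Y (L.coord j) ∈ p := by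
  obtain ⟨y, hyX, hy⟩ := hXp.2
  obtain rfl := eq_point_of_le_idealOf hx hy
  obtain ⟨φ, hφ, hxφ, hφX⟩ := hX.2 y hyX
  obtain ⟨L, hLφ, hLm⟩ := exists_coordAt_of_chart hφ hxφ
  refine ⟨L, fun j hj => ?_⟩
  -- The coordinate alone vanishes on X only near the point. Multiplied by the bump it vanishes on
  -- all of X and keeps the same germ there, so tangency of Y can be used.
  have h1 : L.bump * L.coord j ∈ idealOf n X := fun z hz => by
    change L.bump z * L.coord j z = 0
    by_cases hb : L.bump z = 0
    · rw [hb, zero_mul]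
    · have hzL := L.mem_dom_of_bump_ne_zero z hb
      have h2 : L.coord j z = φ z j :=
        congrArg (fun u : EuclideanSpace ℝ (Fin n) => u j) (hLm z hzL)
      rw [h2, (hφX z (hLφ hzL)).mp hz j hj, mul_zero]
  have hev : ∀ᶠ z in 𝓝 y, (L.coord j - L.bump * L.coord j) z = 0 := by
    filter_upwards [L.eventually_bump] with z hz
    change L.coord j z - L.bump z * L.coord j z = 0
    rw [hz, one_mul, sub_self]
  constructor
  · have h2 := map_eq_zero_of_eventually hx hev
    have h3 := add_mem (Ideal.Quotient.eq_zero_iff_mem.mp h2) (hXp.1 h1)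
    rwa [sub_add_cancel] at h3
  · intro Y hY
    have h2 : Ideal.Quotient.mk p (Y (L.coord j - L.bump * L.coord j)) = 0 :=
      derivation_eq_zero_of_eventually hx (compDerivation_mul (Ideal.Quotient.mkₐ ℝ p) Y) hev
    have h3 := add_mem (Ideal.Quotient.eq_zero_iff_mem.mp h2) (hXp.1 (hY _ h1))
    rwa [← map_add, sub_add_cancel] at h3

theorem CoordAt.apply_mem_firstDerivedIdeal (L : CoordAt n x)
    (hx : ∀ f, weilAug _ (Ideal.Quotient.mkₐ ℝ p f) = f x)
    {Y : Derivation ℝ (SmoothRing n M) (SmoothRing n M)}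
    (hY : ∀ j : Fin n, m ≤ (j : ℕ) → Y (L.coord j) ∈ p) {f : SmoothRing n M} (hf : f ∈ p) :
    Y f ∈ L.firstDerivedIdeal m p := by
  have hpJ := L.le_firstDerivedIdeal m p
  refine (Submodule.sub_mem_iff_left _ (Ideal.sum_mem _ fun i _ => ?_)).mp
    (hpJ (L.sub_sum_mem hx Y f))
  by_cases hi : (i : ℕ) < m
  · exact Ideal.mul_mem_left _ _ (L.field_mem_firstDerivedIdeal hi hf)
  · exact Ideal.mul_mem_right _ _ (hpJ (hY i (not_lt.mp hi)))

/-- Each submanifold through p brings its own adapted coordinates, in which fields tangent to it map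
p to the ideal of first derivatives; the change of coordinates returns to `L`. -/
theorem CoordAt.derivedIdeal_le (L : CoordAt n x)
    (hx : ∀ f, weilAug _ (Ideal.Quotient.mkₐ ℝ p f) = f x)
    (hL : ∀ j : Fin n, weilWidth (SmoothRing n M ⧸ p) ≤ (j : ℕ) → L.coord j ∈ p) :
    derivedIdeal p ≤ L.firstDerivedIdeal (weilWidth (SmoothRing n M ⧸ p)) p := by
  refine derivedIdeal_le_of_forall (L.le_firstDerivedIdeal _ p) fun X Y hX hXp hY f hf => ?_
  obtain ⟨L', hL'⟩ := exists_coordAt_of_passesThrough hx hX hXp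
  exact L.firstDerivedIdeal_le hx hL (fun j hj => (hL' j hj).1)
    (L'.apply_mem_firstDerivedIdeal hx (fun j hj => (hL' j hj).2 Y hY) hf)

end CartanSystem

/-! ### The derived ideal is a jet and is stable under derivations -/

section DerivedIdeal

variable {n : ℕ} {M : Type*} [TopologicalSpace M] [T2Space M] [SecondCountableTopology M]
  [ChartedSpace (EuclideanSpace ℝ (Fin n)) M] [IsManifold (𝓡 n) ∞ M]

/-- The derived ideal of a jet in adapted coordinates. -/
theorem exists_derivedIdeal_eq (p : Ideal (SmoothRing n M)) [IsJet p] :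
    ∃ (x : M) (L : CoordAt n x), (∀ f, weilAug _ (Ideal.Quotient.mkₐ ℝ p f) = f x) ∧
      (∀ j : Fin n, weilWidth (SmoothRing n M ⧸ p) ≤ (j : ℕ) → L.coord j ∈ p) ∧
      derivedIdeal p = L.firstDerivedIdeal (weilWidth (SmoothRing n M ⧸ p)) p := by
  obtain ⟨x, hx⟩ := exists_point (Ideal.Quotient.mkₐ ℝ p)
  obtain ⟨hm, φ, hφ, L, hLφ, hLm, hL⟩ := exists_adapted_coordAt hx (Ideal.Quotient.mkₐ_surjective ℝ p)
  have hL' : ∀ j : Fin n, weilWidth (SmoothRing n M ⧸ p) ≤ (j : ℕ) → L.coord j ∈ p :=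
    fun j hj => Ideal.Quotient.eq_zero_iff_mem.mp (hL j hj)
  exact ⟨x, L, hx, hL', le_antisymm (L.derivedIdeal_le hx hL')
    (L.firstDerivedIdeal_le_derivedIdeal hx hφ hm hLφ hLm hL')⟩

theorem isJet_derivedIdeal (p : Ideal (SmoothRing n M)) [IsJet p] : IsJet (derivedIdeal p) := by
  obtain ⟨x, L, hx, hL, h⟩ := exists_derivedIdeal_eq p
  rw [h]
  exact L.isJet_firstDerivedIdeal hx hL

/-- Lift the derivation of the quotient to a field with components g_j in adapted coordinates. The
induced derivation kills p, so the field preserves p, and the last g_j lie in p because the last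
coordinates do. These are the hypotheses of `CoordAt.derivation_mem_firstDerivedIdeal`. -/
theorem isDerStable_derivedIdeal (p : Ideal (SmoothRing n M)) [IsJet p] :
    IsDerStable (le_derivedIdeal p) := by
  obtain ⟨x, L, hx, hL, h⟩ := exists_derivedIdeal_eq p
  intro δ a ha
  obtain ⟨f, rfl⟩ := Ideal.Quotient.mk_surjective a
  rw [RingHom.mem_ker, Ideal.Quotient.factor_mk, Ideal.Quotient.eq_zero_iff_mem, h] at ha
  let D : Derivation ℝ (SmoothRing n M) (SmoothRing n M ⧸ p) :=
    Derivation.compAlgebraMapL ℝ (SmoothRing n M) (SmoothRing n M ⧸ p) (SmoothRing n M ⧸ p) δ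
  have hDp : ∀ f ∈ p, D f = 0 := (mem_inducedDerivations_iff p D).mp ⟨δ, rfl⟩
  choose g hg using fun i => Ideal.Quotient.mkₐ_surjective ℝ p (D (L.coord i))
  have hY := L.fieldValue_sum hx D hg
  have hYf : ∀ f, Ideal.Quotient.mk p ((∑ i, g i • L.field i) f) = D f := fun f =>
    congrArg (fun D : Derivation ℝ (SmoothRing n M) (SmoothRing n M ⧸ p) => D f) hY
  have h1 := L.derivation_mem_firstDerivedIdeal hx (m := weilWidth (SmoothRing n M ⧸ p)) (g := g)
    (fun j hj => Ideal.Quotient.eq_zero_iff_mem.mp ((hg j).trans (hDp _ (hL j hj))))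
    (fun f hf => Ideal.Quotient.eq_zero_iff_mem.mp ((hYf f).trans (hDp f hf))) ha
  rw [← h] at h1
  change δ (Ideal.Quotient.mk p f) ∈ _
  have h2 : δ (Ideal.Quotient.mk p f) = D f := rfl
  rw [h2, ← hYf, RingHom.mem_ker, Ideal.Quotient.factor_mk]
  exact Ideal.Quotient.eq_zero_iff_mem.mpr h1

end DerivedIdeal

/-! ### A norm on a Weil algebra from its regular representation -/

section WeilNorm

variable (A : Type*) [CommRing A] [Algebra ℝ A] [IsWeilAlgebra A]

/-- The algebra morphism from a Weil algebra to matrices given by the multiplication. -/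
def weilMatrix : A →ₐ[ℝ] Matrix (Fin (Module.finrank ℝ A)) (Fin (Module.finrank ℝ A)) ℝ :=
  have : Module.Finite ℝ A := IsWeilAlgebra.finite
  Algebra.leftMulMatrix (Module.finBasis ℝ A)

theorem weilMatrix_injective : Function.Injective (weilMatrix A) :=
  have : Module.Finite ℝ A := IsWeilAlgebra.finite
  Algebra.leftMulMatrix_injective (Module.finBasis ℝ A)

attribute [local instance] Matrix.linftyOpNormedRing Matrix.linftyOpNormedAlgebra

/-- A norm on a Weil algebra. -/
abbrev weilNormedCommRing : NormedCommRing A :=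
  NormedCommRing.induced A (Matrix (Fin (Module.finrank ℝ A)) (Fin (Module.finrank ℝ A)) ℝ)
    (weilMatrix A) (weilMatrix_injective A)

/-- A Weil algebra is a normed algebra. -/
abbrev weilNormedAlgebra : @NormedAlgebra ℝ A _ (weilNormedCommRing A).toSeminormedRing :=
  NormedAlgebra.induced ℝ A (Matrix (Fin (Module.finrank ℝ A)) (Fin (Module.finrank ℝ A)) ℝ)
    (weilMatrix A)

end WeilNorm

/-! ### Assembly for Weil algebras without a given norm -/

section Main

variable {n : ℕ} {M : Type*} [TopologicalSpace M] [T2Space M] [SecondCountableTopology M]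
  [ChartedSpace (EuclideanSpace ℝ (Fin n)) M] [IsManifold (𝓡 n) ∞ M]
  (A : Type*) [CommRing A] [Algebra ℝ A] [IsWeilAlgebra A]

theorem exists_isCanonicalIso_map_eq {p : Ideal (SmoothRing n M)}
    {q : JetSpace (SmoothRing n M) A} (h : p ≤ q.1) (hs : IsDerStable h) :
    ∃ κ : TangentModule q.1 ≃ₗ[ℝ] PointTangent (smoothJet (SmoothRing n M) A) q,
      IsCanonicalIso q κ ∧ Function.Surjective (toJetTangent h hs κ) ∧
        (prolongationDifferentials p q).map (toJetTangent h hs κ).dualMap =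
          realComponents (contactSystemPair h) := by
  -- The norm serves only the proof: the topologies and smooth functions in the statement are
  -- defined by real components alone.
  let _ := weilNormedCommRing A
  let _ := weilNormedAlgebra A
  have : FiniteDimensional ℝ A := IsWeilAlgebra.finite
  obtain ⟨κ, hκ⟩ := exists_isCanonicalIso (R := SmoothRing n M) (A := A) hasBoundedNhds hasCurves q
  have hq : IsJet q.1 := by
    obtain ⟨e⟩ := q.2
    have : Nontrivial (SmoothRing n M ⧸ q.1) := e.symm.injective.nontrivial
    exact isWeilAlgebra_of_surjective e.symm.toAlgHom e.symm.surjective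
  exact ⟨κ, hκ, toJetTangent_surjective h hs κ (exists_compDer_quotientProj_eq h),
    map_prolongationDifferentials hasBoundedNhds h hs hκ⟩

theorem exists_localSection_through {q : JetSpace (SmoothRing n M) A}
    {P : RegularPoint (SmoothRing n M) A} (hP : jetOf P = q) :
    ∃ s, IsLocalSection s q ∧ s q = P := by
  let _ := weilNormedCommRing A
  let _ := weilNormedAlgebra A
  have : FiniteDimensional ℝ A := IsWeilAlgebra.finite
  subst hP
  exact exists_isLocalSection hasBoundedNhds P

theorem component_section_prolongation {p : Ideal (SmoothRing n M)}
    {q : JetSpace (SmoothRing n M) A} (h : p ≤ q.1) (hst : IsDerStable h)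
    {κ : TangentModule q.1 ≃ₗ[ℝ] PointTangent (smoothJet (SmoothRing n M) A) q}
    (hκ : IsCanonicalIso q κ) {P : RegularPoint (SmoothRing n M) A} (hP : jetOf P = q)
    {s : JetSpace (SmoothRing n M) A → RegularPoint (SmoothRing n M) A} (hs : IsLocalSection s q)
    (hsP : s q = P) (f : p) (η : Module.Dual ℝ A) :
    (∃ F ∈ prolongation A p, ∀ᶠ r in 𝓝 q, F.1 r = component η f.1 (s r)) ∧
      ∀ F : smoothJet (SmoothRing n M) A, (∀ᶠ r in 𝓝 q, F.1 r = component η f.1 (s r)) →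
        ∀ t : TangentModule p,
          pointDifferential (smoothJet (SmoothRing n M) A) q F (toJetTangent h hst κ t) =
            η (residueMap P hP (pairDifferential h f t)) := by
  let _ := weilNormedCommRing A
  let _ := weilNormedAlgebra A
  have : FiniteDimensional ℝ A := IsWeilAlgebra.finite
  exact ⟨exists_mem_prolongation_component_section hasBoundedNhds hP hs hsP f.2 η,
    fun F hF t => toJetTangent_component_section hasBoundedNhds hκ h hst hP hs hsP f η hF t⟩

end Main

end

theorem mainTheorem9 {n : ℕ} {M : Type*} [TopologicalSpace M] [T2Space M]
    [SecondCountableTopology M] [ChartedSpace (EuclideanSpace ℝ (Fin n)) M]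
    [IsManifold (𝓡 n) ∞ M] (p : Ideal (SmoothRing n M)) [IsJet p] :
    (∀ (A' : Type*) [CommRing A'] [Algebra ℝ A'] [IsWeilAlgebra A']
        (q : JetSpace (SmoothRing n M) A') (h : p ≤ q.1) (hs : IsDerStable h),
        ∃ κ : TangentModule q.1 ≃ₗ[ℝ] PointTangent (smoothJet (SmoothRing n M) A') q,
          IsCanonicalIso q κ ∧
          Function.Surjective (toJetTangent h hs κ) ∧
          (prolongationDifferentials p q).map (toJetTangent h hs κ).dualMap =
            realComponents (contactSystemPair h)) ∧
    (IsJet (derivedIdeal p) ∧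
      ∃ hs : IsDerStable (le_derivedIdeal p),
        ∀ (A' : Type*) [CommRing A'] [Algebra ℝ A'] [IsWeilAlgebra A']
          (e : Nonempty ((SmoothRing n M ⧸ derivedIdeal p) ≃ₐ[ℝ] A')),
          ∃ κ : TangentModule (derivedJet p e).1 ≃ₗ[ℝ]
              PointTangent (smoothJet (SmoothRing n M) A') (derivedJet p e),
            IsCanonicalIso (derivedJet p e) κ ∧
            Function.Surjective (toJetTangent (q := derivedJet p e) (le_derivedIdeal p) hs κ) ∧
            (prolongationDifferentials p (derivedJet p e)).map
                (toJetTangent (q := derivedJet p e) (le_derivedIdeal p) hs κ).dualMap =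
              realComponents (contactSystem p) ∧
            ∀ (P : RegularPoint (SmoothRing n M) A') (hP : jetOf P = derivedJet p e),
              (∃ s, IsLocalSection s (derivedJet p e) ∧ s (derivedJet p e) = P) ∧
              ∀ s, IsLocalSection s (derivedJet p e) → s (derivedJet p e) = P →
                ∀ (f : p) (η : Module.Dual ℝ A'),
                  (∃ F ∈ prolongation A' p,
                    ∀ᶠ r in 𝓝 (derivedJet p e), F.1 r = component η f.1 (s r)) ∧
                  ∀ F : smoothJet (SmoothRing n M) A',
                    (∀ᶠ r in 𝓝 (derivedJet p e), F.1 r = component η f.1 (s r)) →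
                    ∀ t : TangentModule p,
                      pointDifferential (smoothJet (SmoothRing n M) A') (derivedJet p e) F
                          (toJetTangent (q := derivedJet p e) (le_derivedIdeal p) hs κ t) =
                        η (residueMap P hP (pairDifferential (le_derivedIdeal p) f t))) := by
  refine ⟨fun A' _ _ _ q h hs => exists_isCanonicalIso_map_eq A' h hs, isJet_derivedIdeal p,
    isDerStable_derivedIdeal p, fun A' _ _ _ e => ?_⟩
  obtain ⟨κ, hκ, hsurj, hmap⟩ := exists_isCanonicalIso_map_eq A' (q := derivedJet p e)
    (le_derivedIdeal p) (isDerStable_derivedIdeal p)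
  exact ⟨κ, hκ, hsurj, hmap, fun P hP => ⟨exists_localSection_through A' hP, fun s hs hsP f η =>
    component_section_prolongation A' (q := derivedJet p e) (le_derivedIdeal p)
      (isDerStable_derivedIdeal p) hκ hP hs hsP f η⟩⟩
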